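/- Let $\varphi\colon\mathbb C^n\to\mathbb R$ be a plurisubharmonic function of class $C^2$, let $\lambda$ be Lebesgue measure, and suppose that the weighted Bergman space $$A^2(\mathbb C^n,e^{-\varphi})=\Big\{f\colon\mathbb C^n\to\mathbb C\ \text{entire}:\ \int_{\mathbb C^n}|f|^2e^{-\varphi}\,d\lambda<\infty\Big\}$$ is infinite dimensional. For $0\le q\le n$ let $L^2_{0,q}(\mathbb C^n,e^{-\varphi})$ be the Hilbert space of $(0,q)$-forms $u=\sum_{|J|=q}u_J\,d\bar z_J$ (sum over increasing multiindices) with inner product $(u,v)_\varphi=\sum_{|J|=q}\int u_J\overline{v_J}\,e^{-\varphi}\,d\lambda$, let $\bar\partial$ be the maximal (distributional) Cauchy--Riemann operator between these spaces, $\bar\partial^*_\varphi$ its Hilbert space adjoint, and $\square^\varphi_{0,q}=\bar\partial\bar\partial^*_\varphi+\bar\partial^*_\varphi\bar\partial$ with domain $\{u\in\operatorname{dom}\bar\partial\cap\operatorname{dom}\bar\partial^*_\varphi:\ \bar\partial u\in\operatorname{dom}\bar\partial^*_\varphi,\ \bar\partial^*_\varphi u\in\operatorname{dom}\bar\partial\}$.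 The $\bar\partial$-Neumann operator $N^\varphi_{0,q}\colon\operatorname{im}\square^\varphi_{0,q}\to L^2_{0,q}(\mathbb C^n,e^{-\varphi})$ is the inverse of the restriction of $\square^\varphi_{0,q}$ to $\operatorname{dom}\square^\varphi_{0,q}\cap(\ker\square^\varphi_{0,q})^\perp$. If $N^\varphi_{0,q}$ is compact for some $1\le q\le n$, then $$\limsup_{z\to\infty}\operatorname{tr}M_\varphi(z)=+\infty,\qquad\text{where } M_\varphi(z)=\Big(\frac{\partial^2\varphi}{\partial z_j\,\partial\bar z_k}(z)\Big)_{j,k=1}^n .$$ -/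

import Mathlib

open MeasureTheory Filter
open scoped ENNReal ContDiff InnerProductSpace

namespace WeightedDbar

noncomputable section

/-! ### Wirtinger derivatives, complex Hessian, plurisubharmonicity

Complex `n`-space is `Fin n → ℂ` with its product (Lebesgue) measure; only its topology, its
differentiable structure and its Lebesgue measure are used, never the norm. -/

/-- `∂f/∂z_j = (∂f/∂x_j - i ∂f/∂y_j) / 2`. -/
def wirtinger {n : ℕ} (j : Fin n) (f : (Fin n → ℂ) → ℂ) (z : Fin n → ℂ) : ℂ :=
  (1 / 2 : ℂ) *
    (fderiv ℝ f z (Pi.single j 1) - Complex.I * fderiv ℝ f z (Pi.single j Complex.I))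

/-- `∂f/∂z̄_j = (∂f/∂x_j + i ∂f/∂y_j) / 2`. -/
def wirtingerBar {n : ℕ} (j : Fin n) (f : (Fin n → ℂ) → ℂ) (z : Fin n → ℂ) : ℂ :=
  (1 / 2 : ℂ) *
    (fderiv ℝ f z (Pi.single j 1) + Complex.I * fderiv ℝ f z (Pi.single j Complex.I))

/-- The complex Hessian `M_φ(z) = (∂²φ / ∂z_j ∂z̄_k (z))_{j,k}`. -/
def complexHessian {n : ℕ} (φ : (Fin n → ℂ) → ℝ) (z : Fin n → ℂ) : Matrix (Fin n) (Fin n) ℂ :=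
  Matrix.of fun j k => wirtinger j (wirtingerBar k fun w => (φ w : ℂ)) z

/-- Plurisubharmonicity of a finite-valued function on `ℂⁿ`: upper semicontinuity and the
sub-mean value inequality over the circles `a + e^{iθ} b` in all complex lines. (It is only
applied to continuous functions, for which the circle averages are honest integrals.) -/
def Plurisubharmonic {n : ℕ} (φ : (Fin n → ℂ) → ℝ) : Prop :=
  UpperSemicontinuous φ ∧
    ∀ a b : Fin n → ℂ, φ a ≤ Real.circleAverage (fun ζ : ℂ => φ (a + ζ • b)) 0 1

/-! ### The weighted Bergman space -/

/-- The entire functions `f` on `ℂⁿ` with `∫ |f|² e^{-φ} dλ < ∞`. -/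
def bergmanSpace {n : ℕ} (φ : (Fin n → ℂ) → ℝ) (hφ : ContDiff ℝ 2 φ) :
    Submodule ℂ ((Fin n → ℂ) → ℂ) where
  carrier := {f | Differentiable ℂ f ∧
    Integrable (fun z => ‖f z‖ ^ 2 * Real.exp (-φ z)) volume}
  zero_mem' := ⟨differentiable_const 0, by simp⟩
  add_mem' := by
    rintro f g ⟨hf, hf2⟩ ⟨hg, hg2⟩
    refine ⟨hf.add hg, ((hf2.add hg2).const_mul 2).mono' ?_ ?_⟩
    · exact ((((hf.add hg).continuous.norm.pow 2).mul
        (Real.continuous_exp.comp hφ.continuous.neg))).aestronglyMeasurable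
    · refine Eventually.of_forall fun z => ?_
      have h1 : ‖f z + g z‖ ^ 2 ≤ 2 * (‖f z‖ ^ 2 + ‖g z‖ ^ 2) := by
        have h2 := norm_add_le (f z) (g z)
        have h3 := norm_nonneg (f z + g z)
        nlinarith [sq_nonneg (‖f z‖ - ‖g z‖)]
      have he := Real.exp_pos (-φ z)
      rw [Real.norm_of_nonneg (by positivity)]
      simp only [Pi.add_apply]
      nlinarith [mul_le_mul_of_nonneg_right h1 he.le]
  smul_mem' := by
    rintro c f ⟨hf, hf2⟩
    refine ⟨hf.const_smul c, ?_⟩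
    have : (fun z => ‖(c • f) z‖ ^ 2 * Real.exp (-φ z))
        = fun z => ‖c‖ ^ 2 * (‖f z‖ ^ 2 * Real.exp (-φ z)) := by
      ext z
      simp only [Pi.smul_apply, smul_eq_mul, norm_mul]
      ring
    simp only [this]
    exact hf2.const_mul _

/-! ### Weighted square integrable `(0,q)`-forms -/

/-- The measure `e^{-φ} dλ`. -/
def weightedMeasure {n : ℕ} (φ : (Fin n → ℂ) → ℝ) : Measure (Fin n → ℂ) :=
  volume.withDensity fun z => ENNReal.ofReal (Real.exp (-φ z))

/-- Increasing multiindices `J = (j_1 < ⋯ < j_q)` in `{1, …, n}`, as `q`-element subsets. -/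
abbrev MultiIndex (n q : ℕ) : Type := {J : Finset (Fin n) // J.card = q}

/-- The multiindex `K \ j` for `j ∈ K`. -/
def MultiIndex.erase {n q : ℕ} (K : MultiIndex n (q + 1)) (j : {j : Fin n // j ∈ K.1}) :
    MultiIndex n q :=
  ⟨K.1.erase j.1, by rw [Finset.card_erase_of_mem j.2, K.2]; rfl⟩

/-- The sign `ε` with `dz̄_j ∧ dz̄_{K \ j} = ε dz̄_K` for `j ∈ K`. -/
def wedgeSign {n q : ℕ} (K : MultiIndex n (q + 1)) (j : Fin n) : ℂ :=
  (-1) ^ (K.1.filter fun i => i < j).card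

/-- The Hilbert space `L²_{0,q}(ℂⁿ, e^{-φ})`: the form `∑_J u_J dz̄_J` is given by the vector of
its coefficients, and `(u, v)_φ = ∑_J ∫ u_J conj(v_J) e^{-φ} dλ`
(Mathlib's `inner` is conjugate linear in its first argument, so this is `inner ℂ v u`). -/
abbrev L2Forms {n : ℕ} (φ : (Fin n → ℂ) → ℝ) (q : ℕ) : Type :=
  Lp (EuclideanSpace ℂ (MultiIndex n q)) 2 (weightedMeasure φ)

/-- `g = ∂̄ f` in the sense of distributions: for each multiindex `K` of length `q + 1`, the
coefficient `g_K` is the distribution `∑_{j ∈ K} ε ∂f_{K \ j}/∂z̄_j`. -/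
def IsWeakDbar {n q : ℕ} (f : (Fin n → ℂ) → EuclideanSpace ℂ (MultiIndex n q))
    (g : (Fin n → ℂ) → EuclideanSpace ℂ (MultiIndex n (q + 1))) : Prop :=
  ∀ (K : MultiIndex n (q + 1)) (χ : (Fin n → ℂ) → ℂ), ContDiff ℝ ∞ χ → HasCompactSupport χ →
    ∫ z, g z K * χ z =
      - ∑ j : {j : Fin n // j ∈ K.1},
          wedgeSign K j * ∫ z, f z (K.erase j) * wirtingerBar j χ z

/-! Facts needed to see that `∂̄` is a well-defined linear operator. -/

theorem volume_ac {n : ℕ} {φ : (Fin n → ℂ) → ℝ} (hφ : ContDiff ℝ 2 φ) :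
    (volume : Measure (Fin n → ℂ)) ≪ weightedMeasure φ := by
  refine withDensity_absolutelyContinuous' ?_ (Eventually.of_forall fun z => ?_)
  · exact (Real.continuous_exp.comp hφ.continuous.neg).measurable.ennreal_ofReal.aemeasurable
  · simp [Real.exp_pos]

theorem locallyIntegrable_coeff {n q : ℕ} {φ : (Fin n → ℂ) → ℝ} (hφ : ContDiff ℝ 2 φ)
    (f : L2Forms φ q) (J : MultiIndex n q) :
    LocallyIntegrable (fun z => f z J) (volume : Measure (Fin n → ℂ)) := by
  have hc : Continuous fun z => Real.exp (-φ z) := Real.continuous_exp.comp hφ.continuous.neg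
  have hm : Measurable fun z => Real.toNNReal (Real.exp (-φ z)) := hc.measurable.real_toNNReal
  have hmem := Lp.memLp f
  have haes : AEStronglyMeasurable (fun z => f z) (volume : Measure (Fin n → ℂ)) :=
    hmem.1.mono_ac (volume_ac hφ)
  have hJ : AEStronglyMeasurable (fun z => f z J) (volume : Measure (Fin n → ℂ)) :=
    (EuclideanSpace.proj (𝕜 := ℂ) J).continuous.comp_aestronglyMeasurable haes
  have h2 : Integrable (fun z => ‖f z‖ ^ 2) (weightedMeasure φ) :=
    (memLp_two_iff_integrable_sq_norm hmem.1).1 hmem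
  have h3 : Integrable (fun z => Real.exp (-φ z) * ‖f z‖ ^ 2) volume := by
    have := (integrable_withDensity_iff_integrable_smul (μ := volume) hm
      (g := fun z => ‖f z‖ ^ 2)).1 h2
    refine this.congr (Eventually.of_forall fun z => ?_)
    simp [NNReal.smul_def, Real.coe_toNNReal _ (Real.exp_pos _).le]
  have h4 : LocallyIntegrable (fun z => Real.exp (φ z) * (Real.exp (-φ z) * ‖f z‖ ^ 2) + 1)
      (volume : Measure (Fin n → ℂ)) := by
    refine LocallyIntegrable.add ?_ (locallyIntegrable_const 1)
    rw [locallyIntegrable_iff]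
    intro k hk
    exact (h3.integrableOn).continuousOn_mul
      (Real.continuous_exp.comp hφ.continuous).continuousOn hk
  refine h4.mono hJ (Eventually.of_forall fun z => ?_)
  have h5 : ‖f z J‖ ≤ ‖f z‖ := PiLp.norm_apply_le (f z) J
  have h6 : Real.exp (φ z) * (Real.exp (-φ z) * ‖f z‖ ^ 2) = ‖f z‖ ^ 2 := by
    rw [← mul_assoc, ← Real.exp_add]; simp
  rw [h6, Real.norm_of_nonneg (by positivity)]
  nlinarith [sq_nonneg (‖f z‖ - 1), norm_nonneg (f z)]

theorem continuous_wirtingerBar {n : ℕ} (j : Fin n) {χ : (Fin n → ℂ) → ℂ} (hχ : ContDiff ℝ ∞ χ) :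
    Continuous (wirtingerBar j χ) := by
  have h := hχ.continuous_fderiv (by simp)
  unfold wirtingerBar
  fun_prop

theorem hasCompactSupport_wirtingerBar {n : ℕ} (j : Fin n) {χ : (Fin n → ℂ) → ℂ}
    (hχ : HasCompactSupport χ) : HasCompactSupport (wirtingerBar j χ) := by
  refine (hχ.fderiv ℝ).mono fun z hz => ?_
  contrapose! hz
  simp only [Function.mem_support, not_not] at hz ⊢
  simp [wirtingerBar, hz]

theorem integrable_coeff_mul {n q : ℕ} {φ : (Fin n → ℂ) → ℝ} (hφ : ContDiff ℝ 2 φ)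
    (f : L2Forms φ q) (J : MultiIndex n q) {χ : (Fin n → ℂ) → ℂ} (hχ : Continuous χ)
    (hχc : HasCompactSupport χ) : Integrable (fun z => f z J * χ z) volume := by
  simpa using (locallyIntegrable_coeff hφ f J).integrable_smul_right_of_hasCompactSupport hχ hχc

theorem integral_coeff_add {n q : ℕ} {φ : (Fin n → ℂ) → ℝ} (hφ : ContDiff ℝ 2 φ)
    (f g : L2Forms φ q) (J : MultiIndex n q) {χ : (Fin n → ℂ) → ℂ} (hχ : Continuous χ)
    (hχc : HasCompactSupport χ) :
    ∫ z, (f + g : L2Forms φ q) z J * χ z = (∫ z, f z J * χ z) + ∫ z, g z J * χ z := by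
  rw [← integral_add (integrable_coeff_mul hφ f J hχ hχc) (integrable_coeff_mul hφ g J hχ hχc)]
  refine integral_congr_ae ((volume_ac hφ).ae_le ?_)
  filter_upwards [Lp.coeFn_add f g] with z hz
  simp only [hz, Pi.add_apply, PiLp.add_apply, add_mul]

theorem integral_coeff_smul {n q : ℕ} {φ : (Fin n → ℂ) → ℝ} (hφ : ContDiff ℝ 2 φ)
    (c : ℂ) (f : L2Forms φ q) (J : MultiIndex n q) (χ : (Fin n → ℂ) → ℂ) :
    ∫ z, (c • f : L2Forms φ q) z J * χ z = c * ∫ z, f z J * χ z := by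
  rw [← integral_const_mul]
  refine integral_congr_ae ((volume_ac hφ).ae_le ?_)
  filter_upwards [Lp.coeFn_smul c f] with z hz
  simp [hz, mul_assoc]

theorem integral_coeff_zero {n q : ℕ} {φ : (Fin n → ℂ) → ℝ} (hφ : ContDiff ℝ 2 φ)
    (J : MultiIndex n q) (χ : (Fin n → ℂ) → ℂ) :
    ∫ z, (0 : L2Forms φ q) z J * χ z = 0 := by
  simpa using integral_coeff_smul hφ 0 (0 : L2Forms φ q) J χ

/-! ### The operators `∂̄`, `∂̄*`, the complex Laplacian and the `∂̄`-Neumann operator -/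

/-- The graph of the maximal extension of `∂̄`: pairs `(f, ∂̄ f)` with
`f ∈ L²_{0,q}(ℂⁿ, e^{-φ})` and distributional `∂̄ f ∈ L²_{0,q+1}(ℂⁿ, e^{-φ})`. -/
def dbarGraph {n : ℕ} (φ : (Fin n → ℂ) → ℝ) (hφ : ContDiff ℝ 2 φ) (q : ℕ) :
    Submodule ℂ (L2Forms φ q × L2Forms φ (q + 1)) where
  carrier := {p | IsWeakDbar p.1 p.2}
  zero_mem' := by
    intro K χ _ _
    simp only [Prod.fst_zero, Prod.snd_zero, integral_coeff_zero hφ, mul_zero,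
      Finset.sum_const_zero, neg_zero]
  add_mem' := by
    intro p r hp hr K χ hχ hχc
    have hw := fun j => continuous_wirtingerBar (n := n) j hχ
    have hwc := fun j => hasCompactSupport_wirtingerBar (n := n) j hχc
    simp only [Prod.fst_add, Prod.snd_add]
    rw [integral_coeff_add hφ _ _ _ hχ.continuous hχc, hp K χ hχ hχc, hr K χ hχ hχc,
      ← neg_add, ← Finset.sum_add_distrib]
    congr 1
    refine Finset.sum_congr rfl fun j _ => ?_
    rw [integral_coeff_add hφ _ _ _ (hw j) (hwc j), mul_add]
  smul_mem' := by
    intro c p hp K χ hχ hχc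
    simp only [Prod.smul_fst, Prod.smul_snd]
    rw [integral_coeff_smul hφ, hp K χ hχ hχc, mul_neg, Finset.mul_sum]
    congr 1
    refine Finset.sum_congr rfl fun j _ => ?_
    rw [integral_coeff_smul hφ]
    ring

/-- The maximal (distributional) `∂̄` on `L²_{0,q}(ℂⁿ, e^{-φ})`, an unbounded operator. -/
def dbar {n : ℕ} (φ : (Fin n → ℂ) → ℝ) (hφ : ContDiff ℝ 2 φ) (q : ℕ) :
    L2Forms φ q →ₗ.[ℂ] L2Forms φ (q + 1) :=
  (dbarGraph φ hφ q).toLinearPMap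

/-- The distributional `∂̄ f` is unique, so that `dbar` is the operator with graph `dbarGraph`. -/
theorem dbar_graph {n : ℕ} (φ : (Fin n → ℂ) → ℝ) (hφ : ContDiff ℝ 2 φ) (q : ℕ) :
    (dbar φ hφ q).graph = dbarGraph φ hφ q := by
  refine Submodule.toLinearPMap_graph_eq _ ?_
  rintro ⟨f, g⟩ hfg hf
  change f = 0 at hf
  change g = 0
  subst hf
  have hJ : ∀ J, ∀ᵐ z ∂(volume : Measure (Fin n → ℂ)), g z J = 0 := by
    intro J
    refine ae_eq_zero_of_integral_contDiff_smul_eq_zero (locallyIntegrable_coeff hφ g J) ?_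
    intro χ hχ hχc
    have h := hfg J (fun z => (χ z : ℂ)) (Complex.ofRealCLM.contDiff.comp hχ)
      (hχc.comp_left (g := fun x : ℝ => (x : ℂ)) (by simp))
    simp only [integral_coeff_zero hφ, mul_zero, Finset.sum_const_zero, neg_zero] at h
    rw [← h]
    refine integral_congr_ae (Eventually.of_forall fun z => ?_)
    simp [mul_comm]
  refine (Lp.eq_zero_iff_ae_eq_zero).2 ((withDensity_absolutelyContinuous _ _).ae_le ?_)
  filter_upwards [ae_all_iff.2 hJ] with z hz
  ext J
  simpa using hz J

/-- The Hilbert space adjoint `∂̄*_φ` from `(0,q+1)`-forms to `(0,q)`-forms. -/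
def dbarStar {n : ℕ} (φ : (Fin n → ℂ) → ℝ) (hφ : ContDiff ℝ 2 φ) (q : ℕ) :
    L2Forms φ (q + 1) →ₗ.[ℂ] L2Forms φ q :=
  (dbar φ hφ q).adjoint

section Operators

variable {E F G : Type*} [AddCommGroup E] [Module ℂ E] [AddCommGroup F] [Module ℂ F]
  [AddCommGroup G] [Module ℂ G]

/-- The composition `S T` of unbounded operators, with domain `{x ∈ dom T : T x ∈ dom S}`. -/
def compose (S : F →ₗ.[ℂ] G) (T : E →ₗ.[ℂ] F) : E →ₗ.[ℂ] G :=
  S.comp (T.domRestrict ((S.domain.comap T.toFun).map T.domain.subtype)) (by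
    intro x
    obtain ⟨y, hy, hyx⟩ := (Submodule.mem_map).1 (Submodule.mem_inf.1 x.2).1
    have h : T.domRestrict ((S.domain.comap T.toFun).map T.domain.subtype) x = T y :=
      LinearPMap.domRestrict_apply hyx.symm
    rw [h]
    exact hy)

/-- The kernel of an unbounded operator, as a subspace of the ambient space. -/
def kernel (T : E →ₗ.[ℂ] F) : Submodule ℂ E :=
  (LinearMap.ker T.toFun).map T.domain.subtype

end Operators

/-- The complex Laplacian (Gaffney extension) `∂̄ ∂̄*_φ + ∂̄*_φ ∂̄` on `L²_{0,q}(ℂⁿ, e^{-φ})`; its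
domain consists of the `u ∈ dom ∂̄ ∩ dom ∂̄*_φ` with `∂̄ u ∈ dom ∂̄*_φ` and `∂̄*_φ u ∈ dom ∂̄`
(for `q = 0` the term `∂̄ ∂̄*_φ` is absent). -/
def complexLaplacian {n : ℕ} (φ : (Fin n → ℂ) → ℝ) (hφ : ContDiff ℝ 2 φ) :
    (q : ℕ) → L2Forms φ q →ₗ.[ℂ] L2Forms φ q
  | 0 => compose (dbarStar φ hφ 0) (dbar φ hφ 0)
  | q + 1 =>
      compose (dbar φ hφ q) (dbarStar φ hφ q) + compose (dbarStar φ hφ (q + 1)) (dbar φ hφ (q + 1))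

/-- The restriction of the complex Laplacian `□` to `dom □ ∩ (ker □)ᗮ`. -/
def restrictedLaplacian {n : ℕ} (φ : (Fin n → ℂ) → ℝ) (hφ : ContDiff ℝ 2 φ) (q : ℕ) :
    L2Forms φ q →ₗ.[ℂ] L2Forms φ q :=
  (complexLaplacian φ hφ q).domRestrict (kernel (complexLaplacian φ hφ q))ᗮ

/-- The restricted Laplacian is injective, so that its inverse makes sense. -/
theorem restrictedLaplacian_ker {n : ℕ} (φ : (Fin n → ℂ) → ℝ) (hφ : ContDiff ℝ 2 φ) (q : ℕ) :
    LinearMap.ker (restrictedLaplacian φ hφ q).toFun = ⊥ := by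
  rw [LinearMap.ker_eq_bot']
  rintro ⟨x, hx⟩ h
  obtain ⟨hx1, hx2⟩ := Submodule.mem_inf.1 hx
  have h0 : complexLaplacian φ hφ q ⟨x, hx2⟩ = 0 := by
    rw [← h]
    exact (LinearPMap.domRestrict_apply rfl).symm
  have hk : x ∈ kernel (complexLaplacian φ hφ q) := ⟨⟨x, hx2⟩, h0, rfl⟩
  have : x = 0 := inner_self_eq_zero.1 (Submodule.inner_right_of_mem_orthogonal hk hx1)
  exact Subtype.ext this

/-- The `∂̄`-Neumann operator `N_{0,q}^φ`: the inverse of the restricted Laplacian, defined on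
the range of the latter. -/
def dbarNeumann {n : ℕ} (φ : (Fin n → ℂ) → ℝ) (hφ : ContDiff ℝ 2 φ) (q : ℕ) :
    L2Forms φ q →ₗ.[ℂ] L2Forms φ q :=
  (restrictedLaplacian φ hφ q).inverse

/-- Compactness of the `∂̄`-Neumann operator: it maps a neighbourhood of zero of its domain (the
range of the Laplacian, with the norm of `L²_{0,q}`) into a compact subset of `L²_{0,q}`.
This holds if and only if it extends to a compact operator on all of `L²_{0,q}` that vanishes
on the kernel of the Laplacian. -/
def CompactDbarNeumann {n : ℕ} (φ : (Fin n → ℂ) → ℝ) (hφ : ContDiff ℝ 2 φ) (q : ℕ) : Prop :=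
  IsCompactOperator (dbarNeumann φ hφ q).toFun

end

end WeightedDbar

namespace WeightedDbar

open Metric
open scoped ComplexConjugate

/-! ### Wirtinger derivatives -/

section Wirtinger

variable {n : ℕ} {f g : (Fin n → ℂ) → ℂ} {z : Fin n → ℂ}

/-! Suppose the limsup is not `⊤`. Then the trace of the complex Hessian is bounded above on all of
`ℂⁿ`, and since the Levi form is nonnegative every entry `∂²φ/∂z_j∂z̄_k` is bounded
(`Plurisubharmonic.norm_complexHessian_le`). At unit scale the weight is then flat up to a
holomorphic change of gauge, uniformly in the centre, and translates of one fixed form show that the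
inverse of `□` is not compact.

The gauge (`exists_gauge`): about every point `a` there is a function `h`, holomorphic on the
polydisc of radius `1/2`, with `φ - 2 Re h` and `∂φ - ∂h` bounded independently of `a`. It is the
Cauchy transform of `φ` over the unit torus about `a`, up to an additive constant. Two applications
of an approximate Cauchy formula (`norm_integral_cauchyKernel_sub_le`), whose error is controlled by
`∂̄` of the function, show that `∂h` is close to `∂φ`: the functions `∂_j φ` are nearly holomorphic
because `∂̄_k ∂_j φ` is bounded.

The test forms (`exists_test_forms`): fix a smooth form `β` supported near `0` with `α = ∂̄β ≠ 0`,
and put `u_a = e^h α(· - a)`. Since `e^h` is holomorphic, `u_a = ∂̄(e^h β(· - a))`. Hence `u_a` is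
orthogonal to `ker □`, and `∂̄u_a = 0`, so that `□u_a = ∂̄∂̄*u_a`. Because `|e^h|² e^{-φ}` lies
between two positive constants, the norm of `u_a` is bounded below. In `∂̄∂̄*u_a` the weight enters,
apart from the factor `e^h`, only through `∂φ - ∂h` and `∂̄∂φ`, so `□u_a` is bounded.

For centres far apart the `u_a` have disjoint supports and are orthogonal. Thus the `∂̄`-Neumann
operator maps a bounded sequence to a separated one and is not compact (`not_compactDbarNeumann`).
The norm of `Fin n → ℂ` is the sup norm, so all balls below are polydiscs. -/

theorem clm_single_eq (L : (Fin n → ℂ) →L[ℝ] ℂ) (k : Fin n) (c : ℂ) :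
    L (Pi.single k c) = c.re * L (Pi.single k 1) + c.im * L (Pi.single k Complex.I) := by
  have h : (Pi.single k c : Fin n → ℂ)
      = c.re • (Pi.single k 1 : Fin n → ℂ) + c.im • (Pi.single k Complex.I : Fin n → ℂ) := by
    ext l
    by_cases hl : l = k
    · subst hl
      simp [Complex.re_add_im]
    · simp [hl]
  rw [h, map_add, map_smul, map_smul, Complex.real_smul, Complex.real_smul]

theorem fderiv_single (f : (Fin n → ℂ) → ℂ) (z : Fin n → ℂ) (k : Fin n) (c : ℂ) :
    fderiv ℝ f z (Pi.single k c) = wirtinger k f z * c + wirtingerBar k f z * conj c := by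
  rw [clm_single_eq, wirtinger, wirtingerBar]
  generalize fderiv ℝ f z (Pi.single k 1) = A
  generalize fderiv ℝ f z (Pi.single k Complex.I) = B
  have h1 : c = c.re + c.im * Complex.I := (Complex.re_add_im c).symm
  have h2 : conj c = c.re - c.im * Complex.I := by
    apply Complex.ext <;> simp
  rw [h2]
  nth_rewrite 3 [h1]
  linear_combination (B * (c.im : ℂ)) * Complex.I_mul_I

/-- The splitting of a real differential into its complex linear and antilinear parts; it links
`fderiv` with the Wirtinger derivatives in the Cauchy formula and in gradient bounds. -/
theorem fderiv_eq_sum (f : (Fin n → ℂ) → ℂ) (z v : Fin n → ℂ) :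
    fderiv ℝ f z v = ∑ k, (wirtinger k f z * v k + wirtingerBar k f z * conj (v k)) := by
  conv_lhs => rw [← Finset.univ_sum_single v, map_sum]
  exact Finset.sum_congr rfl fun k _ => fderiv_single f z k (v k)

end Wirtinger

/-! ### Integration over the torus -/

section Torus

variable {n : ℕ}

/-- The point of the unit torus in `ℂⁿ` with the given angles. -/
noncomputable def torusPt (θ : Fin n → UnitAddCircle) : Fin n → ℂ :=
  fun k => (AddCircle.toCircle (θ k) : ℂ)

theorem continuous_torusPt : Continuous (torusPt (n := n)) :=
  continuous_pi fun k =>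
    continuous_induced_dom.comp (AddCircle.continuous_toCircle.comp (continuous_apply k))

@[fun_prop]
theorem continuous_torusPt_apply (k : Fin n) : Continuous fun θ => torusPt θ k :=
  (continuous_apply k).comp continuous_torusPt

@[simp]
theorem norm_torusPt_apply (θ : Fin n → UnitAddCircle) (k : Fin n) : ‖torusPt θ k‖ = 1 :=
  Circle.norm_coe _

theorem torusPt_mul_conj (θ : Fin n → UnitAddCircle) (k : Fin n) :
    torusPt θ k * conj (torusPt θ k) = 1 := by
  rw [Complex.mul_conj, Complex.normSq_eq_norm_sq]; simp

theorem norm_torusPt_le (θ : Fin n → UnitAddCircle) : ‖torusPt θ‖ ≤ 1 :=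
  (pi_norm_le_iff_of_nonneg zero_le_one).2 fun k => (norm_torusPt_apply θ k).le

theorem torusPt_add_single (θ : Fin n → UnitAddCircle) (k : Fin n) (s : ℝ) :
    torusPt (θ + Pi.single k (s : UnitAddCircle)) k
      = Complex.exp (2 * Real.pi * s * Complex.I) * torusPt θ k := by
  simp only [torusPt, Pi.add_apply, Pi.single_eq_same, AddCircle.toCircle_add, Circle.coe_mul,
    AddCircle.toCircle_apply_mk, Circle.coe_exp]
  rw [mul_comm]
  push_cast
  simp

theorem torusPt_add_single_of_ne (θ : Fin n → UnitAddCircle) {k l : Fin n} (h : l ≠ k) (s : ℝ) :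
    torusPt (θ + Pi.single k (s : UnitAddCircle)) l = torusPt θ l := by
  simp [torusPt, h]

theorem hasDerivAt_torusPt_apply (θ : Fin n → UnitAddCircle) (k : Fin n) :
    HasDerivAt (fun s : ℝ => torusPt (θ + Pi.single k (s : UnitAddCircle)) k)
      (2 * Real.pi * (Complex.I * torusPt θ k)) 0 := by
  simp only [torusPt_add_single]
  have h1 : HasDerivAt (fun s : ℝ => (2 * Real.pi * (s : ℂ) * Complex.I))
      (2 * Real.pi * Complex.I) 0 := by
    simpa using ((Complex.ofRealCLM.hasDerivAt (x := (0 : ℝ))).const_mul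
      (2 * (Real.pi : ℂ))).mul_const Complex.I
  have h2 := (h1.cexp).mul_const (torusPt θ k)
  refine h2.congr_deriv ?_
  rw [Complex.ofReal_zero, mul_zero, zero_mul, Complex.exp_zero]
  ring

theorem hasDerivAt_torusPt (θ : Fin n → UnitAddCircle) (k : Fin n) :
    HasDerivAt (fun s : ℝ => torusPt (θ + Pi.single k (s : UnitAddCircle)))
      (Pi.single k (2 * Real.pi * (Complex.I * torusPt θ k))) 0 := by
  rw [hasDerivAt_pi]
  intro l
  by_cases hl : l = k
  · subst hl
    simpa using hasDerivAt_torusPt_apply θ l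
  · simp only [torusPt_add_single_of_ne θ hl, Pi.single_eq_of_ne hl]
    exact hasDerivAt_const _ _

/-- Angles live in `ℝ/ℤ`, so torus integrals are means. The price is a factor `2π` in every
derivative along a rotation. -/
instance : IsProbabilityMeasure (volume : Measure (Fin n → UnitAddCircle)) := by
  have : IsProbabilityMeasure (volume : Measure UnitAddCircle) :=
    ⟨UnitAddCircle.measure_univ⟩
  infer_instance

theorem integrable_torus {g : (Fin n → UnitAddCircle) → ℂ} (hg : Continuous g) :
    Integrable g volume := by
  simpa using hg.continuousOn.integrableOn_compact (μ := volume) isCompact_univ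

theorem continuous_rotation (k : Fin n) :
    Continuous fun p : ℝ × (Fin n → UnitAddCircle) =>
      p.2 + Pi.single k (p.1 : UnitAddCircle) := by
  refine continuous_snd.add ?_
  refine (continuous_single k).comp ?_
  exact (AddCircle.continuous_mk' 1).comp continuous_fst

/-- The derivative of a function on the torus along a rotation has mean zero. -/
theorem integral_rotation_deriv {g g' : (Fin n → UnitAddCircle) → ℂ} (k : Fin n)
    (hgc : Continuous g) (hg' : Continuous g')
    (hg : ∀ θ, HasDerivAt (fun s : ℝ => g (θ + Pi.single k (s : UnitAddCircle))) (g' θ) 0) :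
    ∫ θ, g' θ = 0 := by
  have hrot := continuous_rotation (n := n) k
  have hder : ∀ (θ : Fin n → UnitAddCircle) (s : ℝ), HasDerivAt (fun s : ℝ => g (θ + Pi.single k (s : UnitAddCircle)))
      (g' (θ + Pi.single k (s : UnitAddCircle))) s := by
    intro θ s
    have h := (hg (θ + Pi.single k (s : UnitAddCircle)))
    have h2 := HasDerivAt.comp_sub_const s s (by rwa [sub_self])
    refine h2.congr_of_eventuallyEq (Eventually.of_forall fun t => ?_)
    simp only [add_assoc]
    rw [← Pi.single_add, ← AddCircle.coe_add, add_sub_cancel]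
  have hftc : ∀ θ : Fin n → UnitAddCircle, ∫ s in (0 : ℝ)..1, g' (θ + Pi.single k (s : UnitAddCircle))
      = g (θ + Pi.single k ((1 : ℝ) : UnitAddCircle)) - g θ := by
    intro θ
    rw [intervalIntegral.integral_eq_sub_of_hasDerivAt (fun s _ => hder θ s)]
    · simp
    · refine Continuous.intervalIntegrable ?_ _ _
      exact hg'.comp (hrot.comp (Continuous.prodMk continuous_id continuous_const))
  -- Both endpoint terms have the same mean by invariance of the measure. After Fubini, invariance
  -- also makes the inner integral independent of `s`, hence equal to the mean of `g'`.
  have hzero : ∫ θ : Fin n → UnitAddCircle, ∫ s in (0 : ℝ)..1, g' (θ + Pi.single k (s : UnitAddCircle)) = 0 := by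
    simp only [hftc]
    have h1 : Integrable fun θ : Fin n → UnitAddCircle =>
        g (θ + Pi.single k ((1 : ℝ) : UnitAddCircle)) :=
      integrable_torus (hgc.comp (continuous_add_const _))
    rw [integral_sub h1 (integrable_torus hgc), integral_add_right_eq_self, sub_self]
  have hswap : ∫ θ : Fin n → UnitAddCircle, ∫ s in (0 : ℝ)..1, g' (θ + Pi.single k (s : UnitAddCircle))
      = ∫ s in (0 : ℝ)..1, ∫ θ : Fin n → UnitAddCircle, g' (θ + Pi.single k (s : UnitAddCircle)) := by
    simp only [intervalIntegral.integral_of_le zero_le_one]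
    refine integral_integral_swap (μ := (volume : Measure (Fin n → UnitAddCircle))) (ν := volume.restrict (Set.Ioc (0 : ℝ) 1))
      (f := fun (θ : Fin n → UnitAddCircle) (s : ℝ) => g' (θ + Pi.single k (s : UnitAddCircle))) ?_
    obtain ⟨B, hB⟩ := (isCompact_univ.image hg').isBounded.exists_norm_le
    refine Integrable.mono' (integrable_const B) ?_ (Eventually.of_forall fun p => ?_)
    · exact (hg'.comp (hrot.comp continuous_swap)).aestronglyMeasurable
    · exact hB _ ⟨_, trivial, rfl⟩
  rw [hswap] at hzero
  simpa [integral_add_right_eq_self] using hzero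

end Torus

/-! ### The Cauchy kernel and an approximate Cauchy formula on the polydisc. -/

section CauchyKernel

variable {n : ℕ}

/-- Integration by parts on the torus, along the rotations of the `k`-th coordinate, for functions
pulled back by the homothety of centre `z` and ratio `t`. -/
theorem integral_rotation_by_parts {f : (Fin n → ℂ) → ℂ} (z : Fin n → ℂ) (t : ℝ) (k : Fin n)
    (hf : ∀ θ, DifferentiableAt ℝ f (z + t • (torusPt θ - z)))
    (hf' : Continuous fun θ => fderiv ℝ f (z + t • (torusPt θ - z)))
    {c c' : (Fin n → UnitAddCircle) → ℂ} (hcc : Continuous c) (hcc' : Continuous c')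
    (hc : ∀ θ, HasDerivAt (fun s : ℝ => c (θ + Pi.single k (s : UnitAddCircle)))
      (2 * Real.pi * Complex.I * c' θ) 0) :
    ∫ θ, (c' θ * f (z + t • (torusPt θ - z)) + t * (c θ *
      (wirtinger k f (z + t • (torusPt θ - z)) * torusPt θ k
        - wirtingerBar k f (z + t • (torusPt θ - z)) * conj (torusPt θ k)))) = 0 := by
  set p : (Fin n → UnitAddCircle) → (Fin n → ℂ) := fun θ => z + t • (torusPt θ - z) with hp
  have hpc : Continuous p := by
    have := continuous_torusPt (n := n)
    fun_prop
  have hfp : Continuous fun θ => f (p θ) :=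
    continuous_iff_continuousAt.2 fun θ =>
      ContinuousAt.comp (g := f) (hf θ).continuousAt hpc.continuousAt
  have hpd : ∀ θ, HasDerivAt (fun s : ℝ => p (θ + Pi.single k (s : UnitAddCircle)))
      (t • Pi.single k (2 * Real.pi * (Complex.I * torusPt θ k))) 0 := fun θ =>
    (((hasDerivAt_torusPt θ k).sub_const z).const_smul t).const_add z
  have hw : Continuous fun θ => wirtinger k f (p θ) := by unfold wirtinger; fun_prop
  have hwb : Continuous fun θ => wirtingerBar k f (p θ) := by unfold wirtingerBar; fun_prop
  have hconj : Continuous fun θ => conj (torusPt θ k) :=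
    Complex.continuous_conj.comp (continuous_torusPt_apply k)
  -- The factor `2πi` is common to the derivatives of `c` and of the torus point. Conjugating it
  -- changes its sign, hence the minus before `wirtingerBar`.
  have key := integral_rotation_deriv k (g := fun θ => c θ * f (p θ))
    (g' := fun θ => 2 * Real.pi * Complex.I * (c' θ * f (p θ) + t * (c θ *
      (wirtinger k f (p θ) * torusPt θ k - wirtingerBar k f (p θ) * conj (torusPt θ k)))))
    (hcc.mul hfp)
    (continuous_const.mul ((hcc'.mul hfp).add (continuous_const.mul (hcc.mul
      ((hw.mul (continuous_torusPt_apply k)).sub (hwb.mul hconj)))))) (fun θ => by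
      have h0 : p (θ + Pi.single k ((0 : ℝ) : UnitAddCircle)) = p θ := by simp
      have h1 : HasDerivAt (fun s : ℝ => f (p (θ + Pi.single k (s : UnitAddCircle))))
          (fderiv ℝ f (p θ) (t • Pi.single k (2 * Real.pi * (Complex.I * torusPt θ k)))) 0 := by
        have h2 := (hf θ).hasFDerivAt
        change HasFDerivAt f _ (p θ) at h2
        rw [← h0] at h2
        have h3 := HasFDerivAt.comp_hasDerivAt (0 : ℝ) h2 (hpd θ)
        exact h3
      refine ((hc θ).mul h1).congr_deriv ?_
      have h4 : ((θ : Fin n → UnitAddCircle) + Pi.single k ((0 : ℝ) : UnitAddCircle)) = θ := by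
        simp
      rw [h4, map_smul, fderiv_single, Complex.real_smul]
      simp only [map_mul, Complex.conj_I, Complex.conj_ofReal, map_ofNat]
      ring)
  rw [integral_const_mul] at key
  exact (mul_eq_zero.1 key).resolve_left (by simp [Real.pi_ne_zero])

/-- The product over `k ∈ s` of the Cauchy kernels `w_k / (w_k - z_k)`, for `|w_k| = 1`. -/
noncomputable def cauchyKernel (s : Finset (Fin n)) (z w : Fin n → ℂ) : ℂ :=
  ∏ k ∈ s, (1 - z k * conj (w k))⁻¹

theorem norm_mul_conj_torusPt_le {z : Fin n → ℂ} {r : ℝ} (hz : ‖z‖ ≤ r)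
    (θ : Fin n → UnitAddCircle) (k : Fin n) : ‖z k * conj (torusPt θ k)‖ ≤ r := by
  rw [norm_mul, RCLike.norm_conj, norm_torusPt_apply, mul_one]
  exact (norm_le_pi_norm z k).trans hz

theorem one_sub_ne_zero_of_norm_lt {a : ℂ} (ha : ‖a‖ < 1) : 1 - a ≠ 0 := by
  intro h
  rw [← sub_eq_zero.1 h] at ha
  simp at ha

theorem norm_inv_one_sub_le {a : ℂ} (ha : ‖a‖ ≤ 1 / 2) : ‖(1 - a)⁻¹‖ ≤ 2 := by
  rw [norm_inv]
  have h := norm_sub_norm_le (1 : ℂ) a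
  rw [norm_one] at h
  rw [inv_le_comm₀ (by linarith) (by norm_num)]
  linarith

theorem norm_cauchyKernel_le {z : Fin n → ℂ} (hz : ‖z‖ ≤ 1 / 2) (s : Finset (Fin n))
    (θ : Fin n → UnitAddCircle) : ‖cauchyKernel s z (torusPt θ)‖ ≤ 2 ^ n := by
  rw [cauchyKernel, norm_prod]
  calc ∏ k ∈ s, ‖(1 - z k * conj (torusPt θ k))⁻¹‖ ≤ ∏ k ∈ s, (2 : ℝ) :=
        Finset.prod_le_prod (fun _ _ => norm_nonneg _) fun k _ =>
          norm_inv_one_sub_le (norm_mul_conj_torusPt_le hz θ k)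
    _ = 2 ^ s.card := by simp
    _ ≤ 2 ^ n := pow_le_pow_right₀ one_le_two (by simpa using s.card_le_univ)

theorem continuous_one_sub_inv {z : Fin n → ℂ} (hz : ‖z‖ < 1) (k : Fin n) :
    Continuous fun θ => (1 - z k * conj (torusPt θ k))⁻¹ := by
  have hconj : Continuous fun θ => conj (torusPt θ k) :=
    Complex.continuous_conj.comp (continuous_torusPt_apply k)
  refine Continuous.inv₀ (by fun_prop) fun θ => one_sub_ne_zero_of_norm_lt ?_
  exact (norm_mul_conj_torusPt_le le_rfl θ k).trans_lt hz

theorem continuous_cauchyKernel {z : Fin n → ℂ} (hz : ‖z‖ < 1) (s : Finset (Fin n)) :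
    Continuous fun θ => cauchyKernel s z (torusPt θ) := by
  unfold cauchyKernel
  exact continuous_finsetProd _ fun k _ => continuous_one_sub_inv hz k

theorem cauchyKernel_rotate {s : Finset (Fin n)} {k : Fin n} (hk : k ∉ s) (z : Fin n → ℂ)
    (θ : Fin n → UnitAddCircle) (r : ℝ) :
    cauchyKernel s z (torusPt (θ + Pi.single k (r : UnitAddCircle)))
      = cauchyKernel s z (torusPt θ) := by
  refine Finset.prod_congr rfl fun l hl => ?_
  rw [torusPt_add_single_of_ne θ (by rintro rfl; exact hk hl)]

theorem hasDerivAt_conj_torusPt (θ : Fin n → UnitAddCircle) (k : Fin n) :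
    HasDerivAt (fun s : ℝ => conj (torusPt (θ + Pi.single k (s : UnitAddCircle)) k))
      (-(2 * Real.pi * Complex.I * conj (torusPt θ k))) 0 := by
  refine (hasDerivAt_torusPt_apply θ k).star.congr_deriv ?_
  change conj (2 * Real.pi * (Complex.I * torusPt θ k)) = _
  simp only [map_mul, Complex.conj_I, Complex.conj_ofReal, map_ofNat]
  ring

/-- The derivative along rotations of the logarithm of the Cauchy kernel. -/
theorem hasDerivAt_log_kernel {z : Fin n → ℂ} (hz : ‖z‖ < 1) (θ : Fin n → UnitAddCircle)
    (k : Fin n) :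
    HasDerivAt (fun s : ℝ =>
      Complex.log (1 - z k * conj (torusPt (θ + Pi.single k (s : UnitAddCircle)) k)))
      (2 * Real.pi * Complex.I * ((1 - z k * conj (torusPt θ k))⁻¹ - 1)) 0 := by
  have h0 : ((θ : Fin n → UnitAddCircle) + Pi.single k ((0 : ℝ) : UnitAddCircle)) = θ := by simp
  have hlt : ‖z k * conj (torusPt θ k)‖ < 1 := (norm_mul_conj_torusPt_le le_rfl θ k).trans_lt hz
  have hne := one_sub_ne_zero_of_norm_lt hlt
  have h1 := ((hasDerivAt_conj_torusPt θ k).const_mul (z k)).const_sub 1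
  have hslit : 1 - z k * conj (torusPt θ k) ∈ Complex.slitPlane := by
    left
    have := (Complex.re_le_norm (z k * conj (torusPt θ k))).trans_lt hlt
    rw [Complex.sub_re, Complex.one_re]
    linarith
  have h2 := h1.clog_real (by rw [h0]; exact hslit)
  refine h2.congr_deriv ?_
  rw [h0]
  field_simp
  ring

theorem continuous_log_kernel {z : Fin n → ℂ} (hz : ‖z‖ < 1) (k : Fin n) :
    Continuous fun θ => Complex.log (1 - z k * conj (torusPt θ k)) := by
  have hconj : Continuous fun θ => conj (torusPt θ k) :=
    Complex.continuous_conj.comp (continuous_torusPt_apply k)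
  refine Continuous.clog (by fun_prop) fun θ => ?_
  left
  have := (Complex.re_le_norm (z k * conj (torusPt θ k))).trans_lt
    ((norm_mul_conj_torusPt_le le_rfl θ k).trans_lt hz)
  rw [Complex.sub_re, Complex.one_re]
  linarith

/-- Factors can be dropped one by one: `(1 - z_k w̄_k)⁻¹ - 1` is, up to `2πi`, the rotation
derivative of `log (1 - z_k w̄_k)`. The other factors do not depend on the `k`-th angle, so its
product with them has mean zero. -/
theorem integral_cauchyKernel {z : Fin n → ℂ} (hz : ‖z‖ < 1) (s : Finset (Fin n)) :
    ∫ θ, cauchyKernel s z (torusPt θ) = 1 := by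
  induction s using Finset.induction_on with
  | empty => simp [cauchyKernel]
  | insert k s hk ih =>
    have key := integral_rotation_deriv k
      (g := fun θ => Complex.log (1 - z k * conj (torusPt θ k)) * cauchyKernel s z (torusPt θ))
      (g' := fun θ => 2 * Real.pi * Complex.I *
        (((1 - z k * conj (torusPt θ k))⁻¹ - 1) * cauchyKernel s z (torusPt θ)))
      ((continuous_log_kernel hz k).mul (continuous_cauchyKernel hz s))
      (continuous_const.mul (((continuous_one_sub_inv hz k).sub continuous_const).mul
        (continuous_cauchyKernel hz s)))
      (fun θ => by
        simp only [cauchyKernel_rotate hk]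
        refine ((hasDerivAt_log_kernel hz θ k).mul_const _).congr_deriv ?_
        ring)
    rw [integral_const_mul] at key
    have key2 := (mul_eq_zero.1 key).resolve_left (by simp [Real.pi_ne_zero])
    simp only [sub_mul, one_mul] at key2
    have hint : Integrable fun θ =>
        (1 - z k * conj (torusPt θ k))⁻¹ * cauchyKernel s z (torusPt θ) :=
      integrable_torus ((continuous_one_sub_inv hz k).mul (continuous_cauchyKernel hz s))
    rw [integral_sub hint (integrable_torus (continuous_cauchyKernel hz s)), ih,
      sub_eq_zero] at key2
    rw [← key2]
    simp only [cauchyKernel, Finset.prod_insert hk]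

theorem cauchyKernel_univ_eq (z w : Fin n → ℂ) (k : Fin n) :
    cauchyKernel Finset.univ z w
      = (1 - z k * conj (w k))⁻¹ * cauchyKernel (Finset.univ.erase k) z w :=
  (Finset.mul_prod_erase _ _ (Finset.mem_univ k)).symm

/-- Since `w w̄ = 1`, one has `w - z = w (1 - z w̄)`, which cancels the `k`-th Cauchy factor. The
remaining kernel is invariant under the `k`-th rotation and survives integration by parts
undifferentiated. -/
theorem torusPt_sub_mul_cauchyKernel {z : Fin n → ℂ} (hz : ‖z‖ < 1) (θ : Fin n → UnitAddCircle)
    (k : Fin n) :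
    (torusPt θ k - z k) * cauchyKernel Finset.univ z (torusPt θ)
      = torusPt θ k * cauchyKernel (Finset.univ.erase k) z (torusPt θ) := by
  have hne := one_sub_ne_zero_of_norm_lt ((norm_mul_conj_torusPt_le le_rfl θ k).trans_lt hz)
  rw [cauchyKernel_univ_eq z _ k]
  field_simp
  linear_combination ((z k * cauchyKernel (Finset.univ.erase k) z (torusPt θ))) *
    torusPt_mul_conj θ k

/-- Approximate Cauchy formula on the polydisc. -/
theorem norm_integral_cauchyKernel_sub_le {f : (Fin n → ℂ) → ℂ} {C : ℝ}
    (hf : ∀ p ∈ closedBall (0 : Fin n → ℂ) 1, DifferentiableAt ℝ f p)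
    (hf' : ContinuousOn (fderiv ℝ f) (closedBall 0 1))
    (hC : ∀ p ∈ closedBall (0 : Fin n → ℂ) 1, ∀ k, ‖wirtingerBar k f p‖ ≤ C)
    {z : Fin n → ℂ} (hz : ‖z‖ ≤ 1 / 2) :
    ‖(∫ θ, f (torusPt θ) * cauchyKernel Finset.univ z (torusPt θ)) - f z‖
      ≤ n * (2 ^ n * 3 * C) := by
  have hz1 : ‖z‖ < 1 := by linarith
  have hC0 : ∀ k : Fin n, 0 ≤ C := fun k =>
    (norm_nonneg _).trans (hC 0 (by simp) k)
  set p : ℝ → (Fin n → UnitAddCircle) → (Fin n → ℂ) := fun t θ => z + t • (torusPt θ - z) with hp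
  have hpball : ∀ t ∈ Set.Icc (0 : ℝ) 1, ∀ θ, p t θ ∈ closedBall (0 : Fin n → ℂ) 1 := by
    intro t ht θ
    refine (convex_closedBall (0 : Fin n → ℂ) 1).add_smul_sub_mem ?_ ?_ ht
    · simpa using hz1.le
    · simpa using norm_torusPt_le θ
  have hT := continuous_torusPt (n := n)
  have hpc : Continuous fun q : ℝ × (Fin n → UnitAddCircle) => p q.1 q.2 := by
    simp only [hp]; fun_prop
  have hDc : ContinuousOn (fun q : ℝ × (Fin n → UnitAddCircle) => fderiv ℝ f (p q.1 q.2))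
      (Set.Icc 0 1 ×ˢ Set.univ) :=
    hf'.comp hpc.continuousOn fun q hq => hpball _ hq.1 _
  set D : ℝ → (Fin n → UnitAddCircle) → ℂ := fun t θ => fderiv ℝ f (p t θ) (torusPt θ - z) with hD
  set K : (Fin n → UnitAddCircle) → ℂ := fun θ => cauchyKernel Finset.univ z (torusPt θ) with hK
  have hKc : Continuous K := continuous_cauchyKernel hz1 _
  have hDKc : ContinuousOn (fun q : ℝ × (Fin n → UnitAddCircle) => D q.1 q.2 * K q.2)
      (Set.Icc 0 1 ×ˢ Set.univ) :=
    (hDc.clm_apply (by fun_prop)).mul (by fun_prop)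
  have hftc : ∀ θ, ∫ t in (0 : ℝ)..1, D t θ = f (torusPt θ) - f z := by
    intro θ
    have hcont : ContinuousOn (fun t => D t θ) (Set.uIcc 0 1) := by
      rw [Set.uIcc_of_le zero_le_one]
      refine ContinuousOn.clm_apply (hDc.comp (f := fun t : ℝ => (t, θ)) (by fun_prop) ?_)
        continuousOn_const
      exact fun t ht => ⟨ht, trivial⟩
    rw [intervalIntegral.integral_eq_sub_of_hasDerivAt (f := fun t => f (p t θ)) ?_
      hcont.intervalIntegrable]
    · simp [hp]
    · intro t ht
      rw [Set.uIcc_of_le zero_le_one] at ht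
      have h1 : HasDerivAt (fun t : ℝ => p t θ) (torusPt θ - z) t := by
        have h2 := ((hasDerivAt_id t).smul_const (torusPt θ - z)).const_add z
        rwa [one_smul] at h2
      exact (hf _ (hpball t ht θ)).hasFDerivAt.comp_hasDerivAt t h1
  have hfc : Continuous fun θ => f (torusPt θ) :=
    continuous_iff_continuousAt.2 fun θ => ContinuousAt.comp (g := f)
      (hf _ (by simpa using norm_torusPt_le θ)).continuousAt hT.continuousAt
  -- The kernel has mean one, so the error is the mean of `(f(w) - f(z)) K`, and `f(w) - f(z)` is an
  -- integral of `D` along the segment from `z` to `w`.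
  have hswap : (∫ θ, f (torusPt θ) * K θ) - f z = ∫ t in (0 : ℝ)..1, ∫ θ, D t θ * K θ := by
    have h1 : f z = ∫ θ, f z * K θ := by
      rw [integral_const_mul, hK, integral_cauchyKernel hz1, mul_one]
    have h2 : Integrable fun θ => f (torusPt θ) * K θ := integrable_torus (hfc.mul hKc)
    have h3 : Integrable fun θ => f z * K θ := integrable_torus (continuous_const.mul hKc)
    rw [h1]
    rw [← integral_sub h2 h3]
    simp only [← sub_mul, ← hftc, intervalIntegral.integral_of_le zero_le_one,
      ← integral_mul_const]
    refine (integral_integral_swap (μ := volume.restrict (Set.Ioc (0 : ℝ) 1))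
      (ν := (volume : Measure (Fin n → UnitAddCircle))) (f := fun t θ => D t θ * K θ) ?_).symm
    have h4 : IntegrableOn (fun q : ℝ × (Fin n → UnitAddCircle) => D q.1 q.2 * K q.2)
        (Set.Icc 0 1 ×ˢ Set.univ) (volume.prod volume) :=
      hDKc.integrableOn_compact (isCompact_Icc.prod isCompact_univ)
    have h5 := h4.mono_set (Set.prod_mono_left Set.Ioc_subset_Icc_self)
    rwa [IntegrableOn, ← Measure.prod_restrict, Measure.restrict_univ] at h5
  rw [hswap]
  refine (intervalIntegral.norm_integral_le_of_norm_le_const (C := n * (2 ^ n * 3 * C))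
    fun t ht => ?_).trans (by simp)
  rw [Set.uIoc_of_le zero_le_one] at ht
  have htI : t ∈ Set.Icc (0 : ℝ) 1 := Set.Ioc_subset_Icc_self ht
  have hDt : Continuous fun θ => fderiv ℝ f (p t θ) := by
    rw [← continuousOn_univ]
    exact hDc.comp (f := fun θ => (t, θ)) (by fun_prop) fun θ _ => ⟨htI, trivial⟩
  have hw : ∀ k, Continuous fun θ => wirtinger k f (p t θ) := fun k => by
    unfold wirtinger; fun_prop
  have hwb : ∀ k, Continuous fun θ => wirtingerBar k f (p t θ) := fun k => by
    unfold wirtingerBar; fun_prop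
  have hconj : ∀ k : Fin n, Continuous fun θ => conj (torusPt θ k) := fun k =>
    Complex.continuous_conj.comp (continuous_torusPt_apply k)
  have hconj2 : ∀ k, Continuous fun θ => conj (torusPt θ k - z k) := fun k =>
    Complex.continuous_conj.comp ((continuous_torusPt_apply k).sub continuous_const)
  set R : Fin n → (Fin n → UnitAddCircle) → ℂ :=
    fun k θ => cauchyKernel (Finset.univ.erase k) z (torusPt θ) with hR
  have hRc : ∀ k, Continuous (R k) := fun k => continuous_cauchyKernel hz1 _
  have hterm : ∀ k, Continuous fun θ => wirtinger k f (p t θ) * (torusPt θ k * R k θ) :=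
    fun k => (hw k).mul ((continuous_torusPt_apply k).mul (hRc k))
  have hterm2 : ∀ k, Continuous fun θ =>
      wirtingerBar k f (p t θ) * (conj (torusPt θ k - z k) * K θ) :=
    fun k => (hwb k).mul ((hconj2 k).mul hKc)
  have hterm3 : ∀ k, Continuous fun θ => wirtingerBar k f (p t θ) * (conj (torusPt θ k) * R k θ) :=
    fun k => (hwb k).mul ((hconj k).mul (hRc k))
  -- Integrating by parts against the rotation-invariant `R k` (so `c' = 0`) trades the uncontrolled
  -- `∂_k f` for `∂̄_k f`. It produces a factor `t`, which can be cancelled because `t` ranges over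
  -- `(0, 1]`.
  have hparts : ∀ k, ∫ θ, wirtinger k f (p t θ) * (torusPt θ k * R k θ)
      = ∫ θ, wirtingerBar k f (p t θ) * (conj (torusPt θ k) * R k θ) := by
    intro k
    have h := integral_rotation_by_parts (f := f) z t k (fun θ => hf _ (hpball t htI θ)) hDt
      (c := R k) (c' := 0) (hRc k) continuous_zero (fun θ => by
        simp only [hR, cauchyKernel_rotate (Finset.notMem_erase k _)]
        simpa using hasDerivAt_const (0 : ℝ) _)
    simp only [Pi.zero_apply, zero_mul, zero_add] at h
    rw [integral_const_mul] at h
    have h2 := (mul_eq_zero.1 h).resolve_left (by exact_mod_cast ht.1.ne')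
    rw [← sub_eq_zero, ← integral_sub (integrable_torus (hterm k)) (integrable_torus (hterm3 k)),
      ← h2]
    refine integral_congr_ae (Eventually.of_forall fun θ => ?_)
    simp only [hp]
    ring
  have hsum : ∫ θ, D t θ * K θ = ∑ k, ∫ θ, wirtingerBar k f (p t θ) *
      (conj (torusPt θ k) * R k θ + conj (torusPt θ k - z k) * K θ) := by
    have h1 : ∀ θ, D t θ * K θ = ∑ k, (wirtinger k f (p t θ) * (torusPt θ k * R k θ) +
        wirtingerBar k f (p t θ) * (conj (torusPt θ k - z k) * K θ)) := by
      intro θ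
      simp only [hD, fderiv_eq_sum, Finset.sum_mul]
      refine Finset.sum_congr rfl fun k _ => ?_
      simp only [hR, ← torusPt_sub_mul_cauchyKernel hz1 θ k, Pi.sub_apply, hK]
      ring
    simp only [h1]
    rw [integral_finsetSum _ fun k _ => integrable_torus ((hterm k).fun_add (hterm2 k))]
    refine Finset.sum_congr rfl fun k _ => ?_
    rw [integral_add (integrable_torus (hterm k)) (integrable_torus (hterm2 k)), hparts k,
      ← integral_add (integrable_torus (hterm3 k)) (integrable_torus (hterm2 k))]
    simp only [mul_add]
  rw [hsum]
  refine (norm_sum_le _ _).trans ?_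
  refine (Finset.sum_le_card_nsmul _ _ (2 ^ n * 3 * C) fun k _ => ?_).trans (by simp)
  refine (norm_integral_le_of_norm_le_const (C := 2 ^ n * 3 * C)
    (Eventually.of_forall fun θ => ?_)).trans (by simp)
  rw [norm_mul]
  -- Origin of the constant: each kernel is at most `2 ^ n`, and `|w_k - z_k| ≤ 2`, so each
  -- coordinate contributes at most `(1 + 2) 2 ^ n C`.
  have h1 : ‖conj (torusPt θ k) * R k θ‖ ≤ 2 ^ n := by
    rw [norm_mul, RCLike.norm_conj, norm_torusPt_apply, one_mul]
    exact norm_cauchyKernel_le hz _ θ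
  have h2 : ‖conj (torusPt θ k - z k) * K θ‖ ≤ 2 * 2 ^ n := by
    rw [norm_mul, RCLike.norm_conj]
    refine mul_le_mul ?_ (norm_cauchyKernel_le hz _ θ) (norm_nonneg _) (by norm_num)
    have h3 := norm_sub_le (torusPt θ k) (z k)
    have h4 := (norm_le_pi_norm z k).trans hz
    rw [norm_torusPt_apply] at h3
    linarith
  have h3 := (norm_add_le (conj (torusPt θ k) * R k θ) (conj (torusPt θ k - z k) * K θ)).trans
    (add_le_add h1 h2)
  calc _ ≤ C * (2 ^ n + 2 * 2 ^ n) :=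
        mul_le_mul (hC _ (hpball t htI θ) k) h3 (norm_nonneg _) (hC0 k)
    _ = 2 ^ n * 3 * C := by ring

end CauchyKernel

/-! ### Calculus rules for Wirtinger derivatives. -/

section WirtingerRules

variable {n : ℕ} {f g : (Fin n → ℂ) → ℂ} {z : Fin n → ℂ} {k : Fin n}

theorem wirtinger_congr (h : f =ᶠ[nhds z] g) : wirtinger k f z = wirtinger k g z := by
  simp only [wirtinger, h.fderiv_eq]

theorem wirtingerBar_congr (h : f =ᶠ[nhds z] g) : wirtingerBar k f z = wirtingerBar k g z := by
  simp only [wirtingerBar, h.fderiv_eq]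

theorem wirtinger_sub (hf : DifferentiableAt ℝ f z) (hg : DifferentiableAt ℝ g z) :
    wirtinger k (fun w => f w - g w) z = wirtinger k f z - wirtinger k g z := by
  simp only [wirtinger, fderiv_fun_sub hf hg, _root_.sub_apply]
  ring

theorem wirtingerBar_sub (hf : DifferentiableAt ℝ f z) (hg : DifferentiableAt ℝ g z) :
    wirtingerBar k (fun w => f w - g w) z = wirtingerBar k f z - wirtingerBar k g z := by
  simp only [wirtingerBar, fderiv_fun_sub hf hg, _root_.sub_apply]
  ring

theorem wirtinger_mul (hf : DifferentiableAt ℝ f z) (hg : DifferentiableAt ℝ g z) :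
    wirtinger k (fun w => f w * g w) z = wirtinger k f z * g z + f z * wirtinger k g z := by
  simp only [wirtinger, fderiv_fun_mul hf hg, _root_.add_apply,
    _root_.smul_apply, smul_eq_mul]
  ring

theorem wirtingerBar_mul (hf : DifferentiableAt ℝ f z) (hg : DifferentiableAt ℝ g z) :
    wirtingerBar k (fun w => f w * g w) z
      = wirtingerBar k f z * g z + f z * wirtingerBar k g z := by
  simp only [wirtingerBar, fderiv_fun_mul hf hg, _root_.add_apply,
    _root_.smul_apply, smul_eq_mul]
  ring

theorem wirtingerBar_const_mul (c : ℂ) (hf : DifferentiableAt ℝ f z) :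
    wirtingerBar k (fun w => c * f w) z = c * wirtingerBar k f z := by
  simp only [wirtingerBar, fderiv_const_mul hf, _root_.smul_apply, smul_eq_mul]
  ring

theorem wirtingerBar_sum {ι : Type*} {s : Finset ι} {F : ι → (Fin n → ℂ) → ℂ}
    (hF : ∀ i ∈ s, DifferentiableAt ℝ (F i) z) :
    wirtingerBar k (fun w => ∑ i ∈ s, F i w) z = ∑ i ∈ s, wirtingerBar k (F i) z := by
  simp only [wirtingerBar, fderiv_fun_sum hF, _root_.sum_apply, Finset.mul_sum,
    ← Finset.sum_add_distrib]

theorem fderiv_conj_apply (f : (Fin n → ℂ) → ℂ) (z v : Fin n → ℂ) :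
    fderiv ℝ (fun w => conj (f w)) z v = conj (fderiv ℝ f z v) := by
  have h := Complex.conjCLE.comp_fderiv (f := f) (x := z)
  have h2 : (fun w => conj (f w)) = Complex.conjCLE ∘ f := rfl
  rw [h2, h]
  rfl

theorem wirtingerBar_conj (f : (Fin n → ℂ) → ℂ) (z : Fin n → ℂ) (k : Fin n) :
    wirtingerBar k (fun w => conj (f w)) z = conj (wirtinger k f z) := by
  simp only [wirtingerBar, wirtinger, fderiv_conj_apply, map_mul, map_sub, Complex.conj_I, map_div₀,
    map_one, map_ofNat]
  ring

theorem wirtinger_conj (f : (Fin n → ℂ) → ℂ) (z : Fin n → ℂ) (k : Fin n) :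
    wirtinger k (fun w => conj (f w)) z = conj (wirtingerBar k f z) := by
  simp only [wirtingerBar, wirtinger, fderiv_conj_apply, map_mul, map_add, Complex.conj_I, map_div₀,
    map_one, map_ofNat]
  ring

theorem wirtingerBar_ofReal (φ : (Fin n → ℂ) → ℝ) (z : Fin n → ℂ) (k : Fin n) :
    wirtingerBar k (fun w => (φ w : ℂ)) z = conj (wirtinger k (fun w => (φ w : ℂ)) z) := by
  rw [← wirtingerBar_conj]
  simp only [Complex.conj_ofReal]

theorem fderiv_single_I (hf : DifferentiableAt ℂ f z) (k : Fin n) :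
    fderiv ℝ f z (Pi.single k Complex.I) = Complex.I * fderiv ℂ f z (Pi.single k 1) := by
  rw [hf.fderiv_restrictScalars ℝ]
  have h : (Pi.single k Complex.I : Fin n → ℂ) = Complex.I • (Pi.single k 1 : Fin n → ℂ) := by
    rw [← Pi.single_smul]; simp
  rw [h, ContinuousLinearMap.coe_restrictScalars', map_smul, smul_eq_mul]

theorem wirtingerBar_eq_zero (hf : DifferentiableAt ℂ f z) (k : Fin n) :
    wirtingerBar k f z = 0 := by
  rw [wirtingerBar, fderiv_single_I hf, hf.fderiv_restrictScalars ℝ,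
    ContinuousLinearMap.coe_restrictScalars', ← mul_assoc, Complex.I_mul_I]
  ring

theorem wirtinger_eq_fderiv (hf : DifferentiableAt ℂ f z) (k : Fin n) :
    wirtinger k f z = fderiv ℂ f z (Pi.single k 1) := by
  rw [wirtinger, fderiv_single_I hf, hf.fderiv_restrictScalars ℝ,
    ContinuousLinearMap.coe_restrictScalars', ← mul_assoc, Complex.I_mul_I]
  ring

theorem wirtinger_comp_add_left (f : (Fin n → ℂ) → ℂ) (a z : Fin n → ℂ) (k : Fin n) :
    wirtinger k (fun w => f (a + w)) z = wirtinger k f (a + z) := by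
  simp only [wirtinger, fderiv_comp_add_left]

theorem wirtingerBar_comp_add_left (f : (Fin n → ℂ) → ℂ) (a z : Fin n → ℂ) (k : Fin n) :
    wirtingerBar k (fun w => f (a + w)) z = wirtingerBar k f (a + z) := by
  simp only [wirtingerBar, fderiv_comp_add_left]

theorem wirtinger_comp_sub_const (f : (Fin n → ℂ) → ℂ) (a z : Fin n → ℂ) (k : Fin n) :
    wirtinger k (fun w => f (w - a)) z = wirtinger k f (z - a) := by
  simp only [wirtinger, sub_eq_add_neg, fderiv_comp_add_right]

theorem wirtingerBar_comp_sub_const (f : (Fin n → ℂ) → ℂ) (a z : Fin n → ℂ) (k : Fin n) :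
    wirtingerBar k (fun w => f (w - a)) z = wirtingerBar k f (z - a) := by
  simp only [wirtingerBar, sub_eq_add_neg, fderiv_comp_add_right]

theorem contDiff_wirtinger {m m' : WithTop ℕ∞} (hf : ContDiff ℝ m' f) (h : m + 1 ≤ m')
    (k : Fin n) : ContDiff ℝ m (wirtinger k f) := by
  have := hf.fderiv_right h
  unfold wirtinger
  fun_prop

theorem contDiff_wirtingerBar {m m' : WithTop ℕ∞} (hf : ContDiff ℝ m' f) (h : m + 1 ≤ m')
    (k : Fin n) : ContDiff ℝ m (wirtingerBar k f) := by
  have := hf.fderiv_right h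
  unfold wirtingerBar
  fun_prop

theorem fderiv_fderiv_apply (hf : ContDiff ℝ 2 f) (z u v : Fin n → ℂ) :
    fderiv ℝ (fun w => fderiv ℝ f w u) z v = fderiv ℝ (fderiv ℝ f) z v u := by
  have h : DifferentiableAt ℝ (fderiv ℝ f) z :=
    (hf.fderiv_right (m := 1) (by norm_num)).differentiable (by norm_num) z
  rw [fderiv_clm_apply h (differentiableAt_const _)]
  simp

theorem fderiv_wirtinger (hf : ContDiff ℝ 2 f) (z v : Fin n → ℂ) (k : Fin n) :
    fderiv ℝ (wirtinger k f) z v = (1 / 2 : ℂ) * (fderiv ℝ (fderiv ℝ f) z v (Pi.single k 1)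
      - Complex.I * fderiv ℝ (fderiv ℝ f) z v (Pi.single k Complex.I)) := by
  have h : Differentiable ℝ (fderiv ℝ f) :=
    (hf.fderiv_right (m := 1) (by norm_num)).differentiable (by norm_num)
  unfold wirtinger
  rw [fderiv_const_mul (by fun_prop), fderiv_fun_sub (by fun_prop) (by fun_prop),
    fderiv_const_mul (by fun_prop)]
  simp [fderiv_fderiv_apply hf]

theorem fderiv_wirtingerBar (hf : ContDiff ℝ 2 f) (z v : Fin n → ℂ) (k : Fin n) :
    fderiv ℝ (wirtingerBar k f) z v = (1 / 2 : ℂ) * (fderiv ℝ (fderiv ℝ f) z v (Pi.single k 1)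
      + Complex.I * fderiv ℝ (fderiv ℝ f) z v (Pi.single k Complex.I)) := by
  have h : Differentiable ℝ (fderiv ℝ f) :=
    (hf.fderiv_right (m := 1) (by norm_num)).differentiable (by norm_num)
  unfold wirtingerBar
  rw [fderiv_const_mul (by fun_prop), fderiv_fun_add (by fun_prop) (by fun_prop),
    fderiv_const_mul (by fun_prop)]
  simp [fderiv_fderiv_apply hf, mul_add]

theorem fderiv_fderiv_symm (hf : ContDiff ℝ 2 f) (z u v : Fin n → ℂ) :
    fderiv ℝ (fderiv ℝ f) z u v = fderiv ℝ (fderiv ℝ f) z v u :=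
  (hf.contDiffAt.isSymmSndFDerivAt (by simp)).eq u v

theorem wirtingerBar_comm (hf : ContDiff ℝ 2 f) (z : Fin n → ℂ) (j k : Fin n) :
    wirtingerBar j (wirtingerBar k f) z = wirtingerBar k (wirtingerBar j f) z := by
  rw [wirtingerBar, wirtingerBar]
  simp only [fderiv_wirtingerBar hf]
  rw [fderiv_fderiv_symm hf z (Pi.single j 1), fderiv_fderiv_symm hf z (Pi.single j 1),
    fderiv_fderiv_symm hf z (Pi.single j Complex.I),
    fderiv_fderiv_symm hf z (Pi.single j Complex.I)]
  ring

theorem wirtingerBar_wirtinger (hf : ContDiff ℝ 2 f) (z : Fin n → ℂ) (j k : Fin n) :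
    wirtingerBar j (wirtinger k f) z = wirtinger k (wirtingerBar j f) z := by
  rw [wirtingerBar, wirtinger]
  simp only [fderiv_wirtingerBar hf, fderiv_wirtinger hf]
  rw [fderiv_fderiv_symm hf z (Pi.single j 1), fderiv_fderiv_symm hf z (Pi.single j 1),
    fderiv_fderiv_symm hf z (Pi.single j Complex.I),
    fderiv_fderiv_symm hf z (Pi.single j Complex.I)]
  ring

end WirtingerRules

/-! ### Holomorphy of the Cauchy transform. -/

section CauchyTransform

variable {n : ℕ}

/-- The conjugate of the `k`-th coordinate, as a continuous function on the torus. -/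
noncomputable def conjCoord (k : Fin n) : C(Fin n → UnitAddCircle, ℂ) where
  toFun θ := conj (torusPt θ k)
  continuous_toFun := Complex.continuous_conj.comp (continuous_torusPt_apply k)

/-- The Cauchy kernel as a function with values in the algebra of continuous functions on the
torus. -/
noncomputable def cauchyKernelMap (z : Fin n → ℂ) : C(Fin n → UnitAddCircle, ℂ) :=
  ∏ k, Ring.inverse (1 - z k • conjCoord k)

theorem isUnit_one_sub_conjCoord {z : Fin n → ℂ} (hz : ‖z‖ < 1) (k : Fin n) :
    IsUnit (1 - z k • conjCoord k) := by
  rw [ContinuousMap.isUnit_iff_forall_ne_zero]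
  intro θ
  exact one_sub_ne_zero_of_norm_lt ((norm_mul_conj_torusPt_le le_rfl θ k).trans_lt hz)

theorem cauchyKernelMap_apply {z : Fin n → ℂ} (hz : ‖z‖ < 1) (θ : Fin n → UnitAddCircle) :
    cauchyKernelMap z θ = cauchyKernel Finset.univ z (torusPt θ) := by
  rw [cauchyKernelMap, cauchyKernel, ContinuousMap.prod_apply]
  refine Finset.prod_congr rfl fun k _ => ?_
  have h := congrArg (fun g : C(Fin n → UnitAddCircle, ℂ) => g θ)
    (Ring.mul_inverse_cancel _ (isUnit_one_sub_conjCoord hz k))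
  exact eq_inv_of_mul_eq_one_right h

/-- Inversion in the Banach algebra of continuous functions on the torus is analytic at units.
Composing with a continuous linear functional then gives analyticity of the Cauchy transform without
differentiating under the integral sign. -/
theorem contDiffAt_cauchyKernelMap {z : Fin n → ℂ} (hz : ‖z‖ < 1) :
    ContDiffAt ℂ ω cauchyKernelMap z := by
  unfold cauchyKernelMap
  refine contDiffAt_prod fun k _ => ?_
  obtain ⟨u, hu⟩ := isUnit_one_sub_conjCoord hz k
  have h1 : ContDiffAt ℂ ω (fun w : Fin n → ℂ => 1 - w k • conjCoord k) z := by
    fun_prop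
  have h2 := contDiffAt_ringInverse ℂ (n := ω) u
  rw [hu] at h2
  exact h2.comp z h1

/-- Integration against a continuous function on the torus. -/
noncomputable def torusIntegralCLM (f : (Fin n → UnitAddCircle) → ℂ) (hf : Continuous f) :
    C(Fin n → UnitAddCircle, ℂ) →L[ℂ] ℂ :=
  LinearMap.mkContinuousOfExistsBound
    { toFun := fun g => ∫ θ, f θ * g θ
      map_add' := fun g g' => by
        have h1 : Integrable fun θ => f θ * g θ := integrable_torus (hf.mul g.continuous)
        have h2 : Integrable fun θ => f θ * g' θ := integrable_torus (hf.mul g'.continuous)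
        simp only [ContinuousMap.add_apply, mul_add]
        exact integral_add h1 h2
      map_smul' := fun c g => by
        simp only [ContinuousMap.smul_apply, smul_eq_mul, RingHom.id_apply, ← integral_const_mul]
        congr 1
        ext θ
        ring } (by
    obtain ⟨B, hB⟩ := (isCompact_univ.image hf).isBounded.exists_norm_le
    refine ⟨B, fun g => ?_⟩
    refine (norm_integral_le_of_norm_le_const (C := B * ‖g‖)
      (Eventually.of_forall fun θ => ?_)).trans (by simp)
    rw [norm_mul]
    exact mul_le_mul (hB _ ⟨θ, trivial, rfl⟩) (g.norm_coe_le_norm θ) (norm_nonneg _)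
      ((norm_nonneg _).trans (hB _ ⟨θ, trivial, rfl⟩)))

theorem torusIntegralCLM_apply {f : (Fin n → UnitAddCircle) → ℂ} (hf : Continuous f)
    (g : C(Fin n → UnitAddCircle, ℂ)) : torusIntegralCLM f hf g = ∫ θ, f θ * g θ := rfl

/-- The Cauchy transform of a continuous function on the torus. -/
noncomputable def cauchyTransform (f : (Fin n → UnitAddCircle) → ℂ) (hf : Continuous f)
    (z : Fin n → ℂ) : ℂ :=
  torusIntegralCLM f hf (cauchyKernelMap z)

theorem contDiffAt_cauchyTransform {f : (Fin n → UnitAddCircle) → ℂ} (hf : Continuous f)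
    {z : Fin n → ℂ} (hz : ‖z‖ < 1) : ContDiffAt ℂ ω (cauchyTransform f hf) z :=
  (torusIntegralCLM f hf).contDiff.contDiffAt.comp z (contDiffAt_cauchyKernelMap hz)

theorem fderiv_cauchyKernelMap_apply {z : Fin n → ℂ} (hz : ‖z‖ < 1) (k : Fin n)
    (θ : Fin n → UnitAddCircle) :
    fderiv ℂ cauchyKernelMap z (Pi.single k 1) θ
      = conj (torusPt θ k) * (1 - z k * conj (torusPt θ k))⁻¹ *
        cauchyKernel Finset.univ z (torusPt θ) := by
  have hne := one_sub_ne_zero_of_norm_lt ((norm_mul_conj_torusPt_le le_rfl θ k).trans_lt hz)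
  have hd : DifferentiableAt ℂ cauchyKernelMap z :=
    (contDiffAt_cauchyKernelMap hz).differentiableAt (by simp)
  have h0 : z + (0 : ℂ) • (Pi.single k 1 : Fin n → ℂ) = z := by simp
  have hline : HasDerivAt (fun s : ℂ => z + s • (Pi.single k 1 : Fin n → ℂ)) (Pi.single k 1) 0 := by
    have h2 := ((hasDerivAt_id (0 : ℂ)).smul_const (Pi.single k 1 : Fin n → ℂ)).const_add z
    rwa [one_smul] at h2
  have h1 : HasDerivAt (fun s : ℂ => cauchyKernelMap (z + s • (Pi.single k 1 : Fin n → ℂ)) θ)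
      (fderiv ℂ cauchyKernelMap z (Pi.single k 1) θ) 0 := by
    have h2 := hd.hasFDerivAt
    rw [← h0] at h2
    have h3 := h2.comp_hasDerivAt (0 : ℂ) hline
    rw [h0] at h3
    exact (ContinuousMap.evalCLM ℂ θ).hasFDerivAt.comp_hasDerivAt (0 : ℂ) h3
  have h2 : HasDerivAt (fun s : ℂ => (1 - (z k + s) * conj (torusPt θ k))⁻¹ *
      cauchyKernel (Finset.univ.erase k) z (torusPt θ))
      (conj (torusPt θ k) / (1 - z k * conj (torusPt θ k)) ^ 2 *
        cauchyKernel (Finset.univ.erase k) z (torusPt θ)) 0 := by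
    have h3 : HasDerivAt (fun s : ℂ => 1 - (z k + s) * conj (torusPt θ k))
        (-(conj (torusPt θ k))) 0 := by
      simpa using (((hasDerivAt_id (0 : ℂ)).const_add (z k)).mul_const
        (conj (torusPt θ k))).const_sub 1
    have h4 := (h3.fun_inv (by simpa using hne)).mul_const
      (cauchyKernel (Finset.univ.erase k) z (torusPt θ))
    simpa using h4
  -- The pointwise formula for `cauchyKernelMap` is available only inside the unit polydisc, where
  -- the factors are units; equality near `s = 0` is enough to compare derivatives.
  have hev : ∀ᶠ s : ℂ in nhds 0, ‖z + s • (Pi.single k 1 : Fin n → ℂ)‖ < 1 := by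
    refine ContinuousAt.eventually_lt (by fun_prop) continuousAt_const ?_
    simpa using hz
  have h3 := h2.congr_of_eventuallyEq (f₁ := fun s : ℂ =>
    cauchyKernelMap (z + s • (Pi.single k 1 : Fin n → ℂ)) θ) (by
      filter_upwards [hev] with s hs
      rw [cauchyKernelMap_apply hs, cauchyKernel_univ_eq _ _ k]
      congr 1
      · simp
      · refine Finset.prod_congr rfl fun l hl => ?_
        simp [Finset.ne_of_mem_erase hl])
  rw [h1.unique h3, cauchyKernel_univ_eq z _ k]
  field_simp

end CauchyTransform

/-! ### Holomorphic gauges for a function with bounded complex Hessian. -/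

section Gauge

variable {n : ℕ}

/-- The `z_j`-derivative of the kernel `K` equals, up to the factor `-2πi`, the rotation derivative
of `w̄_j K`. Integration by parts moves it onto `f`: the `∂_j f` term comes with `w_j w̄_j = 1`, the
`∂̄_j f` term with `w̄_j ^ 2`. -/
theorem wirtinger_cauchyTransform {f : (Fin n → ℂ) → ℂ} (hf : ContDiff ℝ 1 f)
    (hF : Continuous fun θ => f (torusPt θ)) {z : Fin n → ℂ} (hz : ‖z‖ < 1) (j : Fin n) :
    wirtinger j (cauchyTransform (fun θ => f (torusPt θ)) hF) z
      = (∫ θ, wirtinger j f (torusPt θ) * cauchyKernel Finset.univ z (torusPt θ))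
        - ∫ θ, wirtingerBar j f (torusPt θ) *
          (conj (torusPt θ j) ^ 2 * cauchyKernel Finset.univ z (torusPt θ)) := by
  have hd : DifferentiableAt ℂ cauchyKernelMap z :=
    (contDiffAt_cauchyKernelMap hz).differentiableAt (by simp)
  have hT := continuous_torusPt (n := n)
  have hconj : Continuous fun θ => conj (torusPt θ j) :=
    Complex.continuous_conj.comp (continuous_torusPt_apply j)
  have hK := continuous_cauchyKernel hz Finset.univ
  have hw : Continuous fun θ => wirtinger j f (torusPt θ) :=
    (contDiff_wirtinger (m := 0) hf (by norm_num) j).continuous.comp hT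
  have hwb : Continuous fun θ => wirtingerBar j f (torusPt θ) :=
    (contDiff_wirtingerBar (m := 0) hf (by norm_num) j).continuous.comp hT
  have h1 : fderiv ℂ (cauchyTransform (fun θ => f (torusPt θ)) hF) z (Pi.single j 1)
      = ∫ θ, f (torusPt θ) * (conj (torusPt θ j) * (1 - z j * conj (torusPt θ j))⁻¹ *
        cauchyKernel Finset.univ z (torusPt θ)) := by
    have h2 := (torusIntegralCLM (fun θ => f (torusPt θ)) hF).hasFDerivAt.comp z hd.hasFDerivAt
    have h3 : fderiv ℂ (cauchyTransform (fun θ => f (torusPt θ)) hF) z = _ := h2.fderiv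
    rw [h3, ContinuousLinearMap.comp_apply, torusIntegralCLM_apply]
    simp only [fderiv_cauchyKernelMap_apply hz]
  rw [wirtinger_eq_fderiv ((contDiffAt_cauchyTransform hF hz).differentiableAt (by simp)), h1]
  have hsub : ∀ θ : Fin n → UnitAddCircle, (0 : Fin n → ℂ) + (1 : ℝ) • (torusPt θ - 0) = torusPt θ :=
    fun θ => by simp
  have hinv := continuous_one_sub_inv hz j
  -- With centre `0` and ratio `1` the homothety is the identity.
  have hparts := integral_rotation_by_parts (f := f) 0 1 j
    (c := fun θ => conj (torusPt θ j) * cauchyKernel Finset.univ z (torusPt θ))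
    (c' := fun θ => -(conj (torusPt θ j) * (1 - z j * conj (torusPt θ j))⁻¹ *
        cauchyKernel Finset.univ z (torusPt θ)))
    (fun θ => hf.differentiable (by norm_num) _)
    (by simp only [hsub]; exact (hf.continuous_fderiv (by norm_num)).comp hT)
    (hconj.mul hK) ((hconj.mul hinv).mul hK).neg (fun θ => by
      have hne := one_sub_ne_zero_of_norm_lt ((norm_mul_conj_torusPt_le le_rfl θ j).trans_lt hz)
      have h0 : ((θ : Fin n → UnitAddCircle) + Pi.single j ((0 : ℝ) : UnitAddCircle)) = θ := by
        simp
      simp only [cauchyKernel_univ_eq _ _ j, cauchyKernel_rotate (Finset.notMem_erase j _)]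
      have h2 := hasDerivAt_conj_torusPt θ j
      have h3 := (h2.const_mul (z j)).const_sub 1
      have h4 := h2.mul ((h3.fun_inv (by rw [h0]; exact hne)).mul_const
        (cauchyKernel (Finset.univ.erase j) z (torusPt θ)))
      refine h4.congr_deriv ?_
      rw [h0]
      field_simp
      ring)
  simp only [hsub, Complex.ofReal_one, one_mul] at hparts
  have hi1 : Integrable fun θ => f (torusPt θ) * (conj (torusPt θ j) *
      (1 - z j * conj (torusPt θ j))⁻¹ * cauchyKernel Finset.univ z (torusPt θ)) :=
    integrable_torus (hF.mul ((hconj.mul hinv).mul hK))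
  have hi2 : Integrable fun θ =>
      wirtinger j f (torusPt θ) * cauchyKernel Finset.univ z (torusPt θ) :=
    integrable_torus (hw.mul hK)
  have hi3 : Integrable fun θ => wirtingerBar j f (torusPt θ) *
      (conj (torusPt θ j) ^ 2 * cauchyKernel Finset.univ z (torusPt θ)) :=
    integrable_torus (hwb.mul ((hconj.pow 2).mul hK))
  have hi23 : Integrable fun θ =>
      wirtinger j f (torusPt θ) * cauchyKernel Finset.univ z (torusPt θ) -
        wirtingerBar j f (torusPt θ) *
          (conj (torusPt θ j) ^ 2 * cauchyKernel Finset.univ z (torusPt θ)) := hi2.sub hi3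
  rw [← sub_eq_zero, ← integral_sub hi2 hi3, ← integral_sub hi1 hi23, ← neg_eq_zero,
    ← integral_neg, ← hparts]
  refine integral_congr_ae (Eventually.of_forall fun θ => ?_)
  have h5 := torusPt_mul_conj θ j
  linear_combination (-(wirtinger j f (torusPt θ) * cauchyKernel Finset.univ z (torusPt θ))) * h5

/-- The correction term in the derivative of the Cauchy transform of a real function is small. -/
theorem norm_integral_conj_sq_le {φ : (Fin n → ℂ) → ℝ} (hφ : ContDiff ℝ 2 φ) {C : ℝ}
    (hC : ∀ z j k, ‖wirtingerBar k (wirtinger j fun w => (φ w : ℂ)) z‖ ≤ C)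
    {z : Fin n → ℂ} (hz : ‖z‖ ≤ 1 / 2) (j : Fin n) :
    ‖∫ θ, wirtingerBar j (fun w => (φ w : ℂ)) (torusPt θ) *
        (conj (torusPt θ j) ^ 2 * cauchyKernel Finset.univ z (torusPt θ))‖
      ≤ n * (2 ^ n * 3 * (2 ^ n * C)) := by
  set f : (Fin n → ℂ) → ℂ := fun w => (φ w : ℂ) with hfdef
  have hf : ContDiff ℝ 2 f := Complex.ofRealCLM.contDiff.comp hφ
  have hw : ContDiff ℝ 1 (wirtinger j f) := contDiff_wirtinger hf (by norm_num) j
  -- On the torus `u` is the conjugate of `w̄_j ^ 2 K`, but as a function of `p` it is holomorphic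
  -- on the polydisc of radius `2`, because `‖z‖ ≤ 1/2`. It vanishes at the origin.
  set u : (Fin n → ℂ) → ℂ := fun p => p j ^ 2 * ∏ k, (1 - conj (z k) * p k)⁻¹ with hu
  have hsmall : ∀ p : Fin n → ℂ, ∀ r : ℝ, ‖p‖ ≤ r → ∀ k, ‖conj (z k) * p k‖ ≤ r / 2 := by
    intro p r hp k
    rw [norm_mul, RCLike.norm_conj]
    have h1 := (norm_le_pi_norm z k).trans hz
    have h2 := (norm_le_pi_norm p k).trans hp
    nlinarith [norm_nonneg (z k), norm_nonneg (p k)]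
  have huC : ContDiffOn ℂ 1 u (ball 0 2) := by
    refine ContDiffOn.mul (by fun_prop) (contDiffOn_prod fun k _ => ?_)
    refine ContDiffOn.inv (by fun_prop) fun p hp => one_sub_ne_zero_of_norm_lt ?_
    rw [mem_ball_zero_iff] at hp
    exact (hsmall p _ le_rfl k).trans_lt (by linarith)
  have hsub : closedBall (0 : Fin n → ℂ) 1 ⊆ ball 0 2 := closedBall_subset_ball (by norm_num)
  have hud : ∀ p ∈ closedBall (0 : Fin n → ℂ) 1, DifferentiableAt ℂ u p := fun p hp =>
    (huC.contDiffAt (isOpen_ball.mem_nhds (hsub hp))).differentiableAt (by norm_num)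
  have hgC : ContDiffOn ℝ 1 (fun p => wirtinger j f p * u p) (ball 0 2) :=
    hw.contDiffOn.mul (huC.restrict_scalars ℝ)
  -- As `φ` is real, the conjugate of the integral is the mean of `(∂_j φ) u`. The Cauchy formula at
  -- centre `0`, where the kernel is `1`, compares it with the value `0` at the origin; the error
  -- involves only `u ∂̄∂_j φ`, with `|u| ≤ 2 ^ n`.
  have key := norm_integral_cauchyKernel_sub_le (f := fun p => wirtinger j f p * u p)
    (C := 2 ^ n * C) (z := 0)
    (fun p hp => (hgC.contDiffAt (isOpen_ball.mem_nhds (hsub hp))).differentiableAt (by norm_num))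
    ((hgC.continuousOn_fderiv_of_isOpen isOpen_ball (by norm_num)).mono hsub)
    (fun p hp k => by
      rw [wirtingerBar_mul (hw.differentiable (by norm_num) _)
        ((hud p hp).restrictScalars ℝ), wirtingerBar_eq_zero (hud p hp), mul_zero, add_zero,
        norm_mul, mul_comm]
      rw [mem_closedBall_zero_iff] at hp
      refine mul_le_mul ?_ (hC p j k) (norm_nonneg _) (by positivity)
      rw [hu, norm_mul, norm_pow, norm_prod]
      have h1 : ‖p j‖ ^ 2 ≤ 1 := pow_le_one₀ (norm_nonneg _) ((norm_le_pi_norm p j).trans hp)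
      have h2 : ∏ k, ‖(1 - conj (z k) * p k)⁻¹‖ ≤ ∏ k : Fin n, (2 : ℝ) :=
        Finset.prod_le_prod (fun _ _ => norm_nonneg _) fun k _ =>
          norm_inv_one_sub_le (hsmall p 1 hp k)
      calc _ ≤ 1 * ∏ k : Fin n, (2 : ℝ) := mul_le_mul h1 h2 (by positivity) zero_le_one
        _ = 2 ^ n := by simp) (by simp)
  have hu0 : u 0 = 0 := by simp [hu]
  have hK0 : ∀ θ : Fin n → UnitAddCircle, cauchyKernel Finset.univ 0 (torusPt θ) = 1 := by
    simp [cauchyKernel]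
  simp only [hu0, hK0, mul_one, mul_zero, sub_zero] at key
  rw [← RCLike.norm_conj, ← integral_conj]
  refine le_trans (le_of_eq ?_) key
  congr 1
  refine integral_congr_ae (Eventually.of_forall fun θ => ?_)
  simp only [hu, cauchyKernel, hfdef, wirtingerBar_ofReal, map_mul, map_pow, map_prod, map_inv₀,
    map_sub, map_one, Complex.conj_conj]

/-- Near a point, a real function with bounded complex Hessian is the real part of a holomorphic
function up to a bounded error with bounded gradient. -/
theorem exists_holomorphic_approx {φ : (Fin n → ℂ) → ℝ} (hφ : ContDiff ℝ 2 φ) {C : ℝ}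
    (hC : ∀ z j k, ‖wirtingerBar k (wirtinger j fun w => (φ w : ℂ)) z‖ ≤ C) :
    ∃ h : (Fin n → ℂ) → ℂ, (∀ z, ‖z‖ < 1 → ContDiffAt ℂ ω h z) ∧ 2 * (h 0).re = φ 0 ∧
      ∀ z, ‖z‖ ≤ 1 / 2 → ∀ j, ‖wirtinger j (fun w => (φ w : ℂ)) z - wirtinger j h z‖
        ≤ n * (2 ^ n * 3 * C) + n * (2 ^ n * 3 * (2 ^ n * C)) := by
  set f : (Fin n → ℂ) → ℂ := fun w => (φ w : ℂ) with hfdef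
  have hf : ContDiff ℝ 2 f := Complex.ofRealCLM.contDiff.comp hφ
  have hF : Continuous fun θ => f (torusPt θ) := hf.continuous.comp continuous_torusPt
  set H := cauchyTransform (fun θ => f (torusPt θ)) hF with hH
  -- Only the gradient of the Cauchy transform is close to that of `φ`; the constant is chosen so
  -- that `2 Re h` and `φ` agree at the centre.
  refine ⟨fun z => H z - (H 0 - f 0 / 2), fun z hz =>
    (contDiffAt_cauchyTransform hF hz).sub contDiffAt_const, ?_, fun z hz j => ?_⟩
  · simp [hfdef]
    ring
  have hz1 : ‖z‖ < 1 := by linarith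
  have hHd : DifferentiableAt ℂ H z :=
    (contDiffAt_cauchyTransform hF hz1).differentiableAt (by simp)
  have h1 : wirtinger j (fun z => H z - (H 0 - f 0 / 2)) z = wirtinger j H z := by
    simp only [wirtinger, fderiv_sub_const]
  have hw : ContDiff ℝ 1 (wirtinger j f) := contDiff_wirtinger hf (by norm_num) j
  rw [h1, wirtinger_cauchyTransform (hf.of_le (by norm_num)) hF hz1]
  have h2 := norm_integral_cauchyKernel_sub_le (f := wirtinger j f)
    (fun p _ => hw.differentiable (by norm_num) p)
    (hw.continuous_fderiv (by norm_num)).continuousOn (fun p _ k => hC p j k) hz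
  have h3 := norm_integral_conj_sq_le hφ hC hz j
  rw [norm_sub_rev] at h2
  refine le_trans (le_of_eq ?_) ((norm_add_le _ _).trans (add_le_add h2 h3))
  congr 1
  ring

/-- A function with bounded complex Hessian admits, uniformly in the centre, holomorphic gauges
on polydiscs of a fixed radius. -/
theorem exists_gauge {φ : (Fin n → ℂ) → ℝ} (hφ : ContDiff ℝ 2 φ) {C : ℝ}
    (hC : ∀ z j k, ‖wirtingerBar k (wirtinger j fun w => (φ w : ℂ)) z‖ ≤ C) :
    ∃ C' : ℝ, ∀ a : Fin n → ℂ, ∃ h : (Fin n → ℂ) → ℂ, ContDiff ℝ ∞ h ∧ ∀ z ∈ ball a (1 / 2),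
      (∀ j, wirtingerBar j h z = 0) ∧ |φ z - 2 * (h z).re| ≤ C' ∧
      ∀ j, ‖wirtinger j (fun w => (φ w : ℂ)) z - wirtinger j h z‖ ≤ C' := by
  set C₁ : ℝ := n * (2 ^ n * 3 * C) + n * (2 ^ n * 3 * (2 ^ n * C)) with hC₁
  refine ⟨max C₁ (2 * (n * C₁) * (1 / 2)), fun a => ?_⟩
  have hφa : ContDiff ℝ 2 fun w => φ (a + w) := hφ.comp (contDiff_const.add contDiff_id)
  obtain ⟨h, hh, hh0, hhw⟩ := exists_holomorphic_approx hφa (C := C) (fun z j k => by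
    have h1 : (wirtinger j fun w => ((φ (a + w) : ℝ) : ℂ))
        = fun z => wirtinger j (fun w => (φ w : ℂ)) (a + z) :=
      funext fun z => wirtinger_comp_add_left (fun w => (φ w : ℂ)) a z j
    rw [h1, wirtingerBar_comp_add_left (wirtinger j fun w => (φ w : ℂ))]
    exact hC _ _ _)
  have hhd : ∀ z, ‖z‖ < 1 → DifferentiableAt ℂ h z := fun z hz =>
    (hh z hz).differentiableAt (by simp)
  have hbound : ∀ z, ‖z‖ < 1 / 2 → |φ (a + z) - 2 * (h z).re| ≤ 2 * (n * C₁) * (1 / 2) := by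
    intro z hz
    -- The bound on `φ - 2 Re h` comes from the mean value inequality: `Ψ` vanishes at `0`, and
    -- being real it satisfies `|∂̄_k Ψ| = |∂_k Ψ| = |∂_k φ - ∂_k h| ≤ C₁`.
    set Ψ : (Fin n → ℂ) → ℂ := fun w => ((φ (a + w) : ℝ) : ℂ) - (h w + conj (h w)) with hΨ
    have hre : ∀ w, Ψ w = ((φ (a + w) - 2 * (h w).re : ℝ) : ℂ) := by
      intro w
      simp only [hΨ, Complex.add_conj]
      push_cast
      ring
    have hfd : Differentiable ℝ fun w => ((φ (a + w) : ℝ) : ℂ) :=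
      (Complex.ofRealCLM.contDiff.comp hφa).differentiable (by norm_num)
    have hhr : ∀ w, ‖w‖ < 1 → DifferentiableAt ℝ h w := fun w hw => (hhd w hw).restrictScalars ℝ
    have hhc : ∀ w, ‖w‖ < 1 → DifferentiableAt ℝ (fun w => conj (h w)) w := fun w hw =>
      Complex.conjCLE.differentiableAt.comp w (hhr w hw)
    have hΨd : ∀ w, ‖w‖ < 1 → DifferentiableAt ℝ Ψ w := fun w hw =>
      (hfd w).sub ((hhr w hw).add (hhc w hw))
    have hΨw : ∀ w, ‖w‖ < 1 → ∀ j, wirtinger j Ψ w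
        = wirtinger j (fun w => ((φ (a + w) : ℝ) : ℂ)) w - wirtinger j h w := by
      intro w hw j
      have h1 : Ψ = fun w => (((φ (a + w) : ℝ) : ℂ) - h w) - conj (h w) := by
        ext w; simp only [hΨ]; ring
      rw [h1, wirtinger_sub ((hfd w).fun_sub (hhr w hw)) (hhc w hw),
        wirtinger_sub (hfd w) (hhr w hw), wirtinger_conj, wirtingerBar_eq_zero (hhd w hw)]
      simp
    have hfder : ∀ w ∈ ball (0 : Fin n → ℂ) (1 / 2), ‖fderiv ℝ Ψ w‖ ≤ 2 * (n * C₁) := by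
      intro w hw
      rw [mem_ball_zero_iff] at hw
      have hw1 : ‖w‖ < 1 := by linarith
      have hnn : 0 ≤ 2 * (n * C₁) := by
        rcases Nat.eq_zero_or_pos n with h0 | h0
        · simp [h0]
        · have := (norm_nonneg _).trans (hhw w hw.le ⟨0, h0⟩)
          positivity
      refine ContinuousLinearMap.opNorm_le_bound _ hnn fun v => ?_
      rw [fderiv_eq_sum]
      have hΨb : ∀ k, wirtingerBar k Ψ w = conj (wirtinger k Ψ w) := fun k => by
        rw [show Ψ = fun w => ((φ (a + w) - 2 * (h w).re : ℝ) : ℂ) from funext hre,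
          wirtingerBar_ofReal]
      refine (norm_sum_le _ _).trans ((Finset.sum_le_card_nsmul _ _ (2 * C₁ * ‖v‖)
        fun k _ => ?_).trans (le_of_eq ?_))
      · refine (norm_add_le _ _).trans ?_
        rw [norm_mul, norm_mul, hΨb, RCLike.norm_conj, RCLike.norm_conj, hΨw w hw1]
        have h1 := hhw w hw.le k
        have h2 := norm_le_pi_norm v k
        nlinarith [mul_le_mul h1 h2 (norm_nonneg _) ((norm_nonneg _).trans h1)]
      · simp
        ring
    have hmvt := (convex_ball (0 : Fin n → ℂ) (1 / 2)).norm_image_sub_le_of_norm_fderiv_le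
      (𝕜 := ℝ) (fun w hw => hΨd w (by rw [mem_ball_zero_iff] at hw; linarith)) hfder
      (mem_ball_self (by norm_num)) (mem_ball_zero_iff.2 hz)
    have hΨ0 : Ψ 0 = 0 := by rw [hre, hh0]; simp
    rw [hΨ0, sub_zero, sub_zero, hre, Complex.norm_real, Real.norm_eq_abs] at hmvt
    have hnn : 0 ≤ 2 * (n * C₁) :=
      (norm_nonneg _).trans (hfder 0 (mem_ball_self (by norm_num)))
    exact hmvt.trans (mul_le_mul_of_nonneg_left hz.le hnn)
  -- A cutoff makes the gauge smooth on all of `ℂⁿ`: it is one where the estimates are claimed and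
  -- is supported inside the unit polydisc, where `h` is holomorphic.
  let η : ContDiffBump (0 : Fin n → ℂ) := ⟨1 / 2, 3 / 4, by norm_num, by norm_num⟩
  set g : (Fin n → ℂ) → ℂ := fun z => ((η z : ℝ) : ℂ) * h z with hg
  have hgC : ContDiff ℝ ∞ g := by
    rw [contDiff_iff_contDiffAt]
    intro z
    have hη : ContDiff ℝ ∞ fun z => ((η z : ℝ) : ℂ) := Complex.ofRealCLM.contDiff.comp η.contDiff
    by_cases hz : ‖z‖ < 1
    · exact hη.contDiffAt.mul (((hh z hz).restrict_scalars ℝ).of_le (by simp))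
    · have : g =ᶠ[nhds z] fun _ => 0 := by
        have h1 : (closedBall (0 : Fin n → ℂ) (3 / 4))ᶜ ∈ nhds z :=
          isClosed_closedBall.isOpen_compl.mem_nhds (by
            rw [Set.mem_compl_iff, mem_closedBall_zero_iff]; linarith)
        filter_upwards [h1] with w hw
        rw [Set.mem_compl_iff, mem_closedBall] at hw
        simp [hg, η.zero_of_le_dist (not_le.1 hw).le]
      exact contDiffAt_const.congr_of_eventuallyEq this
  have hgeq : ∀ z ∈ ball (0 : Fin n → ℂ) (1 / 2), g =ᶠ[nhds z] h := by
    intro z hz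
    filter_upwards [isOpen_ball.mem_nhds hz] with w hw
    simp [hg, η.one_of_mem_closedBall (ball_subset_closedBall hw)]
  refine ⟨fun z => g (z - a), hgC.comp (contDiff_id.sub contDiff_const), fun z hz => ?_⟩
  have hza : z - a ∈ ball (0 : Fin n → ℂ) (1 / 2) := by
    rwa [mem_ball_zero_iff, ← dist_eq_norm]
  have hza' : ‖z - a‖ < 1 / 2 := mem_ball_zero_iff.1 hza
  refine ⟨fun j => ?_, ?_, fun j => ?_⟩
  · rw [wirtingerBar_comp_sub_const, wirtingerBar_congr (hgeq _ hza),
      wirtingerBar_eq_zero (hhd _ (by linarith))]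
  · simp only [(hgeq _ hza).self_of_nhds]
    have := hbound (z - a) hza'
    rw [add_sub_cancel] at this
    exact this.trans (le_max_right _ _)
  · rw [wirtinger_comp_sub_const, wirtinger_congr (hgeq _ hza)]
    have h1 := hhw (z - a) hza'.le j
    rw [wirtinger_comp_add_left (fun w => (φ w : ℂ)), add_sub_cancel] at h1
    exact h1.trans (le_max_left _ _)

end Gauge

/-! ### Positivity of the Levi form and bounds on the complex Hessian. -/

section Levi

variable {n : ℕ}

/-- Second order Taylor expansion with Peano remainder. -/
theorem eventually_taylor_two {E : Type*} [NormedAddCommGroup E] [NormedSpace ℝ E] {φ : E → ℝ}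
    (hφ : ContDiff ℝ 2 φ) (a : E) {ε : ℝ} (hε : 0 < ε) :
    ∃ δ > 0, ∀ v : E, ‖v‖ < δ →
      |φ (a + v) - φ a - fderiv ℝ φ a v - 1 / 2 * fderiv ℝ (fderiv ℝ φ) a v v| ≤ ε * ‖v‖ ^ 2 := by
  have hd1 : Differentiable ℝ φ := hφ.differentiable (by norm_num)
  have hd2 : DifferentiableAt ℝ (fderiv ℝ φ) a :=
    (hφ.fderiv_right (m := 1) (by norm_num)).differentiable (by norm_num) a
  set B := fderiv ℝ (fderiv ℝ φ) a with hB
  have hsymm : ∀ u v, B u v = B v u := fun u v =>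
    (hφ.contDiffAt.isSymmSndFDerivAt (by simp)).eq u v
  have hlo := (hasFDerivAt_iff_isLittleO_nhds_zero.1 hd2.hasFDerivAt).def hε
  obtain ⟨δ, hδ, hball⟩ := Metric.eventually_nhds_iff_ball.1 hlo
  refine ⟨δ, hδ, fun v hv => ?_⟩
  set R : E → ℝ := fun w => φ (a + w) - φ a - fderiv ℝ φ a w - 1 / 2 * B w w with hR
  have hRd : ∀ w, HasFDerivAt R (fderiv ℝ φ (a + w) - fderiv ℝ φ a - B w) w := by
    intro w
    have h1 : HasFDerivAt (fun w => φ (a + w)) (fderiv ℝ φ (a + w)) w := by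
      have := (hd1 (a + w)).hasFDerivAt
      exact (hasFDerivAt_comp_add_left a).2 this
    have h2 : HasFDerivAt (fun w => B w w) (B.flip w + B w) w := by
      have := B.hasFDerivAt.clm_apply (hasFDerivAt_id w)
      refine this.congr_fderiv ?_
      ext u
      simp [add_comm]
    refine (((h1.sub_const (φ a)).sub (fderiv ℝ φ a).hasFDerivAt).sub
      (h2.const_mul (1 / 2))).congr_fderiv ?_
    ext u
    simp [hsymm u w]
    ring
  -- The derivative of the remainder is the first order remainder of `fderiv ℝ φ`, at most `ε ‖v‖`
  -- on this ball; the displacement supplies the second factor `‖v‖`.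
  have hmvt := (convex_closedBall (0 : E) ‖v‖).norm_image_sub_le_of_norm_hasFDerivWithin_le
    (f := R) (C := ε * ‖v‖) (fun w _ => (hRd w).hasFDerivWithinAt) (fun w hw => by
      rw [mem_closedBall_zero_iff] at hw
      exact (hball w (by rw [mem_ball_zero_iff]; linarith)).trans
        (mul_le_mul_of_nonneg_left hw hε.le))
    (mem_closedBall_self (norm_nonneg v)) (y := v) (by simp)
  have hR0 : R 0 = 0 := by simp [hR]
  rw [hR0, sub_zero, sub_zero, Real.norm_eq_abs] at hmvt
  calc _ ≤ ε * ‖v‖ * ‖v‖ := hmvt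
    _ = ε * ‖v‖ ^ 2 := by ring

/-- Over a full turn the linear and mixed terms average out, while `cos²` and `sin²` have mean
`1/2`. -/
theorem circleAverage_quadratic (c₀ c₁ c₂ p q s : ℝ) :
    (2 * Real.pi)⁻¹ * ∫ θ in (0 : ℝ)..2 * Real.pi, (c₀ + (Real.cos θ * c₁ + Real.sin θ * c₂) +
      (Real.cos θ ^ 2 * p + Real.sin θ ^ 2 * q + Real.sin θ * Real.cos θ * s))
      = c₀ + (p + q) / 2 := by
  have i : ∀ f : ℝ → ℝ, Continuous f → IntervalIntegrable f volume 0 (2 * Real.pi) :=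
    fun f hf => hf.intervalIntegrable _ _
  rw [intervalIntegral.integral_add (i _ (by fun_prop)) (i _ (by fun_prop)),
    intervalIntegral.integral_add (i _ (by fun_prop)) (i _ (by fun_prop)),
    intervalIntegral.integral_add (i _ (by fun_prop)) (i _ (by fun_prop)),
    intervalIntegral.integral_add (i _ (by fun_prop)) (i _ (by fun_prop)),
    intervalIntegral.integral_add (i _ (by fun_prop)) (i _ (by fun_prop))]
  simp only [intervalIntegral.integral_mul_const, intervalIntegral.integral_const, integral_cos,
    integral_sin, integral_cos_sq, integral_sin_sq, integral_sin_mul_cos₁]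
  simp
  field_simp

/-- The Levi form of a plurisubharmonic function is nonnegative. -/
theorem Plurisubharmonic.levi_nonneg {φ : (Fin n → ℂ) → ℝ} (hφ : ContDiff ℝ 2 φ)
    (hpsh : Plurisubharmonic φ) (a b : Fin n → ℂ) :
    0 ≤ fderiv ℝ (fderiv ℝ φ) a b b
      + fderiv ℝ (fderiv ℝ φ) a (Complex.I • b) (Complex.I • b) := by
  set B := fderiv ℝ (fderiv ℝ φ) a with hB
  set D := fderiv ℝ φ a with hD
  by_contra! hneg
  set L := B b b + B (Complex.I • b) (Complex.I • b) with hL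
  -- On the circle of radius `r` the quadratic term has mean `r² L / 4`. With this `ε` the remainder
  -- is at most `-r² L / 8`, so the mean of `φ` would not exceed `φ a + r² L / 8 < φ a`,
  -- contradicting the sub-mean value inequality.
  have hε : 0 < -L / (8 * (‖b‖ ^ 2 + 1)) := div_pos (by linarith) (by positivity)
  obtain ⟨δ, hδ, hT⟩ := eventually_taylor_two hφ a hε
  set r : ℝ := δ / (2 * (‖b‖ + 1)) with hr
  have hr0 : 0 < r := by positivity
  have hrb : r * ‖b‖ < δ := by
    have h1 : r * (‖b‖ + 1) = δ / 2 := by rw [hr]; field_simp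
    nlinarith
  have hcirc : ∀ θ : ℝ, circleMap 0 1 θ • ((r : ℂ) • b)
      = r • (Real.cos θ • b + Real.sin θ • (Complex.I • b)) := by
    intro θ
    ext k
    simp only [circleMap, Pi.smul_apply, Pi.add_apply, smul_eq_mul, Complex.real_smul,
      Complex.exp_mul_I, Complex.ofReal_cos, Complex.ofReal_sin]
    push_cast
    ring
  have hnorm : ∀ θ : ℝ, ‖circleMap 0 1 θ • ((r : ℂ) • b)‖ = r * ‖b‖ := by
    intro θ
    rw [norm_smul, norm_smul, norm_circleMap_zero, Complex.norm_real, Real.norm_of_nonneg hr0.le]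
    simp
  have hle : ∀ θ : ℝ, φ (a + circleMap 0 1 θ • ((r : ℂ) • b)) ≤
      (φ a + -L / (8 * (‖b‖ ^ 2 + 1)) * (r * ‖b‖) ^ 2)
        + (Real.cos θ * (r * D b) + Real.sin θ * (r * D (Complex.I • b)))
        + (Real.cos θ ^ 2 * (r ^ 2 / 2 * B b b)
          + Real.sin θ ^ 2 * (r ^ 2 / 2 * B (Complex.I • b) (Complex.I • b))
          + Real.sin θ * Real.cos θ * (r ^ 2 / 2 * (B b (Complex.I • b) + B (Complex.I • b) b))) := by
    intro θ
    have h := (abs_le.1 (hT (circleMap 0 1 θ • ((r : ℂ) • b)) (by rw [hnorm]; exact hrb))).2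
    rw [hnorm] at h
    have h1 : D (circleMap 0 1 θ • ((r : ℂ) • b))
        = Real.cos θ * (r * D b) + Real.sin θ * (r * D (Complex.I • b)) := by
      rw [hcirc]
      simp only [map_smul, map_add, smul_eq_mul]
      ring
    have h2 : 1 / 2 * B (circleMap 0 1 θ • ((r : ℂ) • b)) (circleMap 0 1 θ • ((r : ℂ) • b))
        = Real.cos θ ^ 2 * (r ^ 2 / 2 * B b b)
          + Real.sin θ ^ 2 * (r ^ 2 / 2 * B (Complex.I • b) (Complex.I • b))
          + Real.sin θ * Real.cos θ *
            (r ^ 2 / 2 * (B b (Complex.I • b) + B (Complex.I • b) b)) := by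
      rw [hcirc]
      simp only [map_smul, map_add, smul_eq_mul, _root_.add_apply, _root_.smul_apply]
      ring
    rw [← hD, ← hB, h1, h2] at h
    linarith
  have havg := hpsh.2 a ((r : ℂ) • b)
  rw [Real.circleAverage_def, smul_eq_mul] at havg
  have hint : ∫ θ in (0 : ℝ)..2 * Real.pi, φ (a + circleMap 0 1 θ • ((r : ℂ) • b)) ≤ _ :=
    intervalIntegral.integral_mono (by positivity)
      ((hφ.continuous.comp (by fun_prop)).intervalIntegrable _ _)
      (Continuous.intervalIntegrable (by fun_prop) _ _) hle
  have h3 := havg.trans (mul_le_mul_of_nonneg_left hint (by positivity))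
  rw [circleAverage_quadratic] at h3
  have h4 : -L / (8 * (‖b‖ ^ 2 + 1)) * (r * ‖b‖) ^ 2 ≤ r ^ 2 * (-L / 8) := by
    have h5 : -L / (8 * (‖b‖ ^ 2 + 1)) * (‖b‖ ^ 2 + 1) = -L / 8 := by field_simp
    have h6 : -L / (8 * (‖b‖ ^ 2 + 1)) * ‖b‖ ^ 2 ≤ -L / 8 := by nlinarith
    calc _ = r ^ 2 * (-L / (8 * (‖b‖ ^ 2 + 1)) * ‖b‖ ^ 2) := by ring
      _ ≤ _ := mul_le_mul_of_nonneg_left h6 (by positivity)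
  have h7 : 0 ≤ r ^ 2 * (L / 8) := by
    have : (r ^ 2 / 2 * B b b + r ^ 2 / 2 * B (Complex.I • b) (Complex.I • b)) / 2
        = r ^ 2 * (L / 4) := by rw [hL]; ring
    linarith
  nlinarith [pow_pos hr0 2]

theorem fderiv_fderiv_ofReal {φ : (Fin n → ℂ) → ℝ} (hφ : ContDiff ℝ 2 φ) (z u v : Fin n → ℂ) :
    fderiv ℝ (fderiv ℝ fun w => (φ w : ℂ)) z u v = (fderiv ℝ (fderiv ℝ φ) z u v : ℝ) := by
  have hd1 : Differentiable ℝ φ := hφ.differentiable (by norm_num)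
  have hd2 : DifferentiableAt ℝ (fderiv ℝ φ) z :=
    (hφ.fderiv_right (m := 1) (by norm_num)).differentiable (by norm_num) z
  have h1 : ∀ w, fderiv ℝ (fun w => (φ w : ℂ)) w = Complex.ofRealCLM.comp (fderiv ℝ φ w) :=
    fun w => (Complex.ofRealCLM.hasFDerivAt.comp w (hd1 w).hasFDerivAt).fderiv
  have hf : ContDiff ℝ 2 fun w => (φ w : ℂ) := Complex.ofRealCLM.contDiff.comp hφ
  rw [← fderiv_fderiv_apply hf]
  simp only [h1, ContinuousLinearMap.comp_apply]
  have h2 : HasFDerivAt (fun w => fderiv ℝ φ w v)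
      ((fderiv ℝ (fderiv ℝ φ) z).flip v) z := by
    refine (hd2.hasFDerivAt.clm_apply (hasFDerivAt_const v z)).congr_fderiv ?_
    ext; simp
  have h3 : fderiv ℝ (fun w => Complex.ofRealCLM (fderiv ℝ φ w v)) z = _ :=
    (Complex.ofRealCLM.hasFDerivAt.comp z h2).fderiv
  rw [h3]
  rfl

/-- The entries of the complex Hessian of a plurisubharmonic function are bounded by its trace. -/
theorem Plurisubharmonic.norm_complexHessian_le {φ : (Fin n → ℂ) → ℝ} (hφ : ContDiff ℝ 2 φ)
    (hpsh : Plurisubharmonic φ) (z : Fin n → ℂ) (j k : Fin n) :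
    ‖complexHessian φ z j k‖ ≤ 2 * (complexHessian φ z).trace.re := by
  have hf : ContDiff ℝ 2 fun w => (φ w : ℂ) := Complex.ofRealCLM.contDiff.comp hφ
  set B := fderiv ℝ (fderiv ℝ φ) z with hB
  set e : Fin n → Fin n → ℂ := fun j => Pi.single j 1 with he
  set e' : Fin n → Fin n → ℂ := fun j => Pi.single j Complex.I with he'
  have hIe : ∀ j, Complex.I • e j = e' j := fun j => by
    simp only [he, he', ← Pi.single_smul]; simp
  have hIe' : ∀ j, Complex.I • e' j = -e j := fun j => by
    simp only [he, he', ← Pi.single_smul, ← Pi.single_neg]; simp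
  have hpos : ∀ b, 0 ≤ B b b + B (Complex.I • b) (Complex.I • b) := hpsh.levi_nonneg hφ z
  have hsymm : ∀ u v, B u v = B v u := fun u v =>
    (hφ.contDiffAt.isSymmSndFDerivAt (by simp)).eq u v
  have hH : ∀ j k, complexHessian φ z j k = (1 / 4 : ℂ) *
      (((B (e j) (e k) + B (e' j) (e' k) : ℝ) : ℂ)
        + ((B (e j) (e' k) - B (e' j) (e k) : ℝ) : ℂ) * Complex.I) := by
    intro j k
    simp only [complexHessian, Matrix.of_apply]
    rw [wirtinger, fderiv_wirtingerBar hf, fderiv_wirtingerBar hf]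
    simp only [fderiv_fderiv_ofReal hφ]
    push_cast
    linear_combination (-(1 / 4 : ℂ) * (B (e' j) (e' k) : ℂ)) * Complex.I_mul_I
  have hre : ∀ j, (complexHessian φ z j j).re = 1 / 4 * (B (e j) (e j) + B (e' j) (e' j)) := by
    intro j
    rw [hH, hsymm (e' j) (e j)]
    simp
  have hnn : ∀ j, 0 ≤ (complexHessian φ z j j).re := fun j => by
    rw [hre]
    have := hpos (e j)
    rw [hIe] at this
    linarith
  have htr : ∀ j, (complexHessian φ z j j).re ≤ (complexHessian φ z).trace.re := by
    intro j
    simp only [Matrix.trace, Matrix.diag_apply, Complex.re_sum]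
    exact Finset.single_le_sum (f := fun j => (complexHessian φ z j j).re)
      (fun i _ => hnn i) (Finset.mem_univ j)
  -- Polarisation of the positive semidefinite form `B(u, v) + B(iu, iv)`. The pairs `(e_j, e_k)`
  -- and `(e_j, i e_k)` give the real and imaginary parts of four times the Hessian entry; each is
  -- at most four times the trace, which yields the factor `2`.
  have habs : ∀ u v, |B u v + B (Complex.I • u) (Complex.I • v)| ≤
      ((B u u + B (Complex.I • u) (Complex.I • u))
        + (B v v + B (Complex.I • v) (Complex.I • v))) / 2 := by
    intro u v
    have h1 := hpos (u + v)
    have h2 := hpos (u - v)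
    simp only [smul_add, smul_sub, map_add, map_sub, _root_.add_apply, _root_.sub_apply] at h1 h2
    rw [hsymm v u, hsymm (Complex.I • v) (Complex.I • u)] at h1 h2
    rw [abs_le]
    constructor <;> linarith
  have h1 := habs (e j) (e k)
  have h2 := habs (e j) (e' k)
  simp only [hIe, hIe', map_neg, _root_.neg_apply, neg_neg] at h1 h2
  have h3 := htr j
  have h4 := htr k
  rw [hre] at h3 h4
  rw [hH, norm_mul]
  have h5 := norm_add_le (((B (e j) (e k) + B (e' j) (e' k) : ℝ) : ℂ))
    (((B (e j) (e' k) - B (e' j) (e k) : ℝ) : ℂ) * Complex.I)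
  rw [norm_mul, Complex.norm_I, mul_one, Complex.norm_real, Complex.norm_real, Real.norm_eq_abs,
    Real.norm_eq_abs] at h5
  rw [← sub_eq_add_neg] at h2
  have h6 : ‖(1 / 4 : ℂ)‖ = 1 / 4 := by simp
  rw [h6]
  linarith

theorem continuous_complexHessian_trace {φ : (Fin n → ℂ) → ℝ} (hφ : ContDiff ℝ 2 φ) :
    Continuous fun z => (complexHessian φ z).trace.re := by
  have hf : ContDiff ℝ 2 fun w => (φ w : ℂ) := Complex.ofRealCLM.contDiff.comp hφ
  simp only [Matrix.trace, Matrix.diag_apply, complexHessian, Matrix.of_apply]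
  refine Complex.continuous_re.comp (continuous_finsetSum _ fun j _ => ?_)
  exact (contDiff_wirtinger (m := 0) (m' := 1) (contDiff_wirtingerBar hf (by norm_num) j)
    (by norm_num) j).continuous

/-- A limsup below `⊤` bounds the trace off a compact set, and continuity bounds it on that set. -/
theorem exists_trace_le_of_limsup_ne_top {φ : (Fin n → ℂ) → ℝ} (hφ : ContDiff ℝ 2 φ)
    (h : limsup (fun z : Fin n → ℂ => (((complexHessian φ z).trace.re : ℝ) : EReal))
      (cocompact (Fin n → ℂ)) ≠ ⊤) :
    ∃ C : ℝ, ∀ z, (complexHessian φ z).trace.re ≤ C := by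
  obtain ⟨B, hB, -⟩ := EReal.lt_iff_exists_real_btwn.1 (lt_top_iff_ne_top.2 h)
  obtain ⟨K, hK, hKB⟩ := mem_cocompact.1 (eventually_lt_of_limsup_lt hB)
  obtain ⟨B', hB'⟩ := (hK.image (continuous_complexHessian_trace hφ)).isBounded.exists_norm_le
  refine ⟨max B B', fun z => ?_⟩
  by_cases hz : z ∈ K
  · exact (le_abs_self _).trans ((hB' _ ⟨z, hz, rfl⟩).trans (le_max_right _ _))
  · have : ((complexHessian φ z).trace.re : EReal) < B := hKB hz
    exact (EReal.coe_lt_coe_iff.1 this).le.trans (le_max_left _ _)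

end Levi

/-! ### Weak equations tested against `C¹` functions. -/

section TestFunctions

variable {n : ℕ}

theorem norm_wirtingerBar_sub_le {f g : (Fin n → ℂ) → ℂ} {z : Fin n → ℂ} {ε : ℝ} (j : Fin n)
    (h : ‖fderiv ℝ f z - fderiv ℝ g z‖ ≤ ε) : ‖wirtingerBar j f z - wirtingerBar j g z‖ ≤ ε := by
  have h1 : ∀ c : ℂ, ‖c‖ = 1 →
      ‖fderiv ℝ f z (Pi.single j c) - fderiv ℝ g z (Pi.single j c)‖ ≤ ε := by
    intro c hc
    rw [← _root_.sub_apply]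
    refine (ContinuousLinearMap.le_opNorm _ _).trans ?_
    rw [Pi.norm_single, hc, mul_one]
    exact h
  have h2 : wirtingerBar j f z - wirtingerBar j g z = (1 / 2 : ℂ) *
      ((fderiv ℝ f z (Pi.single j 1) - fderiv ℝ g z (Pi.single j 1)) + Complex.I *
        (fderiv ℝ f z (Pi.single j Complex.I) - fderiv ℝ g z (Pi.single j Complex.I))) := by
    rw [wirtingerBar, wirtingerBar]; ring
  rw [h2, norm_mul]
  have h3 := norm_add_le (fderiv ℝ f z (Pi.single j 1) - fderiv ℝ g z (Pi.single j 1)) (Complex.I *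
        (fderiv ℝ f z (Pi.single j Complex.I) - fderiv ℝ g z (Pi.single j Complex.I)))
  rw [norm_mul, Complex.norm_I, one_mul] at h3
  have h4 := h1 1 (by simp)
  have h5 := h1 Complex.I (by simp)
  have h6 : ‖(1 / 2 : ℂ)‖ = 1 / 2 := by simp
  rw [h6]
  linarith

/-- Approximation of `C¹` functions with compact support by smooth ones, in `C¹` norm and with
uniform control of the supports. -/
theorem exists_contDiff_approx {χ : (Fin n → ℂ) → ℂ} (hχ : ContDiff ℝ 1 χ)
    (hχc : HasCompactSupport χ) {ε : ℝ} (hε : 0 < ε) :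
    ∃ χ' : (Fin n → ℂ) → ℂ, ContDiff ℝ ∞ χ' ∧ HasCompactSupport χ' ∧
      tsupport χ' ⊆ cthickening 1 (tsupport χ) ∧
      (∀ z, ‖χ' z - χ z‖ ≤ ε) ∧ ∀ z, ‖fderiv ℝ χ' z - fderiv ℝ χ z‖ ≤ ε := by
  have hu0 := hχc.uniformContinuous_of_continuous hχ.continuous
  have hu1 := (hχc.fderiv ℝ).uniformContinuous_of_continuous (hχ.continuous_fderiv (by norm_num))
  obtain ⟨δ₀, hδ₀, h0⟩ := Metric.uniformContinuous_iff.1 hu0 ε hε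
  obtain ⟨δ₁, hδ₁, h1⟩ := Metric.uniformContinuous_iff.1 hu1 ε hε
  -- The mollifier radius respects the moduli of continuity of `χ` and of its derivative; the bound
  -- `1` keeps all supports in one compact set, independent of `ε`.
  have hδ : 0 < min 1 (min δ₀ δ₁) := by positivity
  let ρ : ContDiffBump (0 : Fin n → ℂ) := ⟨min 1 (min δ₀ δ₁) / 2, min 1 (min δ₀ δ₁),
    by positivity, by linarith⟩
  have hρ : ρ.rOut = min 1 (min δ₀ δ₁) := rfl
  set χ' := MeasureTheory.convolution (ρ.normed volume) χ (ContinuousLinearMap.lsmul ℝ ℝ) volume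
    with hχ'
  have hρi : LocallyIntegrable (ρ.normed volume) (volume : Measure (Fin n → ℂ)) :=
    ρ.integrable_normed.locallyIntegrable
  have hsupp : tsupport χ' ⊆ cthickening 1 (tsupport χ) := by
    refine closure_minimal ?_ isClosed_cthickening
    refine (support_convolution_subset (ContinuousLinearMap.lsmul ℝ ℝ)).trans ?_
    rw [ρ.support_normed_eq]
    rintro z ⟨x, hx, y, hy, rfl⟩
    refine mem_cthickening_of_dist_le _ y 1 _ (subset_tsupport _ hy) ?_
    rw [mem_ball_zero_iff, hρ] at hx
    simpa using hx.le.trans (min_le_left _ _)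
  have hcomp : HasCompactSupport χ' :=
    (hχc.isCompact.cthickening).of_isClosed_subset (isClosed_tsupport _) hsupp
  refine ⟨χ', ?_, hcomp, hsupp, fun z => ?_, fun z => ?_⟩
  · exact ρ.hasCompactSupport_normed.contDiff_convolution_left _ ρ.contDiff_normed
      hχ.continuous.locallyIntegrable
  · rw [← dist_eq_norm]
    refine ρ.dist_normed_convolution_le hχ.continuous.aestronglyMeasurable fun x hx => ?_
    rw [mem_ball, hρ] at hx
    exact (h0 (hx.trans_le ((min_le_right _ _).trans (min_le_left _ _)))).le
  · have hd := hχc.hasFDerivAt_convolution_right (ContinuousLinearMap.lsmul ℝ ℝ) hρi hχ z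
    have heq : fderiv ℝ χ' z = MeasureTheory.convolution (ρ.normed volume) (fderiv ℝ χ)
        (ContinuousLinearMap.lsmul ℝ ℝ) volume z := by
      rw [hd.fderiv]
      rfl
    rw [heq, ← dist_eq_norm]
    refine ρ.dist_normed_convolution_le
      (hχ.continuous_fderiv (by norm_num)).aestronglyMeasurable fun x hx => ?_
    rw [mem_ball, hρ] at hx
    exact (h1 (hx.trans_le ((min_le_right _ _).trans (min_le_right _ _)))).le

theorem norm_integral_mul_sub_le {f χ χ' : (Fin n → ℂ) → ℂ} (hf : LocallyIntegrable f volume)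
    {S : Set (Fin n → ℂ)} (hS : IsCompact S) {ε : ℝ}
    (hi : Integrable (fun z => f z * χ z) volume) (hi' : Integrable (fun z => f z * χ' z) volume)
    (hχ : ∀ z ∉ S, χ z = 0) (hχ' : ∀ z ∉ S, χ' z = 0) (h : ∀ z, ‖χ' z - χ z‖ ≤ ε) :
    ‖(∫ z, f z * χ' z) - ∫ z, f z * χ z‖ ≤ ε * ∫ z in S, ‖f z‖ := by
  rw [← integral_sub hi' hi]
  have hsupp : ∀ z ∉ S, f z * χ' z - f z * χ z = 0 := fun z hz => by
    rw [hχ z hz, hχ' z hz]; ring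
  rw [← setIntegral_eq_integral_of_forall_compl_eq_zero hsupp, ← integral_const_mul]
  refine norm_integral_le_of_norm_le ((hf.integrableOn_isCompact hS).norm.const_mul ε)
    (Eventually.of_forall fun z => ?_)
  rw [← mul_sub, norm_mul, mul_comm]
  exact mul_le_mul_of_nonneg_right (h z) (norm_nonneg _)

theorem continuous_wirtingerBar_one (j : Fin n) {χ : (Fin n → ℂ) → ℂ} (hχ : ContDiff ℝ 1 χ) :
    Continuous (wirtingerBar j χ) :=
  (contDiff_wirtingerBar (m := 0) hχ (by norm_num) j).continuous

theorem wirtingerBar_eq_zero_of_notMem_tsupport {χ : (Fin n → ℂ) → ℂ} {z : Fin n → ℂ}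
    (hz : z ∉ tsupport χ) (j : Fin n) : wirtingerBar j χ z = 0 := by
  have : fderiv ℝ χ z = 0 := by
    by_contra h
    exact hz (support_fderiv_subset ℝ h)
  simp [wirtingerBar, this]

/-- A first order weak equation may be tested against `C¹` functions. -/
theorem weak_equation_of_contDiff_one {ι : Type*} [Fintype ι] {g : (Fin n → ℂ) → ℂ}
    {f : ι → (Fin n → ℂ) → ℂ} (hg : LocallyIntegrable g volume)
    (hf : ∀ i, LocallyIntegrable (f i) volume) (c : ι → ℂ) (k : ι → Fin n)
    (hweak : ∀ χ : (Fin n → ℂ) → ℂ, ContDiff ℝ ∞ χ → HasCompactSupport χ →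
      ∫ z, g z * χ z = - ∑ i, c i * ∫ z, f i z * wirtingerBar (k i) χ z)
    {χ : (Fin n → ℂ) → ℂ} (hχ : ContDiff ℝ 1 χ) (hχc : HasCompactSupport χ) :
    ∫ z, g z * χ z = - ∑ i, c i * ∫ z, f i z * wirtingerBar (k i) χ z := by
  have hint : ∀ u : (Fin n → ℂ) → ℂ, LocallyIntegrable u volume → ∀ v : (Fin n → ℂ) → ℂ,
      Continuous v → HasCompactSupport v → Integrable (fun z => u z * v z) volume := by
    intro u hu v hv hvc
    simpa using hu.integrable_smul_right_of_hasCompactSupport hv hvc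
  set S := cthickening 1 (tsupport χ) with hS
  have hSc : IsCompact S := hχc.isCompact.cthickening
  have hsub : tsupport χ ⊆ S := self_subset_cthickening _
  set M : ℝ := (∫ z in S, ‖g z‖) + ∑ i, ‖c i‖ * ∫ z in S, ‖f i z‖ with hM
  have hM0 : 0 ≤ M := add_nonneg (integral_nonneg fun _ => norm_nonneg _)
    (Finset.sum_nonneg fun _ _ => mul_nonneg (norm_nonneg _) (integral_nonneg fun _ => norm_nonneg _))
  rw [← sub_eq_zero, ← norm_le_zero_iff]
  refine le_of_forall_pos_le_add fun ε hε => ?_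
  rw [zero_add]
  -- `M` collects the weighted `L¹` masses of the coefficients on `S`, so the total error is at most
  -- `ε M / (M + 1)`; the added `1` keeps the denominator positive.
  obtain ⟨χ', hχ', hχ'c, hsub', h0, h1⟩ :=
    exists_contDiff_approx hχ hχc (ε := ε / (M + 1)) (by positivity)
  have e1 := norm_integral_mul_sub_le hg hSc (hint g hg χ hχ.continuous hχc)
    (hint g hg χ' hχ'.continuous hχ'c)
    (fun z hz => image_eq_zero_of_notMem_tsupport fun h => hz (hsub h))
    (fun z hz => image_eq_zero_of_notMem_tsupport fun h => hz (hsub' h)) h0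
  have e2 : ∀ i, ‖c i * (∫ z, f i z * wirtingerBar (k i) χ' z)
        - c i * ∫ z, f i z * wirtingerBar (k i) χ z‖
        ≤ ε / (M + 1) * (‖c i‖ * ∫ z in S, ‖f i z‖) := by
    intro i
    rw [← mul_sub, norm_mul, mul_left_comm]
    refine mul_le_mul_of_nonneg_left ?_ (norm_nonneg _)
    exact norm_integral_mul_sub_le (hf i) hSc
      (hint _ (hf i) _ (continuous_wirtingerBar_one _ hχ)
        (hasCompactSupport_wirtingerBar _ hχc))
      (hint _ (hf i) _ (continuous_wirtingerBar _ hχ')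
        (hasCompactSupport_wirtingerBar _ hχ'c))
      (fun z hz => wirtingerBar_eq_zero_of_notMem_tsupport (fun h => hz (hsub h)) _)
      (fun z hz => wirtingerBar_eq_zero_of_notMem_tsupport (fun h => hz (hsub' h)) _)
      (fun z => norm_wirtingerBar_sub_le _ (h1 z))
  have e3 : (∫ z, g z * χ z) - -∑ i, c i * ∫ z, f i z * wirtingerBar (k i) χ z
      = -(((∫ z, g z * χ' z) - ∫ z, g z * χ z) + ∑ i,
        (c i * (∫ z, f i z * wirtingerBar (k i) χ' z)
        - c i * ∫ z, f i z * wirtingerBar (k i) χ z)) := by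
    rw [hweak χ' hχ' hχ'c, Finset.sum_sub_distrib]
    ring
  rw [e3, norm_neg]
  calc _ ≤ ε / (M + 1) * (∫ z in S, ‖g z‖) + ∑ i, ε / (M + 1) * (‖c i‖ * ∫ z in S, ‖f i z‖) :=
      (norm_add_le _ _).trans (add_le_add e1 ((norm_sum_le _ _).trans
        (Finset.sum_le_sum fun j _ => e2 j)))
    _ = ε / (M + 1) * M := by rw [← Finset.mul_sum, ← mul_add]
    _ ≤ ε := by
      rw [div_mul_eq_mul_div, div_le_iff₀ (by positivity)]
      nlinarith

/-- Needed because the weight is only `C²`: the functions `conj (V K) e^{-φ}` against which the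
adjoint is computed need not be smooth. -/
theorem integral_eq_of_mem_dbarGraph {q : ℕ} {φ : (Fin n → ℂ) → ℝ} (hφ : ContDiff ℝ 2 φ)
    {f : L2Forms φ q} {g : L2Forms φ (q + 1)} (hfg : (f, g) ∈ dbarGraph φ hφ q)
    (K : MultiIndex n (q + 1)) {χ : (Fin n → ℂ) → ℂ} (hχ : ContDiff ℝ 1 χ)
    (hχc : HasCompactSupport χ) :
    ∫ z, g z K * χ z = - ∑ j : {j : Fin n // j ∈ K.1},
      wedgeSign K j * ∫ z, f z (K.erase j) * wirtingerBar j χ z :=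
  weak_equation_of_contDiff_one (locallyIntegrable_coeff hφ g K)
    (fun j : {j : Fin n // j ∈ K.1} => locallyIntegrable_coeff hφ f (K.erase j))
    (fun j => wedgeSign K j) (fun j => j.1) (hfg K) hχ hχc

/-- Integration by parts for the operators `∂/∂z̄_j`. -/
theorem integral_mul_wirtingerBar {f χ : (Fin n → ℂ) → ℂ} (hf : ContDiff ℝ 1 f)
    (hχ : ContDiff ℝ 1 χ) (hχc : HasCompactSupport χ) (j : Fin n) :
    ∫ z, f z * wirtingerBar j χ z = -∫ z, wirtingerBar j f z * χ z := by
  have hfc := hf.continuous_fderiv (by norm_num)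
  have hχf := hχ.continuous_fderiv (by norm_num)
  have hc0 := hf.continuous
  have hc1 := hχ.continuous
  have hA : ∀ v, Integrable (fun z => f z * fderiv ℝ χ z v) (volume : Measure (Fin n → ℂ)) :=
    fun v => Continuous.integrable_of_hasCompactSupport (by fun_prop)
      ((hχc.fderiv_apply ℝ v).mul_left)
  have hB : ∀ v, Integrable (fun z => fderiv ℝ f z v * χ z) (volume : Measure (Fin n → ℂ)) :=
    fun v => Continuous.integrable_of_hasCompactSupport (by fun_prop) hχc.mul_left
  have hC : Integrable (fun z => f z * χ z) (volume : Measure (Fin n → ℂ)) :=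
    Continuous.integrable_of_hasCompactSupport (by fun_prop) hχc.mul_left
  have hparts : ∀ v, ∫ z, f z * fderiv ℝ χ z v = -∫ z, fderiv ℝ f z v * χ z := fun v =>
    integral_mul_fderiv_eq_neg_fderiv_mul_of_integrable (hB v) (hA v) hC
      (fun x _ => hf.differentiable (by norm_num) x) (fun x _ => hχ.differentiable (by norm_num) x)
  have h1 : ∀ z, f z * wirtingerBar j χ z = (1 / 2 : ℂ) * (f z * fderiv ℝ χ z (Pi.single j 1))
      + (1 / 2 * Complex.I) * (f z * fderiv ℝ χ z (Pi.single j Complex.I)) := fun z => by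
    rw [wirtingerBar]; ring
  have h2 : ∀ z, wirtingerBar j f z * χ z = (1 / 2 : ℂ) * (fderiv ℝ f z (Pi.single j 1) * χ z)
      + (1 / 2 * Complex.I) * (fderiv ℝ f z (Pi.single j Complex.I) * χ z) := fun z => by
    rw [wirtingerBar]; ring
  simp only [h1, h2]
  rw [integral_add ((hA _).const_mul _) ((hA _).const_mul _),
    integral_add ((hB _).const_mul _) ((hB _).const_mul _)]
  simp only [integral_const_mul, hparts]
  ring

end TestFunctions

/-! ### Compactly supported forms as elements of `L2Forms`, and the formal adjoint. -/

section CompactForms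

variable {n q : ℕ} {φ : (Fin n → ℂ) → ℝ}

/-- The vector of coefficients of a form. -/
noncomputable def coeffVec (F : MultiIndex n q → (Fin n → ℂ) → ℂ) (z : Fin n → ℂ) :
    EuclideanSpace ℂ (MultiIndex n q) :=
  WithLp.toLp 2 fun J => F J z

/-- The classical `∂̄` of a form with differentiable coefficients. -/
noncomputable def dbarForm (F : MultiIndex n q → (Fin n → ℂ) → ℂ) (K : MultiIndex n (q + 1))
    (z : Fin n → ℂ) : ℂ :=
  ∑ j : {j : Fin n // j ∈ K.1}, wedgeSign K j * wirtingerBar j (F (K.erase j)) z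

/-- The formal adjoint of `∂̄` in the weighted space, on forms with differentiable coefficients. -/
noncomputable def dbarStarForm (φ : (Fin n → ℂ) → ℝ)
    (V : MultiIndex n (q + 1) → (Fin n → ℂ) → ℂ) (J : MultiIndex n q) (z : Fin n → ℂ) : ℂ :=
  -∑ K : MultiIndex n (q + 1), ∑ j : {j : Fin n // j ∈ K.1}, if K.erase j = J then
    wedgeSign K j * (wirtinger j (V K) z - wirtinger j (fun w => (φ w : ℂ)) z * V K z) else 0

theorem isLocallyFiniteMeasure_weightedMeasure (hφ : ContDiff ℝ 2 φ) :
    IsLocallyFiniteMeasure (weightedMeasure φ) :=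
  IsLocallyFiniteMeasure.withDensity_ofReal (Real.continuous_exp.comp hφ.continuous.neg)

theorem continuous_coeffVec {F : MultiIndex n q → (Fin n → ℂ) → ℂ}
    (hF : ∀ J, Continuous (F J)) : Continuous (coeffVec F) :=
  (PiLp.continuous_toLp 2 _).comp (continuous_pi hF)

theorem hasCompactSupport_coeffVec {F : MultiIndex n q → (Fin n → ℂ) → ℂ}
    (hF : ∀ J, HasCompactSupport (F J)) : HasCompactSupport (coeffVec F) := by
  refine HasCompactSupport.intro (K := ⋃ J, tsupport (F J)) (isCompact_iUnion fun J => hF J)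
    fun z hz => ?_
  ext J
  simp only [Set.mem_iUnion, not_exists] at hz
  exact (image_eq_zero_of_notMem_tsupport (hz J) : F J z = 0)

theorem memLp_coeffVec (hφ : ContDiff ℝ 2 φ) {F : MultiIndex n q → (Fin n → ℂ) → ℂ}
    (hF : ∀ J, Continuous (F J)) (hFc : ∀ J, HasCompactSupport (F J)) :
    MemLp (coeffVec F) 2 (weightedMeasure φ) := by
  have := isLocallyFiniteMeasure_weightedMeasure hφ
  exact (continuous_coeffVec hF).memLp_of_hasCompactSupport (hasCompactSupport_coeffVec hFc)

/-- The element of `L²_{0,q}` given by a form. -/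
noncomputable def formLp {F : MultiIndex n q → (Fin n → ℂ) → ℂ}
    (hF : MemLp (coeffVec F) 2 (weightedMeasure φ)) : L2Forms φ q :=
  hF.toLp

theorem formLp_coeff_ae (hφ : ContDiff ℝ 2 φ) {F : MultiIndex n q → (Fin n → ℂ) → ℂ}
    (hF : MemLp (coeffVec F) 2 (weightedMeasure φ)) (J : MultiIndex n q) :
    ∀ᵐ z ∂(volume : Measure (Fin n → ℂ)), formLp hF z J = F J z := by
  filter_upwards [(volume_ac hφ).ae_le hF.coeFn_toLp] with z hz
  rw [formLp, hz]
  rfl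

theorem integral_weightedMeasure (hφ : ContDiff ℝ 2 φ) {E : Type*} [NormedAddCommGroup E]
    [NormedSpace ℝ E] (g : (Fin n → ℂ) → E) :
    ∫ z, g z ∂(weightedMeasure φ) = ∫ z, Real.exp (-φ z) • g z := by
  have hm : Measurable fun z => ENNReal.ofReal (Real.exp (-φ z)) :=
    (Real.continuous_exp.comp hφ.continuous.neg).measurable.ennreal_ofReal
  rw [weightedMeasure, integral_withDensity_eq_integral_toReal_smul hm
    (Eventually.of_forall fun _ => ENNReal.ofReal_lt_top)]
  simp only [ENNReal.toReal_ofReal (Real.exp_pos _).le]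

theorem contDiff_conj {m : WithTop ℕ∞} {f : (Fin n → ℂ) → ℂ} (hf : ContDiff ℝ m f) :
    ContDiff ℝ m fun z => conj (f z) :=
  Complex.conjCLE.contDiff.comp hf

theorem contDiff_weight (hφ : ContDiff ℝ 2 φ) :
    ContDiff ℝ 2 fun z => ((Real.exp (-φ z) : ℝ) : ℂ) :=
  Complex.ofRealCLM.contDiff.comp (Real.contDiff_exp.comp hφ.neg)

theorem inner_formLp (hφ : ContDiff ℝ 2 φ) {F : MultiIndex n q → (Fin n → ℂ) → ℂ}
    (hF : ∀ J, Continuous (F J)) (hFc : ∀ J, HasCompactSupport (F J))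
    (hFm : MemLp (coeffVec F) 2 (weightedMeasure φ)) (x : L2Forms φ q) :
    inner ℂ (formLp hFm) x
      = ∑ J, ∫ z, x z J * (conj (F J z) * ((Real.exp (-φ z) : ℝ) : ℂ)) := by
  rw [L2.inner_def, integral_weightedMeasure hφ, ← integral_finsetSum]
  · refine integral_congr_ae ?_
    filter_upwards [(volume_ac hφ).ae_le hFm.coeFn_toLp] with z hz
    rw [formLp, hz, PiLp.inner_apply, Finset.smul_sum]
    refine Finset.sum_congr rfl fun J _ => ?_
    rw [Complex.real_smul]
    simp only [coeffVec, RCLike.inner_apply]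
    ring
  · intro J _
    refine integrable_coeff_mul hφ x J ?_ ?_
    · exact (Complex.continuous_conj.comp (hF J)).mul (contDiff_weight hφ).continuous
    · exact ((hFc J).comp_left (g := conj) (map_zero _)).mul_right

theorem formLp_mem_dbarGraph (hφ : ContDiff ℝ 2 φ) {F : MultiIndex n q → (Fin n → ℂ) → ℂ}
    (hF : ∀ J, ContDiff ℝ 1 (F J)) (hFm : MemLp (coeffVec F) 2 (weightedMeasure φ))
    (hdm : MemLp (coeffVec (dbarForm F)) 2 (weightedMeasure φ)) :
    (formLp hFm, formLp hdm) ∈ dbarGraph φ hφ q := by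
  change IsWeakDbar _ _
  intro K χ hχ hχc
  have h1 : ∫ z, formLp hdm z K * χ z = ∫ z, dbarForm F K z * χ z := by
    refine integral_congr_ae ?_
    filter_upwards [formLp_coeff_ae hφ hdm K] with z hz
    rw [hz]
  have h2 : ∀ j : {j : Fin n // j ∈ K.1}, ∫ z, formLp hFm z (K.erase j) * wirtingerBar j χ z
      = -∫ z, wirtingerBar j (F (K.erase j)) z * χ z := fun j => by
    rw [← integral_mul_wirtingerBar (hF _) (hχ.of_le (by simp)) hχc]
    refine integral_congr_ae ?_
    filter_upwards [formLp_coeff_ae hφ hFm (K.erase j)] with z hz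
    rw [hz]
  have hint : ∀ j : {j : Fin n // j ∈ K.1},
      Integrable (fun z => wirtingerBar j (F (K.erase j)) z * χ z) volume := fun j =>
    Continuous.integrable_of_hasCompactSupport
      ((continuous_wirtingerBar_one j.1 (hF (K.erase j))).mul hχ.continuous) hχc.mul_left
  rw [h1]
  simp only [h2, mul_neg, Finset.sum_neg_distrib, neg_neg, dbarForm, Finset.sum_mul, mul_assoc]
  rw [integral_finsetSum]
  · simp only [integral_const_mul]
  · exact fun j _ => (hint j).const_mul _

theorem conj_wedgeSign (K : MultiIndex n (q + 1)) (j : Fin n) :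
    conj (wedgeSign K j) = wedgeSign K j := by
  simp [wedgeSign]

theorem wirtingerBar_weight (hφ : ContDiff ℝ 2 φ) (z : Fin n → ℂ) (j : Fin n) :
    wirtingerBar j (fun z => ((Real.exp (-φ z) : ℝ) : ℂ)) z
      = -(conj (wirtinger j (fun w => (φ w : ℂ)) z) * ((Real.exp (-φ z) : ℝ) : ℂ)) := by
  have hd : DifferentiableAt ℝ (fun w => (φ w : ℂ)) z :=
    (Complex.ofRealCLM.contDiff.comp hφ).differentiable (by norm_num) z
  have h1 : HasFDerivAt (fun z => ((Real.exp (-φ z) : ℝ) : ℂ))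
      (((Real.exp (-φ z) : ℝ) : ℂ) • (-fderiv ℝ (fun w => (φ w : ℂ)) z)) z := by
    have h2 := hd.hasFDerivAt.neg.cexp
    simp only [Pi.neg_apply, ← Complex.ofReal_neg, ← Complex.ofReal_exp] at h2
    exact h2
  rw [← wirtingerBar_ofReal, wirtingerBar, wirtingerBar, h1.fderiv]
  simp only [_root_.smul_apply, _root_.neg_apply, smul_eq_mul]
  ring

theorem contDiff_dbarStarForm_term (hφ : ContDiff ℝ 2 φ) {f : (Fin n → ℂ) → ℂ}
    {m : WithTop ℕ∞} (hm : m ≤ 1) (hf : ContDiff ℝ (m + 1) f) (j : Fin n) :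
    ContDiff ℝ m fun z => wirtinger j f z - wirtinger j (fun w => (φ w : ℂ)) z * f z := by
  have hφc : ContDiff ℝ 2 fun w => (φ w : ℂ) := Complex.ofRealCLM.contDiff.comp hφ
  have h2 : m + 1 ≤ 2 := (add_le_add_left hm 1).trans (by norm_num)
  exact (contDiff_wirtinger hf le_rfl j).sub ((contDiff_wirtinger hφc h2 j).mul
    (hf.of_le (by simp)))

/-- The formal adjoint of `∂̄` is the adjoint on forms with compact support. -/
theorem inner_formLp_dbarStarForm (hφ : ContDiff ℝ 2 φ)
    {V : MultiIndex n (q + 1) → (Fin n → ℂ) → ℂ} (hV : ∀ K, ContDiff ℝ 1 (V K))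
    (hVc : ∀ K, HasCompactSupport (V K)) (hVm : MemLp (coeffVec V) 2 (weightedMeasure φ))
    (hsm : MemLp (coeffVec (dbarStarForm φ V)) 2 (weightedMeasure φ))
    (hsc : ∀ J, HasCompactSupport (dbarStarForm φ V J))
    (hsC : ∀ J, Continuous (dbarStarForm φ V J))
    {x : L2Forms φ q} {y : L2Forms φ (q + 1)} (hxy : (x, y) ∈ dbarGraph φ hφ q) :
    inner ℂ (formLp hsm) x = inner ℂ (formLp hVm) y := by
  rw [inner_formLp hφ hsC hsc, inner_formLp hφ (fun K => (hV K).continuous) hVc]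
  have hwt := contDiff_weight hφ
  have hχ : ∀ K, ContDiff ℝ 1 fun z => conj (V K z) * ((Real.exp (-φ z) : ℝ) : ℂ) := fun K =>
    (contDiff_conj (hV K)).mul (hwt.of_le (by norm_num))
  have hχc : ∀ K, HasCompactSupport fun z => conj (V K z) * ((Real.exp (-φ z) : ℝ) : ℂ) :=
    fun K => ((hVc K).comp_left (g := conj) (map_zero _)).mul_right
  simp only [integral_eq_of_mem_dbarGraph hφ hxy _ (hχ _) (hχc _)]
  -- Differentiating the weight produces the `∂_j φ` term, so this is the conjugated weighted
  -- summand of `dbarStarForm`.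
  have hder : ∀ (K : MultiIndex n (q + 1)) (j : Fin n) (z : Fin n → ℂ),
      wirtingerBar j (fun z => conj (V K z) * ((Real.exp (-φ z) : ℝ) : ℂ)) z
        = conj (wirtinger j (V K) z - wirtinger j (fun w => (φ w : ℂ)) z * V K z)
          * ((Real.exp (-φ z) : ℝ) : ℂ) := by
    intro K j z
    rw [wirtingerBar_mul ((contDiff_conj (hV K)).differentiable (by norm_num) z)
      (hwt.differentiable (by norm_num) z), wirtingerBar_conj, wirtingerBar_weight hφ]
    simp only [map_sub, map_mul]
    ring
  have hint : ∀ (K : MultiIndex n (q + 1)) (j : Fin n) (J : MultiIndex n q), Integrable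
      (fun z => x z J * wirtingerBar j
        (fun z => conj (V K z) * ((Real.exp (-φ z) : ℝ) : ℂ)) z) volume := fun K j J =>
    integrable_coeff_mul hφ x J (continuous_wirtingerBar_one j (hχ K))
      (hasCompactSupport_wirtingerBar j (hχc K))
  have hL : ∀ J : MultiIndex n q,
      ∫ z, x z J * (conj (dbarStarForm φ V J z) * ((Real.exp (-φ z) : ℝ) : ℂ))
        = -∑ K : MultiIndex n (q + 1), ∑ j : {j : Fin n // j ∈ K.1}, if K.erase j = J then
            wedgeSign K j * ∫ z, x z J * wirtingerBar j
              (fun z => conj (V K z) * ((Real.exp (-φ z) : ℝ) : ℂ)) z else 0 := by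
    intro J
    have h1 : ∀ z, x z J * (conj (dbarStarForm φ V J z) * ((Real.exp (-φ z) : ℝ) : ℂ))
        = -∑ K : MultiIndex n (q + 1), ∑ j : {j : Fin n // j ∈ K.1}, if K.erase j = J then
            wedgeSign K j * (x z J * wirtingerBar j
              (fun z => conj (V K z) * ((Real.exp (-φ z) : ℝ) : ℂ)) z) else 0 := by
      intro z
      simp only [dbarStarForm, map_neg, map_sum, hder, neg_mul, mul_neg, Finset.sum_mul,
        Finset.mul_sum]
      congr 1
      refine Finset.sum_congr rfl fun K _ => Finset.sum_congr rfl fun j _ => ?_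
      split_ifs
      · rw [map_mul, conj_wedgeSign]
        ring
      · simp
    have h2 : ∀ (K : MultiIndex n (q + 1)) (j : {j : Fin n // j ∈ K.1}), Integrable (fun z =>
        if K.erase j = J then wedgeSign K j * (x z J * wirtingerBar j
          (fun z => conj (V K z) * ((Real.exp (-φ z) : ℝ) : ℂ)) z) else 0) volume := by
      intro K j
      split_ifs
      · exact (hint K j J).const_mul _
      · exact integrable_zero _ _ _
    simp only [h1]
    rw [integral_neg, integral_finsetSum _ fun K _ => integrable_finsetSum _ fun j _ => h2 K j]
    congr 1
    refine Finset.sum_congr rfl fun K _ => ?_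
    rw [integral_finsetSum _ fun j _ => h2 K j]
    refine Finset.sum_congr rfl fun j _ => ?_
    split_ifs
    · exact integral_const_mul _ _
    · simp
  simp only [hL, Finset.sum_neg_distrib]
  congr 1
  -- Summing over `J` innermost, the condition `K.erase j = J` selects exactly one term.
  rw [Finset.sum_comm]
  refine Finset.sum_congr rfl fun K _ => ?_
  rw [Finset.sum_comm]
  refine Finset.sum_congr rfl fun j _ => ?_
  rw [Finset.sum_ite_eq]
  simp

end CompactForms

/-! ### The classical `∂̄`-complex: regularity, supports and `∂̄² = 0`. -/

section DbarForm

variable {n q : ℕ} {φ : (Fin n → ℂ) → ℝ}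

theorem contDiff_dbarForm {m m' : WithTop ℕ∞} (h : m + 1 ≤ m')
    {F : MultiIndex n q → (Fin n → ℂ) → ℂ} (hF : ∀ J, ContDiff ℝ m' (F J))
    (K : MultiIndex n (q + 1)) : ContDiff ℝ m (dbarForm F K) := by
  unfold dbarForm
  exact ContDiff.sum fun j _ => contDiff_const.mul (contDiff_wirtingerBar (hF _) h _)

theorem dbarForm_eq_zero {F : MultiIndex n q → (Fin n → ℂ) → ℂ} {z : Fin n → ℂ}
    (hz : ∀ J, z ∉ tsupport (F J)) (K : MultiIndex n (q + 1)) : dbarForm F K z = 0 := by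
  simp only [dbarForm, wirtingerBar_eq_zero_of_notMem_tsupport (hz _), mul_zero,
    Finset.sum_const_zero]

theorem tsupport_dbarForm_subset {F : MultiIndex n q → (Fin n → ℂ) → ℂ} {S : Set (Fin n → ℂ)}
    (hS : IsClosed S) (hF : ∀ J, tsupport (F J) ⊆ S) (K : MultiIndex n (q + 1)) :
    tsupport (dbarForm F K) ⊆ S := by
  refine closure_minimal (fun z hz => ?_) hS
  by_contra h
  exact hz (dbarForm_eq_zero (fun J hJ => h (hF J hJ)) K)

theorem wirtinger_eq_zero_of_notMem_tsupport {χ : (Fin n → ℂ) → ℂ} {z : Fin n → ℂ}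
    (hz : z ∉ tsupport χ) (j : Fin n) : wirtinger j χ z = 0 := by
  have : fderiv ℝ χ z = 0 := by
    by_contra h
    exact hz (support_fderiv_subset ℝ h)
  simp [wirtinger, this]

theorem dbarStarForm_eq_zero {V : MultiIndex n (q + 1) → (Fin n → ℂ) → ℂ} {z : Fin n → ℂ}
    (hz : ∀ K, z ∉ tsupport (V K)) (J : MultiIndex n q) : dbarStarForm φ V J z = 0 := by
  simp only [dbarStarForm, wirtinger_eq_zero_of_notMem_tsupport (hz _),
    image_eq_zero_of_notMem_tsupport (hz _), mul_zero, sub_zero, ite_self, Finset.sum_const_zero,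
    neg_zero]

theorem tsupport_dbarStarForm_subset {V : MultiIndex n (q + 1) → (Fin n → ℂ) → ℂ}
    {S : Set (Fin n → ℂ)} (hS : IsClosed S) (hV : ∀ K, tsupport (V K) ⊆ S) (J : MultiIndex n q) :
    tsupport (dbarStarForm φ V J) ⊆ S := by
  refine closure_minimal (fun z hz => ?_) hS
  by_contra h
  exact hz (dbarStarForm_eq_zero (fun K hK => h (hV K hK)) J)

theorem contDiff_dbarStarForm (hφ : ContDiff ℝ 2 φ)
    {V : MultiIndex n (q + 1) → (Fin n → ℂ) → ℂ} (hV : ∀ K, ContDiff ℝ 2 (V K))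
    (J : MultiIndex n q) : ContDiff ℝ 1 (dbarStarForm φ V J) := by
  unfold dbarStarForm
  refine ContDiff.neg (ContDiff.sum fun K _ => ContDiff.sum fun j _ => ?_)
  split_ifs
  · exact contDiff_const.mul
      (contDiff_dbarStarForm_term hφ le_rfl ((hV K).of_le (by norm_num)) j)
  · exact contDiff_const

/-- For `j < k`, removing `j` lowers by one the number of indices before `k`, whereas removing `k`
leaves the number before `j` unchanged. -/
theorem wedgeSign_mul_wedgeSign_erase (K : MultiIndex n (q + 1 + 1)) {j k : Fin n} (hj : j ∈ K.1)
    (hk : k ∈ K.1) (hjk : j < k) :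
    wedgeSign K j * wedgeSign (K.erase ⟨j, hj⟩) k
      = -(wedgeSign K k * wedgeSign (K.erase ⟨k, hk⟩) j) := by
  have h1 : ((K.1.erase j).filter fun i => i < k).card + 1 = (K.1.filter fun i => i < k).card := by
    rw [Finset.filter_erase]
    exact Finset.card_erase_add_one (by simp [hj, hjk])
  have h2 : (K.1.erase k).filter (fun i => i < j) = K.1.filter fun i => i < j := by
    rw [Finset.filter_erase]
    exact Finset.erase_eq_of_notMem (by simp [hjk.le])
  simp only [wedgeSign, MultiIndex.erase]
  rw [h2, ← h1, pow_succ]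
  ring

theorem dbarForm_dbarForm {F : MultiIndex n q → (Fin n → ℂ) → ℂ} (hF : ∀ J, ContDiff ℝ 2 (F J))
    (K : MultiIndex n (q + 1 + 1)) (z : Fin n → ℂ) : dbarForm (dbarForm F) K z = 0 := by
  have hd : ∀ (J : MultiIndex n q) (k : Fin n), DifferentiableAt ℝ (wirtingerBar k (F J)) z :=
    fun J k => (contDiff_wirtingerBar (m := 1) (hF J) (by norm_num) k).differentiable
      (by norm_num) z
  -- The double sum is extended by zero to all pairs, so that exchanging `j` and `k` is a plain
  -- exchange of sums. `T` is antisymmetric: the signs are, and the second derivatives commute.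
  set T : Fin n → Fin n → ℂ := fun j k =>
    if h : j ∈ K.1 ∧ k ∈ K.1 ∧ k ≠ j then
      wedgeSign K j * (wedgeSign (K.erase ⟨j, h.1⟩) k * wirtingerBar j (wirtingerBar k
        (F ((K.erase ⟨j, h.1⟩).erase ⟨k, Finset.mem_erase.2 ⟨h.2.2, h.2.1⟩⟩))) z)
    else 0 with hT
  have hsum : dbarForm (dbarForm F) K z = ∑ j, ∑ k, T j k := by
    have h1 : ∀ j : {j : Fin n // j ∈ K.1},
        wedgeSign K j * wirtingerBar j (dbarForm F (K.erase j)) z = ∑ k, T j k := by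
      intro j
      have h2 : wirtingerBar j (dbarForm F (K.erase j)) z
          = ∑ k : {k : Fin n // k ∈ (K.erase j).1}, wedgeSign (K.erase j) k *
            wirtingerBar j (wirtingerBar k (F ((K.erase j).erase k))) z := by
        have h5 := wirtingerBar_sum (k := j.1) (z := z) (s := Finset.univ)
          (F := fun (k : {k : Fin n // k ∈ (K.erase j).1}) w =>
            wedgeSign (K.erase j) k * wirtingerBar k (F ((K.erase j).erase k)) w)
          fun k _ => (hd _ _).const_mul _
        exact h5.trans (Finset.sum_congr rfl fun k _ => wirtingerBar_const_mul _ (hd _ _))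
      rw [h2, Finset.mul_sum]
      have h3 : ∀ k ∈ Finset.univ, k ∉ (K.erase j).1 → T j k = 0 := by
        intro k _ hk
        simp only [hT]
        rw [dif_neg]
        rintro ⟨-, hk1, hk2⟩
        exact hk (Finset.mem_erase.2 ⟨hk2, hk1⟩)
      rw [← Finset.sum_subset (Finset.subset_univ (K.erase j).1) h3,
        ← Finset.sum_coe_sort (K.erase j).1 fun k => T j k]
      refine Finset.sum_congr rfl fun k _ => ?_
      have hk := Finset.mem_erase.1 k.2
      simp only [hT]
      rw [dif_pos ⟨j.2, hk.2, hk.1⟩]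
    have h4 : ∀ j ∈ Finset.univ, j ∉ K.1 → ∑ k, T j k = 0 := by
      intro j _ hj
      refine Finset.sum_eq_zero fun k _ => ?_
      simp only [hT]
      rw [dif_neg fun h => hj h.1]
    rw [← Finset.sum_subset (Finset.subset_univ K.1) h4,
      ← Finset.sum_coe_sort K.1 fun j => ∑ k, T j k, dbarForm]
    exact Finset.sum_congr rfl fun j _ => h1 j
  have hcomm : ∀ (j k : Fin n) (hj : j ∈ K.1) (hk : k ∈ K.1) (hkj : k ≠ j),
      (K.erase ⟨j, hj⟩).erase ⟨k, Finset.mem_erase.2 ⟨hkj, hk⟩⟩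
        = (K.erase ⟨k, hk⟩).erase ⟨j, Finset.mem_erase.2 ⟨hkj.symm, hj⟩⟩ := fun j k hj hk hkj =>
    Subtype.ext Finset.erase_right_comm
  have hanti : ∀ j k, T j k = -T k j := by
    intro j k
    simp only [hT]
    by_cases h : j ∈ K.1 ∧ k ∈ K.1 ∧ k ≠ j
    · have h' : k ∈ K.1 ∧ j ∈ K.1 ∧ j ≠ k := ⟨h.2.1, h.1, h.2.2.symm⟩
      rw [dif_pos h, dif_pos h', hcomm j k h.1 h.2.1 h.2.2, wirtingerBar_comm (hF _), ← mul_assoc,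
        ← mul_assoc, ← neg_mul]
      congr 1
      rcases lt_or_gt_of_ne h.2.2 with hlt | hlt
      · rw [wedgeSign_mul_wedgeSign_erase K h.2.1 h.1 hlt, neg_neg]
      · rw [wedgeSign_mul_wedgeSign_erase K h.1 h.2.1 hlt]
    · have h' : ¬(k ∈ K.1 ∧ j ∈ K.1 ∧ j ≠ k) := fun h' => h ⟨h'.2.1, h'.1, h'.2.2.symm⟩
      rw [dif_neg h, dif_neg h', neg_zero]
  have hself : ∑ j, ∑ k, T j k = -∑ j, ∑ k, T j k := by
    conv_lhs => rw [Finset.sum_comm]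
    simp only [← Finset.sum_neg_distrib]
    exact Finset.sum_congr rfl fun j _ => Finset.sum_congr rfl fun k _ => hanti k j
  rw [hsum]
  exact self_eq_neg.1 hself

end DbarForm

/-! ### Graphs of the unbounded operators and the obstruction to compactness. -/

section Operators

variable {n q : ℕ} {φ : (Fin n → ℂ) → ℝ}

/-- In terms of graphs, the nested domain conditions of `compose` reduce to the existence of an
intermediate vector. -/
theorem mem_graph_compose {E F G : Type*} [AddCommGroup E] [Module ℂ E] [AddCommGroup F]
    [Module ℂ F] [AddCommGroup G] [Module ℂ G] {S : F →ₗ.[ℂ] G} {T : E →ₗ.[ℂ] F} {x : E} {z : G} :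
    (x, z) ∈ (compose S T).graph ↔ ∃ y, (x, y) ∈ T.graph ∧ (y, z) ∈ S.graph := by
  have hdom : ∀ x, x ∈ (compose S T).domain ↔ ∃ hx : x ∈ T.domain, T ⟨x, hx⟩ ∈ S.domain := by
    intro x
    constructor
    · intro h
      obtain ⟨h1, h2⟩ := Submodule.mem_inf.1 h
      obtain ⟨y, hy, rfl⟩ := Submodule.mem_map.1 h1
      exact ⟨h2, hy⟩
    · rintro ⟨hx, hTx⟩
      exact Submodule.mem_inf.2 ⟨Submodule.mem_map.2 ⟨⟨x, hx⟩, hTx, rfl⟩, hx⟩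
  have hval : ∀ (x : E) (h : x ∈ (compose S T).domain) (hx : x ∈ T.domain)
      (hTx : T ⟨x, hx⟩ ∈ S.domain), compose S T ⟨x, h⟩ = S ⟨T ⟨x, hx⟩, hTx⟩ := by
    intro x h hx hTx
    rfl
  constructor
  · intro h
    obtain ⟨⟨x', hx'⟩, rfl, hz⟩ := (LinearPMap.mem_graph_iff _).1 h
    obtain ⟨hx, hTx⟩ := (hdom x').1 hx'
    refine ⟨T ⟨x', hx⟩, T.mem_graph ⟨x', hx⟩, ?_⟩
    have hz' : compose S T ⟨x', hx'⟩ = z := hz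
    rw [← hz', hval x' hx' hx hTx]
    exact S.mem_graph ⟨_, hTx⟩
  · rintro ⟨y, hxy, hyz⟩
    obtain ⟨⟨x', hx'⟩, rfl, rfl⟩ := (LinearPMap.mem_graph_iff _).1 hxy
    obtain ⟨⟨y', hy'⟩, h1, rfl⟩ := (LinearPMap.mem_graph_iff _).1 hyz
    simp only at h1
    subst h1
    have hd := (hdom x').2 ⟨hx', hy'⟩
    exact (LinearPMap.mem_graph_iff _).2 ⟨⟨x', hd⟩, rfl, hval _ _ _ _⟩

theorem mem_graph_add {E F : Type*} [AddCommGroup E] [Module ℂ E] [AddCommGroup F]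
    [Module ℂ F] {S T : E →ₗ.[ℂ] F} {x : E} {z : F} :
    (x, z) ∈ (S + T).graph ↔ ∃ y w, (x, y) ∈ S.graph ∧ (x, w) ∈ T.graph ∧ y + w = z := by
  constructor
  · intro h
    obtain ⟨⟨x', hx'⟩, rfl, rfl⟩ := (LinearPMap.mem_graph_iff _).1 h
    obtain ⟨h1, h2⟩ := Submodule.mem_inf.1 hx'
    exact ⟨S ⟨x', h1⟩, T ⟨x', h2⟩, S.mem_graph ⟨x', h1⟩, T.mem_graph ⟨x', h2⟩,
      (LinearPMap.add_apply S T ⟨x', hx'⟩).symm⟩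
  · rintro ⟨y, w, h1, h2, rfl⟩
    obtain ⟨⟨x', hx'⟩, rfl, rfl⟩ := (LinearPMap.mem_graph_iff _).1 h1
    obtain ⟨⟨y', hy'⟩, h3, rfl⟩ := (LinearPMap.mem_graph_iff _).1 h2
    simp only at h3
    subst h3
    exact (LinearPMap.mem_graph_iff _).2 ⟨⟨y', Submodule.mem_inf.2 ⟨hx', hy'⟩⟩, rfl,
      LinearPMap.add_apply S T _⟩

theorem mem_dbar_graph (hφ : ContDiff ℝ 2 φ) {x : L2Forms φ q} {y : L2Forms φ (q + 1)} :
    (x, y) ∈ (dbar φ hφ q).graph ↔ (x, y) ∈ dbarGraph φ hφ q := by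
  rw [dbar_graph]

/-- The maximal `∂̄` is densely defined. -/
theorem dense_dbar_domain (hφ : ContDiff ℝ 2 φ) :
    Dense ((dbar φ hφ q).domain : Set (L2Forms φ q)) := by
  rw [Submodule.dense_iff_topologicalClosure_eq_top, Submodule.topologicalClosure_eq_top_iff,
    Submodule.eq_bot_iff]
  intro x hx
  have hJ : ∀ J, ∀ᵐ z ∂(volume : Measure (Fin n → ℂ)), x z J = 0 := by
    intro J
    have hwt := contDiff_weight hφ
    have hloc : LocallyIntegrable (fun z => x z J * ((Real.exp (-φ z) : ℝ) : ℂ))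
        (volume : Measure (Fin n → ℂ)) := by
      rw [locallyIntegrable_iff]
      intro k hk
      exact ((locallyIntegrable_coeff hφ x J).integrableOn_isCompact hk).mul_continuousOn
        hwt.continuous.continuousOn hk
    -- The domain contains every form `χ dz̄_J` with smooth compactly supported `χ`. Orthogonality
    -- to these says that the distribution `x_J e^{-φ}` vanishes.
    have h0 := ae_eq_zero_of_integral_contDiff_smul_eq_zero hloc (fun χ hχ hχc => by
      set F : MultiIndex n q → (Fin n → ℂ) → ℂ := fun J' z => if J' = J then (χ z : ℂ) else 0
        with hF
      have hFC : ∀ J', ContDiff ℝ ∞ (F J') := by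
        intro J'
        simp only [hF]
        split_ifs
        · exact Complex.ofRealCLM.contDiff.comp hχ
        · exact contDiff_const
      have hFc : ∀ J', tsupport (F J') ⊆ tsupport χ := by
        intro J'
        refine closure_mono fun z hz => ?_
        contrapose! hz
        simp only [Function.mem_support, not_not] at hz ⊢
        simp [hF, hz]
      have hFc' : ∀ J', HasCompactSupport (F J') := fun J' =>
        hχc.isCompact.of_isClosed_subset (isClosed_tsupport _) (hFc J')
      have hdc : ∀ K, HasCompactSupport (dbarForm F K) := fun K =>
        hχc.isCompact.of_isClosed_subset (isClosed_tsupport _)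
          (tsupport_dbarForm_subset (isClosed_tsupport _) hFc K)
      have hFm := memLp_coeffVec hφ (fun J' => (hFC J').continuous) hFc'
      have hdm := memLp_coeffVec hφ
        (fun K => (contDiff_dbarForm (m := 0) (m' := ∞) (by simp) hFC K).continuous) hdc
      have hmem := formLp_mem_dbarGraph hφ (fun J' => (hFC J').of_le (by simp)) hFm hdm
      have hin := LinearPMap.mem_domain_of_mem_graph ((mem_dbar_graph hφ).2 hmem)
      have horth := Submodule.inner_right_of_mem_orthogonal hin hx
      rw [inner_formLp hφ (fun J' => (hFC J').continuous) hFc',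
        Finset.sum_eq_single J (fun J' _ hJ' => by simp [hF, hJ']) (by simp)] at horth
      rw [← horth]
      refine integral_congr_ae (Eventually.of_forall fun z => ?_)
      simp [hF]
      ring)
    filter_upwards [h0] with z hz
    exact (mul_eq_zero.1 hz).resolve_right (by simp)
  refine (Lp.eq_zero_iff_ae_eq_zero).2 ((withDensity_absolutelyContinuous _ _).ae_le ?_)
  filter_upwards [ae_all_iff.2 hJ] with z hz
  ext J
  simpa using hz J

/-- Density of the domain of `∂̄` makes the vector `w` unique, so the duality relation alone
describes the adjoint. -/
theorem mem_dbarStar_graph (hφ : ContDiff ℝ 2 φ) {y : L2Forms φ (q + 1)} {w : L2Forms φ q} :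
    (y, w) ∈ (dbarStar φ hφ q).graph ↔
      ∀ x v, (x, v) ∈ dbarGraph φ hφ q → inner ℂ w x = inner ℂ y v := by
  constructor
  · intro h x v hxv
    obtain ⟨y', rfl, rfl⟩ := (LinearPMap.mem_graph_iff _).1 h
    obtain ⟨x', rfl, rfl⟩ := (LinearPMap.mem_graph_iff _).1 ((mem_dbar_graph hφ).2 hxv)
    exact LinearPMap.adjoint_isFormalAdjoint (dense_dbar_domain hφ) y' x'
  · intro h
    have h1 : ∀ x : (dbar φ hφ q).domain, inner ℂ w (x : L2Forms φ q)
        = inner ℂ y (dbar φ hφ q x) := fun x =>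
      h _ _ ((mem_dbar_graph hφ).1 ((dbar φ hφ q).mem_graph x))
    have hy : y ∈ (dbarStar φ hφ q).domain :=
      LinearPMap.mem_adjoint_domain_of_exists y ⟨w, h1⟩
    exact (LinearPMap.mem_graph_iff _).2 ⟨⟨y, hy⟩, rfl,
      LinearPMap.adjoint_apply_eq (dense_dbar_domain hφ) ⟨y, hy⟩ h1⟩

theorem mem_complexLaplacian_graph (hφ : ContDiff ℝ 2 φ) {x z : L2Forms φ (q + 1)} :
    (x, z) ∈ (complexLaplacian φ hφ (q + 1)).graph ↔ ∃ v w a b,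
      (x, v) ∈ (dbarStar φ hφ q).graph ∧ (v, a) ∈ dbarGraph φ hφ q ∧
      (x, w) ∈ dbarGraph φ hφ (q + 1) ∧ (w, b) ∈ (dbarStar φ hφ (q + 1)).graph ∧ a + b = z := by
  rw [complexLaplacian, mem_graph_add]
  simp only [mem_graph_compose, mem_dbar_graph]
  constructor
  · rintro ⟨a, b, ⟨v, h1, h2⟩, ⟨w, h3, h4⟩, h⟩
    exact ⟨v, w, a, b, h1, h2, h3, h4, h⟩
  · rintro ⟨v, w, a, b, h1, h2, h3, h4, h⟩
    exact ⟨a, b, ⟨v, h1, h2⟩, ⟨w, h3, h4⟩, h⟩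

/-- The range of `∂̄` is orthogonal to the kernel of the complex Laplacian. -/
theorem mem_kernel_orthogonal (hφ : ContDiff ℝ 2 φ) {x : L2Forms φ q} {y : L2Forms φ (q + 1)}
    (hxy : (x, y) ∈ dbarGraph φ hφ q) : y ∈ (kernel (complexLaplacian φ hφ (q + 1)))ᗮ := by
  rw [Submodule.mem_orthogonal]
  rintro _ ⟨u, hu, rfl⟩
  have hu0 : complexLaplacian φ hφ (q + 1) u = 0 := hu
  have hug := (complexLaplacian φ hφ (q + 1)).mem_graph u
  rw [hu0] at hug
  obtain ⟨v, w, a, b, h1, h2, h3, h4, h⟩ := (mem_complexLaplacian_graph hφ).1 hug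
  have e1 := (mem_dbarStar_graph hφ).1 h1 v a h2
  have e2 := (mem_dbarStar_graph hφ).1 h4 _ _ h3
  have e3 : inner ℂ (u : L2Forms φ (q + 1)) b = inner ℂ w w := by
    rw [← inner_conj_symm, e2, inner_conj_symm]
  -- For `u` in the kernel, `0 = (□u, u) = ‖∂̄*u‖² + ‖∂̄u‖²`. Hence `v = ∂̄*u = 0`, and pairing `u`
  -- with `y = ∂̄x` gives zero.
  have e4 : inner ℂ v v + inner ℂ w w = 0 := by
    rw [e1, ← e3, ← inner_add_right, h, inner_zero_right]
  have e5 : ‖v‖ = 0 := by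
    have e6 := congrArg RCLike.re e4
    rw [map_add, inner_self_eq_norm_sq, inner_self_eq_norm_sq, map_zero] at e6
    nlinarith [sq_nonneg ‖v‖, sq_nonneg ‖w‖]
  have e7 := (mem_dbarStar_graph hφ).1 h1 x y hxy
  rw [norm_eq_zero.1 e5, inner_zero_left] at e7
  exact e7.symm

theorem not_isCompact_of_separated {X : Type*} [MetricSpace X] {S : Set X} (hS : IsCompact S)
    {u : ℕ → X} (hu : ∀ k, u k ∈ S) {c : ℝ} (hc : 0 < c)
    (hsep : ∀ k l, k ≠ l → c ≤ dist (u k) (u l)) : False := by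
  obtain ⟨x, -, σ, hσ, hlim⟩ := hS.tendsto_subseq hu
  obtain ⟨N, hN⟩ := Metric.cauchySeq_iff.1 hlim.cauchySeq c hc
  have h1 := hN N le_rfl (N + 1) (Nat.le_succ N)
  have h2 := hsep (σ N) (σ (N + 1)) (hσ (Nat.lt_succ_self N)).ne
  exact absurd h1 (not_lt.2 h2)

/-- A separated sequence in `dom □ ∩ (ker □)ᗮ` with bounded image under `□` prevents compactness
of the `∂̄`-Neumann operator. -/
theorem not_compactDbarNeumann (hφ : ContDiff ℝ 2 φ) {u w : ℕ → L2Forms φ q}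
    (hu : ∀ k, u k ∈ (kernel (complexLaplacian φ hφ q))ᗮ)
    (huw : ∀ k, (u k, w k) ∈ (complexLaplacian φ hφ q).graph) {B c : ℝ} (hw : ∀ k, ‖w k‖ ≤ B)
    (hc : 0 < c) (hsep : ∀ k l, k ≠ l → c ≤ ‖u k - u l‖) : ¬ CompactDbarNeumann φ hφ q := by
  rintro ⟨S, hS, hmem⟩
  have hker := restrictedLaplacian_ker φ hφ q
  have hgr : ∀ k, (u k, w k) ∈ (restrictedLaplacian φ hφ q).graph := by
    intro k
    obtain ⟨⟨x, hx⟩, h1, h2⟩ := (LinearPMap.mem_graph_iff _).1 (huw k)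
    simp only at h1
    subst h1
    exact (LinearPMap.mem_graph_iff _).2 ⟨⟨u k, Submodule.mem_inf.2 ⟨hu k, hx⟩⟩, rfl,
      (LinearPMap.domRestrict_apply rfl).trans h2⟩
  have hN : ∀ k, (w k, u k) ∈ (dbarNeumann φ hφ q).graph := by
    intro k
    obtain ⟨x, h1, h2⟩ := (LinearPMap.mem_graph_iff _).1 (hgr k)
    have h3 := LinearPMap.mem_inverse_graph hker x
    rw [h1, h2] at h3
    exact h3
  obtain ⟨δ, hδ, hball⟩ := Metric.mem_nhds_iff.1 hmem
  have hB : 0 ≤ B := (norm_nonneg _).trans (hw 0)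
  -- Scaling by `r` brings every `w k` into the ball that the operator maps into the compact set;
  -- the separation is only multiplied by `r`.
  set r : ℝ := δ / (B + 1) with hr
  have hr0 : 0 < r := by positivity
  refine not_isCompact_of_separated hS (u := fun k => (r : ℂ) • u k) (c := r * c) (fun k => ?_)
    (by positivity) (fun k l hkl => ?_)
  · obtain ⟨x, h1, h2⟩ := (LinearPMap.mem_graph_iff _).1 ((dbarNeumann φ hφ q).graph.smul_mem (r : ℂ) (hN k))
    have h3 : x ∈ Metric.ball (0 : (dbarNeumann φ hφ q).domain) δ := by
      rw [mem_ball_zero_iff, Submodule.coe_norm, h1]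
      change ‖(r : ℂ) • w k‖ < δ
      rw [norm_smul, Complex.norm_real, Real.norm_of_nonneg hr0.le, hr, div_mul_eq_mul_div,
        div_lt_iff₀ (by positivity)]
      nlinarith [hw k]
    have h4 := hball h3
    change (dbarNeumann φ hφ q) x ∈ S at h4
    rw [h2] at h4
    exact h4
  · rw [dist_eq_norm, ← smul_sub, norm_smul, Complex.norm_real, Real.norm_of_nonneg hr0.le]
    exact mul_le_mul_of_nonneg_left (hsep k l hkl) hr0.le

end Operators

/-! ### The model form and its conjugation by a gauge. -/

section TestForms

variable {n q : ℕ} {φ : (Fin n → ℂ) → ℝ}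

theorem two_le_infty : (2 : WithTop ℕ∞) ≤ (∞ : WithTop ℕ∞) :=
  WithTop.coe_le_coe.2 le_top

theorem norm_wedgeSign (K : MultiIndex n (q + 1)) (j : Fin n) : ‖wedgeSign K j‖ = 1 := by
  simp [wedgeSign]

theorem norm_sq_formLp (hφ : ContDiff ℝ 2 φ) {F : MultiIndex n q → (Fin n → ℂ) → ℂ}
    (hF : ∀ J, Continuous (F J)) (hFc : ∀ J, HasCompactSupport (F J))
    (hFm : MemLp (coeffVec F) 2 (weightedMeasure φ)) :
    ‖formLp hFm‖ ^ 2 = ∑ J, ∫ z, ‖F J z‖ ^ 2 * Real.exp (-φ z) := by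
  have h1 := inner_formLp hφ hF hFc hFm (formLp hFm)
  have h2 : ∀ J, ∫ z, formLp hFm z J * (conj (F J z) * ((Real.exp (-φ z) : ℝ) : ℂ))
      = ((∫ z, ‖F J z‖ ^ 2 * Real.exp (-φ z) : ℝ) : ℂ) := by
    intro J
    rw [← integral_complex_ofReal]
    refine integral_congr_ae ?_
    filter_upwards [formLp_coeff_ae hφ hFm J] with z hz
    rw [hz, ← mul_assoc, Complex.mul_conj, Complex.normSq_eq_norm_sq]
    push_cast
    rfl
  simp only [h2, ← Complex.ofReal_sum] at h1
  have h3 := congrArg RCLike.re h1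
  rw [inner_self_eq_norm_sq] at h3
  simpa using h3

theorem inner_formLp_eq_zero (hφ : ContDiff ℝ 2 φ) {F G : MultiIndex n q → (Fin n → ℂ) → ℂ}
    (hF : ∀ J, Continuous (F J)) (hFc : ∀ J, HasCompactSupport (F J))
    (hFm : MemLp (coeffVec F) 2 (weightedMeasure φ))
    (hGm : MemLp (coeffVec G) 2 (weightedMeasure φ)) (h : ∀ J z, F J z = 0 ∨ G J z = 0) :
    inner ℂ (formLp hFm) (formLp hGm) = 0 := by
  rw [inner_formLp hφ hF hFc]
  refine Finset.sum_eq_zero fun J _ => integral_eq_zero_of_ae ?_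
  filter_upwards [formLp_coeff_ae hφ hGm J] with z hz
  rw [hz]
  rcases h J z with h | h <;> simp [h]

/-- The form `χ dz̄_L`. -/
def monomialForm (L : MultiIndex n q) (χ : (Fin n → ℂ) → ℂ) (J : MultiIndex n q)
    (z : Fin n → ℂ) : ℂ :=
  if J = L then χ z else 0

theorem contDiff_monomialForm (L : MultiIndex n q) {χ : (Fin n → ℂ) → ℂ} {m : WithTop ℕ∞}
    (hχ : ContDiff ℝ m χ) (J : MultiIndex n q) : ContDiff ℝ m (monomialForm L χ J) := by
  unfold monomialForm
  split_ifs
  · exact hχ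
  · exact contDiff_const

theorem tsupport_monomialForm_subset (L : MultiIndex n q) (χ : (Fin n → ℂ) → ℂ)
    (J : MultiIndex n q) : tsupport (monomialForm L χ J) ⊆ tsupport χ := by
  refine closure_mono fun z hz => ?_
  contrapose! hz
  simp only [Function.mem_support, not_not] at hz ⊢
  simp [monomialForm, hz]

/-- A smooth monomial form supported near the origin whose `∂̄` does not vanish at the origin. -/
theorem exists_monomialForm (hq : q < n) : ∃ (L : MultiIndex n q) (χ : (Fin n → ℂ) → ℂ)
    (K : MultiIndex n (q + 1)), ContDiff ℝ ∞ χ ∧ tsupport χ ⊆ closedBall 0 (1 / 4) ∧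
      dbarForm (monomialForm L χ) K 0 ≠ 0 := by
  obtain ⟨L, -, hL⟩ := Finset.exists_subset_card_eq (s := (Finset.univ : Finset (Fin n))) (n := q)
    (by simpa using hq.le)
  obtain ⟨j, hj⟩ : ∃ j, j ∉ L := by
    by_contra! h
    have : L = Finset.univ := Finset.eq_univ_iff_forall.2 h
    rw [this, Finset.card_univ, Fintype.card_fin] at hL
    omega
  let η : ContDiffBump (0 : Fin n → ℂ) := ⟨1 / 8, 1 / 4, by norm_num, by norm_num⟩
  -- Near the origin `χ = z̄_j` with `j ∉ L`, so the coefficient of `∂̄(χ dz̄_L)` at `L ∪ {j}` is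
  -- `±1` there: erasing any other index from `L ∪ {j}` does not give `L`.
  set χ : (Fin n → ℂ) → ℂ := fun z => conj (z j) * ((η z : ℝ) : ℂ) with hχ
  refine ⟨⟨L, hL⟩, χ, ⟨insert j L, by rw [Finset.card_insert_of_notMem hj, hL]⟩, ?_, ?_, ?_⟩
  · exact (contDiff_conj (contDiff_apply ℝ ℂ j)).mul (Complex.ofRealCLM.contDiff.comp η.contDiff)
  · refine closure_minimal (fun z hz => ?_) isClosed_closedBall
    by_contra h
    rw [mem_closedBall] at h
    have : η z = 0 := η.zero_of_le_dist (not_le.1 h).le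
    exact hz (by simp [hχ, this])
  · have h1 : χ =ᶠ[nhds 0] fun z => conj (z j) := by
      filter_upwards [closedBall_mem_nhds (0 : Fin n → ℂ) (show (0 : ℝ) < 1 / 8 by norm_num)]
        with z hz
      have : η z = 1 := η.one_of_mem_closedBall hz
      simp [hχ, this]
    have h2 : wirtingerBar j χ 0 = 1 := by
      rw [wirtingerBar_congr h1, wirtingerBar_conj]
      have h3 : fderiv ℝ (fun z : Fin n → ℂ => z j) 0 = ContinuousLinearMap.proj j :=
        (ContinuousLinearMap.proj (R := ℝ) (φ := fun _ : Fin n => ℂ) j).fderiv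
      rw [wirtinger, h3]
      have h4 : conj (2 : ℂ) = 2 := map_ofNat _ 2
      simp [h4]
      norm_num
    rw [dbarForm, Finset.sum_eq_single ⟨j, Finset.mem_insert_self j L⟩]
    · have h4 : MultiIndex.erase (⟨insert j L, by rw [Finset.card_insert_of_notMem hj, hL]⟩ :
          MultiIndex n (q + 1)) ⟨j, Finset.mem_insert_self j L⟩ = ⟨L, hL⟩ :=
        Subtype.ext (Finset.erase_insert hj)
      have h5 : monomialForm (⟨L, hL⟩ : MultiIndex n q) χ ⟨L, hL⟩ = χ := by
        funext z; simp [monomialForm]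
      rw [h4, h5, h2, mul_one, ← norm_ne_zero_iff, norm_wedgeSign]
      norm_num
    · rintro ⟨k, hk⟩ - hkj
      have hkj' : k ≠ j := fun h => hkj (Subtype.ext h)
      have h4 : MultiIndex.erase (⟨insert j L, by rw [Finset.card_insert_of_notMem hj, hL]⟩ :
          MultiIndex n (q + 1)) ⟨k, hk⟩ ≠ ⟨L, hL⟩ := by
        intro h
        have h5 : (insert j L).erase k = L := congrArg Subtype.val h
        exact hj (h5 ▸ Finset.mem_erase.2 ⟨hkj'.symm, Finset.mem_insert_self j L⟩)
      have h5 : monomialForm (⟨L, hL⟩ : MultiIndex n q) χ (MultiIndex.erase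
          (⟨insert j L, by rw [Finset.card_insert_of_notMem hj, hL]⟩ : MultiIndex n (q + 1))
          ⟨k, hk⟩) = fun _ => 0 := by
        funext z
        rw [monomialForm, if_neg h4]
      rw [h5]
      simp [wirtingerBar]
    · simp

/-- The data of a holomorphic gauge for `φ` on the polydisc of radius `1/2` about `a`. -/
structure IsGauge (φ : (Fin n → ℂ) → ℝ) (C : ℝ) (a : Fin n → ℂ) (h : (Fin n → ℂ) → ℂ) : Prop where
  contDiff : ContDiff ℝ ∞ h
  wirtingerBar_eq : ∀ z ∈ ball a (1 / 2), ∀ j, wirtingerBar j h z = 0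
  abs_sub_le : ∀ z ∈ ball a (1 / 2), |φ z - 2 * (h z).re| ≤ C
  norm_wirtinger_sub_le : ∀ z ∈ ball a (1 / 2), ∀ j,
    ‖wirtinger j (fun w => (φ w : ℂ)) z - wirtinger j h z‖ ≤ C

/-- The translate to `a` of a function, multiplied by the exponential of a gauge. -/
noncomputable def gauged (h : (Fin n → ℂ) → ℂ) (a : Fin n → ℂ) (β : (Fin n → ℂ) → ℂ)
    (z : Fin n → ℂ) : ℂ :=
  Complex.exp (h z) * β (z - a)

theorem tsupport_gauged_subset (h : (Fin n → ℂ) → ℂ) (a : Fin n → ℂ) {β : (Fin n → ℂ) → ℂ} {r : ℝ}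
    (hβ : tsupport β ⊆ closedBall 0 r) : tsupport (gauged h a β) ⊆ closedBall a r := by
  refine closure_minimal (fun z hz => ?_) isClosed_closedBall
  have h1 : β (z - a) ≠ 0 := fun h0 => hz (by simp [gauged, h0])
  have h2 := hβ (subset_tsupport _ h1)
  rwa [mem_closedBall_zero_iff, ← dist_eq_norm] at h2

namespace IsGauge

variable {C : ℝ} {a : Fin n → ℂ} {h : (Fin n → ℂ) → ℂ}

theorem contDiff_gauged (hh : IsGauge φ C a h) {m : WithTop ℕ∞} (hm : m ≤ (∞ : WithTop ℕ∞))
    {β : (Fin n → ℂ) → ℂ} (hβ : ContDiff ℝ m β) : ContDiff ℝ m (gauged h a β) :=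
  (hh.contDiff.cexp.of_le hm).mul (hβ.comp (contDiff_id.sub contDiff_const))

theorem fderiv_cexp (hh : IsGauge φ C a h) (z : Fin n → ℂ) :
    fderiv ℝ (fun w => Complex.exp (h w)) z = Complex.exp (h z) • fderiv ℝ h z :=
  ((hh.contDiff.differentiable (by simp) z).hasFDerivAt.cexp).fderiv

/-- On the gauge polydisc `e^h` is holomorphic and passes through `∂̄`; this keeps the gauged forms
`∂̄`-exact. -/
theorem wirtingerBar_gauged (hh : IsGauge φ C a h) {β : (Fin n → ℂ) → ℂ} (hβ : ContDiff ℝ 1 β)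
    {z : Fin n → ℂ} (hz : z ∈ ball a (1 / 2)) (j : Fin n) :
    wirtingerBar j (gauged h a β) z = gauged h a (wirtingerBar j β) z := by
  have h1 : DifferentiableAt ℝ (fun w => Complex.exp (h w)) z :=
    hh.contDiff.cexp.differentiable (by simp) z
  have h2 : DifferentiableAt ℝ (fun w => β (w - a)) z :=
    (hβ.comp (contDiff_id.sub contDiff_const)).differentiable (by norm_num) z
  have h3 : wirtingerBar j (fun w => Complex.exp (h w)) z = 0 := by
    have h4 : wirtingerBar j (fun w => Complex.exp (h w)) z
        = Complex.exp (h z) * wirtingerBar j h z := by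
      rw [wirtingerBar, wirtingerBar, hh.fderiv_cexp]
      simp only [_root_.smul_apply, smul_eq_mul]
      ring
    rw [h4, hh.wirtingerBar_eq z hz, mul_zero]
  unfold gauged
  rw [wirtingerBar_mul h1 h2, h3, wirtingerBar_comp_sub_const, zero_mul, zero_add]

theorem wirtinger_gauged (hh : IsGauge φ C a h) {β : (Fin n → ℂ) → ℂ} (hβ : ContDiff ℝ 1 β)
    (z : Fin n → ℂ) (j : Fin n) :
    wirtinger j (gauged h a β) z
      = wirtinger j h z * gauged h a β z + gauged h a (wirtinger j β) z := by
  have h1 : DifferentiableAt ℝ (fun w => Complex.exp (h w)) z :=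
    hh.contDiff.cexp.differentiable (by simp) z
  have h2 : DifferentiableAt ℝ (fun w => β (w - a)) z :=
    (hβ.comp (contDiff_id.sub contDiff_const)).differentiable (by norm_num) z
  have h4 : wirtinger j (fun w => Complex.exp (h w)) z
      = Complex.exp (h z) * wirtinger j h z := by
    rw [wirtinger, wirtinger, hh.fderiv_cexp]
    simp only [_root_.smul_apply, smul_eq_mul]
    ring
  unfold gauged
  rw [wirtinger_mul h1 h2, h4, wirtinger_comp_sub_const]
  ring

/-- The left side is `exp (2 Re h - φ)`. With the companion lower bound, gauging makes weighted
norms comparable to unweighted ones, uniformly in `a`. -/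
theorem norm_exp_sq_le (hh : IsGauge φ C a h) {z : Fin n → ℂ} (hz : z ∈ ball a (1 / 2)) :
    ‖Complex.exp (h z)‖ ^ 2 * Real.exp (-φ z) ≤ Real.exp C := by
  rw [Complex.norm_exp, ← Real.exp_nat_mul, ← Real.exp_add, Real.exp_le_exp]
  have := (abs_le.1 (hh.abs_sub_le z hz)).1
  push_cast
  linarith

theorem le_norm_exp_sq (hh : IsGauge φ C a h) {z : Fin n → ℂ} (hz : z ∈ ball a (1 / 2)) :
    Real.exp (-C) ≤ ‖Complex.exp (h z)‖ ^ 2 * Real.exp (-φ z) := by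
  rw [Complex.norm_exp, ← Real.exp_nat_mul, ← Real.exp_add, Real.exp_le_exp]
  have := (abs_le.1 (hh.abs_sub_le z hz)).2
  push_cast
  linarith

/-- Conjugation by the gauge: the second order terms of `∂̄ ∂̄*` have bounded coefficients. -/
theorem norm_wirtingerBar_adjoint_term_le (hφ : ContDiff ℝ 2 φ) {C' : ℝ}
    (hC : ∀ z j k, ‖wirtingerBar k (wirtinger j fun w => (φ w : ℂ)) z‖ ≤ C')
    (hh : IsGauge φ C a h) {β : (Fin n → ℂ) → ℂ} (hβ : ContDiff ℝ ∞ β) {M : ℝ}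
    (hM0 : ∀ z, ‖β z‖ ≤ M) (hM1 : ∀ z l, ‖wirtingerBar l β z‖ ≤ M)
    (hM2 : ∀ z j l, ‖wirtinger j (wirtingerBar l β) z‖ ≤ M) {z : Fin n → ℂ}
    (hz : z ∈ ball a (1 / 2)) (j l : Fin n) :
    ‖wirtingerBar l (fun w => wirtinger j (gauged h a β) w
      - wirtinger j (fun w => (φ w : ℂ)) w * gauged h a β w) z‖
      ≤ ‖Complex.exp (h z)‖ * (M * (1 + C + C')) := by
  have hφc : ContDiff ℝ 2 fun w => (φ w : ℂ) := Complex.ofRealCLM.contDiff.comp hφ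
  have hg : ContDiff ℝ ∞ (gauged h a β) := hh.contDiff_gauged le_rfl hβ
  have hg2 : ContDiff ℝ 2 (gauged h a β) := hg.of_le two_le_infty
  have d1 : DifferentiableAt ℝ (wirtinger j (gauged h a β)) z :=
    (contDiff_wirtinger (m := 1) hg2 (by norm_num) j).differentiable (by norm_num) z
  have d2 : DifferentiableAt ℝ (wirtinger j fun w => (φ w : ℂ)) z :=
    (contDiff_wirtinger (m := 1) hφc (by norm_num) j).differentiable (by norm_num) z
  have d3 : DifferentiableAt ℝ (gauged h a β) z := hg2.differentiable (by norm_num) z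
  have hβ1 : ContDiff ℝ 1 β := hβ.of_le (by exact_mod_cast le_top)
  have hβl : ContDiff ℝ 1 (wirtingerBar l β) :=
    contDiff_wirtingerBar (m' := 2) (hβ.of_le two_le_infty) (by norm_num) l
  have hev : wirtingerBar l (gauged h a β) =ᶠ[nhds z] gauged h a (wirtingerBar l β) := by
    filter_upwards [isOpen_ball.mem_nhds hz] with w hw
    exact hh.wirtingerBar_gauged hβ1 hw l
  -- Commuting `∂̄_l` past `∂_j` lets it act on `e^h β` first, where it falls on `β` alone. The
  -- gradients of `φ` and `h`, each possibly large, then occur only in the difference `∂_j φ - ∂_j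
  -- h`.
  have heq : wirtingerBar l (fun w => wirtinger j (gauged h a β) w
      - wirtinger j (fun w => (φ w : ℂ)) w * gauged h a β w) z
      = Complex.exp (h z) * (wirtinger j (wirtingerBar l β) (z - a)
        - (wirtinger j (fun w => (φ w : ℂ)) z - wirtinger j h z) * wirtingerBar l β (z - a)
        - wirtingerBar l (wirtinger j fun w => (φ w : ℂ)) z * β (z - a)) := by
    rw [wirtingerBar_sub d1 (d2.fun_mul d3), wirtingerBar_mul d2 d3, wirtingerBar_wirtinger hg2,
      wirtinger_congr hev, hev.self_of_nhds, hh.wirtinger_gauged hβl]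
    simp only [gauged]
    ring
  rw [heq, norm_mul]
  refine mul_le_mul_of_nonneg_left ?_ (norm_nonneg _)
  have hM : 0 ≤ M := (norm_nonneg _).trans (hM0 0)
  have t1 := hM2 (z - a) j l
  have t2 : ‖(wirtinger j (fun w => (φ w : ℂ)) z - wirtinger j h z) * wirtingerBar l β (z - a)‖
      ≤ C * M := by
    rw [norm_mul]
    have := hh.norm_wirtinger_sub_le z hz j
    exact mul_le_mul this (hM1 _ _) (norm_nonneg _) ((norm_nonneg _).trans this)
  have t3 : ‖wirtingerBar l (wirtinger j fun w => (φ w : ℂ)) z * β (z - a)‖ ≤ C' * M := by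
    rw [norm_mul]
    have := hC z j l
    exact mul_le_mul this (hM0 _) (norm_nonneg _) ((norm_nonneg _).trans this)
  refine (norm_sub_le _ _).trans ((add_le_add (norm_sub_le _ _) le_rfl).trans ?_)
  linarith

end IsGauge

end TestForms

/-! ### Uniform test forms and the failure of compactness. -/

section TestSequence

variable {n q : ℕ} {φ : (Fin n → ℂ) → ℝ}

theorem exists_forall_norm_le {ι X : Type*} [Finite ι] [TopologicalSpace X] {f : ι → X → ℂ}
    (hf : ∀ i, Continuous (f i)) (hfc : ∀ i, HasCompactSupport (f i)) :
    ∃ M : ℝ, ∀ i z, ‖f i z‖ ≤ M := by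
  choose M hM using fun i => (hf i).bounded_above_of_compact_support (hfc i)
  obtain ⟨B, hB⟩ := Set.finite_range M |>.bddAbove
  exact ⟨B, fun i z => (hM i z).trans (hB ⟨i, rfl⟩)⟩

theorem hasCompactSupport_of_tsupport_subset_closedBall {f : (Fin n → ℂ) → ℂ} {a : Fin n → ℂ}
    {r : ℝ} (h : tsupport f ⊆ closedBall a r) : HasCompactSupport f :=
  (isCompact_closedBall a r).of_isClosed_subset (isClosed_tsupport f) h

theorem norm_wedge_sum_le (K : MultiIndex n (q + 1)) {f : {j : Fin n // j ∈ K.1} → ℂ} {A : ℝ}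
    (h : ∀ j, ‖f j‖ ≤ A) : ‖∑ j, f j‖ ≤ (q + 1) * A := by
  refine (norm_sum_le_of_le _ fun j _ => h j).trans (le_of_eq ?_)
  rw [Finset.sum_const, Finset.card_univ, Fintype.card_coe, K.2, nsmul_eq_mul]
  push_cast
  rfl

namespace IsGauge

variable {C : ℝ} {a : Fin n → ℂ} {h : (Fin n → ℂ) → ℂ}

/-- The identity is global although the gauge is holomorphic only locally: off the polydisc of
radius `1/2` both sides vanish because of the supports. -/
theorem dbarForm_gauged (hh : IsGauge φ C a h) {β : MultiIndex n q → (Fin n → ℂ) → ℂ}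
    (hβ : ∀ J, ContDiff ℝ 1 (β J)) (hs : ∀ J, tsupport (β J) ⊆ closedBall 0 (1 / 4)) :
    dbarForm (fun J => gauged h a (β J)) = fun K => gauged h a (dbarForm β K) := by
  funext K z
  by_cases hz : z ∈ ball a (1 / 2)
  · simp only [dbarForm, gauged, Finset.mul_sum]
    refine Finset.sum_congr rfl fun j _ => ?_
    have := hh.wirtingerBar_gauged (hβ (K.erase j)) hz j
    simp only [gauged] at this
    rw [this]
    ring
  · have h1 : ∀ {β : (Fin n → ℂ) → ℂ}, tsupport β ⊆ closedBall 0 (1 / 4) →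
        z ∉ tsupport (gauged h a β) := fun hβ h2 => hz
      (closedBall_subset_ball (by norm_num) (tsupport_gauged_subset h a hβ h2))
    rw [dbarForm_eq_zero fun J => h1 (hs J), image_eq_zero_of_notMem_tsupport
      (h1 (tsupport_dbarForm_subset isClosed_closedBall hs K))]

/-- A crude count of terms: `q + 1` from `∂̄`, and at most `q + 1` for each multiindex from the
formal adjoint. -/
theorem norm_dbarForm_dbarStarForm_le (hφ : ContDiff ℝ 2 φ) {C' : ℝ}
    (hC : ∀ z j k, ‖wirtingerBar k (wirtinger j fun w => (φ w : ℂ)) z‖ ≤ C')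
    (hh : IsGauge φ C a h) {β : MultiIndex n (q + 1) → (Fin n → ℂ) → ℂ}
    (hβ : ∀ K, ContDiff ℝ ∞ (β K)) {M : ℝ}
    (hM0 : ∀ K z, ‖β K z‖ ≤ M) (hM1 : ∀ K z l, ‖wirtingerBar l (β K) z‖ ≤ M)
    (hM2 : ∀ K z j l, ‖wirtinger j (wirtingerBar l (β K)) z‖ ≤ M) {z : Fin n → ℂ}
    (hz : z ∈ ball a (1 / 2)) (K : MultiIndex n (q + 1)) :
    ‖dbarForm (dbarStarForm φ fun K => gauged h a (β K)) K z‖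
      ≤ (q + 1) * (Fintype.card (MultiIndex n (q + 1)) * ((q + 1) *
        (‖Complex.exp (h z)‖ * (M * (1 + C + C'))))) := by
  have hd : ∀ (K : MultiIndex n (q + 1)) (j : Fin n), DifferentiableAt ℝ
      (fun w => wirtinger j (gauged h a (β K)) w
        - wirtinger j (fun w => (φ w : ℂ)) w * gauged h a (β K) w) z := fun K j =>
    (contDiff_dbarStarForm_term hφ le_rfl ((hh.contDiff_gauged le_rfl (hβ K)).of_le
      (by rw [one_add_one_eq_two]; exact two_le_infty)) j).differentiable (by norm_num) z
  have hb : ∀ (J : MultiIndex n q) (l : Fin n),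
      ‖wirtingerBar l (dbarStarForm φ (fun K => gauged h a (β K)) J) z‖
        ≤ Fintype.card (MultiIndex n (q + 1)) * ((q + 1) *
          (‖Complex.exp (h z)‖ * (M * (1 + C + C')))) := by
    intro J l
    have ht : ∀ (K : MultiIndex n (q + 1)) (j : {j : Fin n // j ∈ K.1}), DifferentiableAt ℝ
        (fun w => if K.erase j = J then wedgeSign K j * (wirtinger j (gauged h a (β K)) w
          - wirtinger j (fun w => (φ w : ℂ)) w * gauged h a (β K) w) else 0) z := by
      intro K j
      split_ifs
      · exact (hd K j).const_mul _
      · exact differentiableAt_const _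
    have heq : dbarStarForm φ (fun K => gauged h a (β K)) J = fun w => (-1) *
        ∑ K : MultiIndex n (q + 1), ∑ j : {j : Fin n // j ∈ K.1}, if K.erase j = J then
          wedgeSign K j * (wirtinger j (gauged h a (β K)) w
            - wirtinger j (fun w => (φ w : ℂ)) w * gauged h a (β K) w) else 0 := by
      funext w
      rw [dbarStarForm, neg_one_mul]
    rw [heq, wirtingerBar_const_mul _ (DifferentiableAt.fun_sum fun K _ =>
      DifferentiableAt.fun_sum fun j _ => ht K j), wirtingerBar_sum fun K _ =>
      DifferentiableAt.fun_sum fun j _ => ht K j, norm_mul, norm_neg, norm_one, one_mul]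
    refine (norm_sum_le_of_le (f := fun K => _) Finset.univ (n := fun _ => (q + 1) *
      (‖Complex.exp (h z)‖ * (M * (1 + C + C')))) fun K _ => ?_).trans (le_of_eq ?_)
    · rw [wirtingerBar_sum fun j _ => ht K j]
      refine norm_wedge_sum_le K fun j => ?_
      have h1 := norm_wirtingerBar_adjoint_term_le hφ hC hh (hβ K) (hM0 K) (hM1 K) (hM2 K) hz j l
      split_ifs
      · rwa [wirtingerBar_const_mul _ (hd K j), norm_mul, norm_wedgeSign, one_mul]
      · have : wirtingerBar l (fun _ : Fin n → ℂ => (0 : ℂ)) z = 0 := by simp [wirtingerBar]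
        rw [this, norm_zero]
        exact (norm_nonneg _).trans h1
    · rw [Finset.sum_const, Finset.card_univ, nsmul_eq_mul]
  refine norm_wedge_sum_le K fun j => ?_
  rw [norm_mul, norm_wedgeSign, one_mul]
  exact hb _ _

end IsGauge

theorem norm_sq_formLp_le (hφ : ContDiff ℝ 2 φ) {F : MultiIndex n q → (Fin n → ℂ) → ℂ}
    (hF : ∀ J, Continuous (F J)) {a : Fin n → ℂ} {r : ℝ}
    (hs : ∀ J, tsupport (F J) ⊆ closedBall a r)
    (hFm : MemLp (coeffVec F) 2 (weightedMeasure φ)) {A : ℝ}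
    (hA : ∀ J, ∀ z ∈ closedBall a r, ‖F J z‖ ^ 2 * Real.exp (-φ z) ≤ A) :
    ‖formLp hFm‖ ^ 2 ≤ Fintype.card (MultiIndex n q)
      * (A * volume.real (closedBall (0 : Fin n → ℂ) r)) := by
  have hFc := fun J => hasCompactSupport_of_tsupport_subset_closedBall (hs J)
  rw [norm_sq_formLp hφ hF hFc]
  refine (Finset.sum_le_sum (g := fun _ => A * volume.real (closedBall (0 : Fin n → ℂ) r))
    fun J _ => ?_).trans (le_of_eq ?_)
  · have h1 : ∫ z, ‖F J z‖ ^ 2 * Real.exp (-φ z)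
        = ∫ z in closedBall a r, ‖F J z‖ ^ 2 * Real.exp (-φ z) := by
      refine (setIntegral_eq_integral_of_forall_compl_eq_zero fun z hz => ?_).symm
      rw [image_eq_zero_of_notMem_tsupport fun h => hz (hs J h)]
      simp
    have h2 : volume.real (closedBall (0 : Fin n → ℂ) r) = volume.real (closedBall a r) := by
      rw [measureReal_def, measureReal_def, Measure.addHaar_closedBall_center volume a]
    rw [h1, h2]
    have h3 := norm_setIntegral_le_of_norm_le_const (μ := volume) (s := closedBall a r)
      (f := fun z => ‖F J z‖ ^ 2 * Real.exp (-φ z)) (C := A) measure_closedBall_lt_top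
      fun z hz => by
        rw [Real.norm_of_nonneg (by positivity)]
        exact hA J z hz
    exact (le_abs_self _).trans h3
  · rw [Finset.sum_const, Finset.card_univ, nsmul_eq_mul]

/-- Test forms concentrated near an arbitrary point, orthogonal to the kernel of the complex
Laplacian, bounded away from zero and with bounded image. -/
theorem exists_test_forms (hφ : ContDiff ℝ 2 φ) (hq : q < n) {C : ℝ}
    (hC : ∀ z j k, ‖wirtingerBar k (wirtinger j fun w => (φ w : ℂ)) z‖ ≤ C) :
    ∃ B c : ℝ, 0 < c ∧ ∀ a : Fin n → ℂ, ∃ U : MultiIndex n (q + 1) → (Fin n → ℂ) → ℂ,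
      (∀ K, Continuous (U K)) ∧ (∀ K, tsupport (U K) ⊆ closedBall a (1 / 4)) ∧
      ∃ (hU : MemLp (coeffVec U) 2 (weightedMeasure φ)) (w : L2Forms φ (q + 1)),
        formLp hU ∈ (kernel (complexLaplacian φ hφ (q + 1)))ᗮ ∧
        (formLp hU, w) ∈ (complexLaplacian φ hφ (q + 1)).graph ∧ ‖w‖ ≤ B ∧
        c ≤ ‖formLp hU‖ ^ 2 := by
  obtain ⟨C', hC'⟩ := exists_gauge hφ hC
  obtain ⟨L, χ, K₀, hχ, hχs, hK₀⟩ := exists_monomialForm hq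
  set β := monomialForm L χ with hβdef
  have hβ : ∀ J, ContDiff ℝ ∞ (β J) := contDiff_monomialForm L hχ
  have hβs : ∀ J, tsupport (β J) ⊆ closedBall 0 (1 / 4) := fun J =>
    (tsupport_monomialForm_subset L χ J).trans hχs
  set α := dbarForm β with hαdef
  have hα : ∀ K, ContDiff ℝ ∞ (α K) := contDiff_dbarForm (by simp) hβ
  have hαs : ∀ K, tsupport (α K) ⊆ closedBall 0 (1 / 4) :=
    tsupport_dbarForm_subset isClosed_closedBall hβs
  have hαc := fun K => hasCompactSupport_of_tsupport_subset_closedBall (hαs K)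
  obtain ⟨M₀, hM₀⟩ := exists_forall_norm_le (fun K => (hα K).continuous) hαc
  have hα1 : ∀ K l, ContDiff ℝ ∞ (wirtingerBar l (α K)) := fun K l =>
    contDiff_wirtingerBar (hα K) (by simp) l
  have hα1s : ∀ K l, tsupport (wirtingerBar l (α K)) ⊆ closedBall 0 (1 / 4) := fun K l =>
    closure_minimal (fun z hz => by
      by_contra h
      exact hz (wirtingerBar_eq_zero_of_notMem_tsupport (fun h' => h (hαs K h')) l))
      isClosed_closedBall
  obtain ⟨M₁, hM₁⟩ := exists_forall_norm_le
    (f := fun i : MultiIndex n (q + 1) × Fin n => wirtingerBar i.2 (α i.1))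
    (fun i => (hα1 i.1 i.2).continuous)
    fun i => hasCompactSupport_of_tsupport_subset_closedBall (hα1s i.1 i.2)
  obtain ⟨M₂, hM₂⟩ := exists_forall_norm_le
    (f := fun i : MultiIndex n (q + 1) × Fin n × Fin n =>
      wirtinger i.2.1 (wirtingerBar i.2.2 (α i.1)))
    (fun i => (contDiff_wirtinger (m := ∞) (hα1 i.1 i.2.2) (by simp) i.2.1).continuous)
    fun i => hasCompactSupport_of_tsupport_subset_closedBall (a := 0) (r := 1 / 4) <|
      closure_minimal (fun z hz => by
        by_contra h
        exact hz (wirtinger_eq_zero_of_notMem_tsupport (fun h' => h (hα1s i.1 i.2.2 h')) i.2.1))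
      isClosed_closedBall
  set M := max M₀ (max M₁ M₂) with hM
  set D : ℝ := (q + 1) * (Fintype.card (MultiIndex n (q + 1)) * ((q + 1) *
    (M * (1 + C' + C)))) with hD
  set B₂ : ℝ := Fintype.card (MultiIndex n (q + 1))
    * (D ^ 2 * Real.exp C' * volume.real (closedBall (0 : Fin n → ℂ) (1 / 4))) with hB₂
  have hcont : Continuous fun z => ‖α K₀ z‖ ^ 2 := (hα K₀).continuous.norm.pow 2
  have hcs : HasCompactSupport fun z => ‖α K₀ z‖ ^ 2 :=
    (hαc K₀).comp_left (g := fun x : ℂ => ‖x‖ ^ 2) (by simp)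
  have hpos : 0 < ∫ z, ‖α K₀ z‖ ^ 2 := by
    refine hcont.integral_pos_of_hasCompactSupport_nonneg_nonzero hcs (fun z => by positivity)
      (x := 0) ?_
    exact pow_ne_zero _ (norm_ne_zero_iff.2 hK₀)
  -- Both constants depend only on the model form and on the uniform bounds, and are fixed before
  -- `a`. The second is the unweighted mass of one nonzero coefficient times the lower bound for
  -- `|e^h|² e^{-φ}`.
  refine ⟨√B₂, Real.exp (-C') * ∫ z, ‖α K₀ z‖ ^ 2, mul_pos (Real.exp_pos _) hpos, fun a => ?_⟩
  obtain ⟨h, hh, hh'⟩ := hC' a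
  have hg : IsGauge φ C' a h := ⟨hh, fun z hz => (hh' z hz).1, fun z hz => (hh' z hz).2.1,
    fun z hz => (hh' z hz).2.2⟩
  set F : MultiIndex n q → (Fin n → ℂ) → ℂ := fun J => gauged h a (β J) with hF
  set U : MultiIndex n (q + 1) → (Fin n → ℂ) → ℂ := fun K => gauged h a (α K) with hU
  have hdF : dbarForm F = U := hg.dbarForm_gauged (fun J => (hβ J).of_le (by simp)) hβs
  have hFd : ∀ J, ContDiff ℝ ∞ (F J) := fun J => hg.contDiff_gauged le_rfl (hβ J)
  have hUd : ∀ K, ContDiff ℝ ∞ (U K) := fun K => hg.contDiff_gauged le_rfl (hα K)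
  have hUd2 : ∀ K, ContDiff ℝ 2 (U K) := fun K => (hUd K).of_le two_le_infty
  have hFs : ∀ J, tsupport (F J) ⊆ closedBall a (1 / 4) := fun J =>
    tsupport_gauged_subset h a (hβs J)
  have hUs : ∀ K, tsupport (U K) ⊆ closedBall a (1 / 4) := fun K =>
    tsupport_gauged_subset h a (hαs K)
  have hUc := fun K => hasCompactSupport_of_tsupport_subset_closedBall (hUs K)
  have hFm := memLp_coeffVec hφ (fun J => (hFd J).continuous)
    fun J => hasCompactSupport_of_tsupport_subset_closedBall (hFs J)
  have hUm := memLp_coeffVec hφ (fun K => (hUd K).continuous) hUc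
  set V := dbarStarForm φ U with hV
  have hVd : ∀ J, ContDiff ℝ 1 (V J) := contDiff_dbarStarForm hφ hUd2
  have hVs : ∀ J, tsupport (V J) ⊆ closedBall a (1 / 4) :=
    tsupport_dbarStarForm_subset isClosed_closedBall hUs
  have hVc := fun J => hasCompactSupport_of_tsupport_subset_closedBall (hVs J)
  have hVm := memLp_coeffVec hφ (fun J => (hVd J).continuous) hVc
  have hWd : ∀ K, Continuous (dbarForm V K) := fun K =>
    (contDiff_dbarForm (m := 0) (by simp) hVd K).continuous
  have hWs : ∀ K, tsupport (dbarForm V K) ⊆ closedBall a (1 / 4) :=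
    tsupport_dbarForm_subset isClosed_closedBall hVs
  have hWm := memLp_coeffVec hφ hWd
    fun K => hasCompactSupport_of_tsupport_subset_closedBall (hWs K)
  have hdU : dbarForm U = fun _ _ => 0 := by
    funext K z
    rw [← hdF]
    exact dbarForm_dbarForm (fun J => (hFd J).of_le two_le_infty) K z
  have hdUm : MemLp (coeffVec (dbarForm U)) 2 (weightedMeasure φ) := by
    rw [hdU]
    exact memLp_coeffVec hφ (fun _ => continuous_const) fun _ => HasCompactSupport.zero
  have hdU0 : formLp hdUm = 0 := by
    have h1 := norm_sq_formLp hφ (F := dbarForm U) (by simp [hdU, continuous_const])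
      (by rw [hdU]; exact fun _ => HasCompactSupport.zero) hdUm
    simpa [hdU] using h1
  refine ⟨U, fun K => (hUd K).continuous, hUs, hUm, formLp hWm, ?_, ?_, ?_, ?_⟩
  · have hdFm : MemLp (coeffVec (dbarForm F)) 2 (weightedMeasure φ) := hdF ▸ hUm
    have h1 := formLp_mem_dbarGraph hφ (fun J => (hFd J).of_le (by simp)) hFm hdFm
    have h2 : formLp hdFm = formLp hUm := by congr 1
    rw [h2] at h1
    exact mem_kernel_orthogonal hφ h1
  -- As `U = ∂̄F` is closed, only the `∂̄∂̄*` part of the Laplacian contributes.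
  · refine (mem_complexLaplacian_graph hφ).2 ⟨formLp hVm, 0, formLp hWm, 0, ?_, ?_, ?_,
      (dbarStar φ hφ (q + 1)).graph.zero_mem, add_zero _⟩
    · exact (mem_dbarStar_graph hφ).2 fun x v hxv => inner_formLp_dbarStarForm hφ
        (fun K => (hUd K).of_le (by simp)) hUc hUm hVm hVc (fun J => (hVd J).continuous) hxv
    · exact formLp_mem_dbarGraph hφ hVd hVm hWm
    · rw [← hdU0]
      exact formLp_mem_dbarGraph hφ (fun K => (hUd K).of_le (by simp)) hUm hdUm
  · refine Real.le_sqrt_of_sq_le (norm_sq_formLp_le hφ hWd hWs hWm fun K z hz => ?_)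
    have hz' : z ∈ ball a (1 / 2) := closedBall_subset_ball (by norm_num) hz
    have h1 := hg.norm_dbarForm_dbarStarForm_le hφ hC hα
      (fun K z => (hM₀ K z).trans (le_max_left _ _))
      (fun K z l => (hM₁ (K, l) z).trans ((le_max_left _ _).trans (le_max_right _ _)))
      (fun K z j l => (hM₂ (K, j, l) z).trans ((le_max_right _ _).trans (le_max_right _ _))) hz' K
    have h2 : ‖dbarForm V K z‖ ≤ D * ‖Complex.exp (h z)‖ := by
      refine h1.trans (le_of_eq ?_)
      rw [hD]
      ring
    calc ‖dbarForm V K z‖ ^ 2 * Real.exp (-φ z)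
        ≤ (D * ‖Complex.exp (h z)‖) ^ 2 * Real.exp (-φ z) := by gcongr
      _ = D ^ 2 * (‖Complex.exp (h z)‖ ^ 2 * Real.exp (-φ z)) := by ring
      _ ≤ D ^ 2 * Real.exp C' := by
        gcongr
        exact hg.norm_exp_sq_le hz'
  · rw [norm_sq_formLp hφ (fun K => (hUd K).continuous) hUc, ← integral_const_mul]
    refine le_trans ?_ (Finset.single_le_sum
      (f := fun J => ∫ z, ‖U J z‖ ^ 2 * Real.exp (-φ z))
      (fun J _ => integral_nonneg fun z => by positivity) (Finset.mem_univ K₀))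
    rw [← integral_sub_right_eq_self _ a]
    refine integral_mono ?_ ?_ fun z => ?_
    · exact ((hcont.integrable_of_hasCompactSupport hcs).const_mul _).comp_sub_right a
    · refine Continuous.integrable_of_hasCompactSupport
        (((hUd K₀).continuous.norm.pow 2).mul (Real.continuous_exp.comp hφ.continuous.neg)) ?_
      exact ((hUc K₀).comp_left (g := fun x : ℂ => ‖x‖ ^ 2) (by simp)).mul_right
    · by_cases hz : z ∈ ball a (1 / 2)
      · have h1 := mul_le_mul_of_nonneg_right (hg.le_norm_exp_sq hz) (sq_nonneg ‖α K₀ (z - a)‖)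
        refine h1.trans (le_of_eq ?_)
        simp only [hU, gauged, norm_mul]
        ring
      · have h1 : α K₀ (z - a) = 0 := by
          refine image_eq_zero_of_notMem_tsupport fun h => hz ?_
          have h2 := hαs K₀ h
          rw [mem_closedBall_zero_iff, ← dist_eq_norm] at h2
          exact mem_ball.2 (h2.trans_lt (by norm_num))
        refine le_trans (le_of_eq (b := 0) ?_) (mul_nonneg (sq_nonneg _) (Real.exp_nonneg _))
        simp [h1]

theorem not_compactDbarNeumann_of_bounded (hφ : ContDiff ℝ 2 φ) (hq : q < n) {C : ℝ}
    (hC : ∀ z j k, ‖wirtingerBar k (wirtinger j fun w => (φ w : ℂ)) z‖ ≤ C) :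
    ¬ CompactDbarNeumann φ hφ (q + 1) := by
  obtain ⟨B, c, hc, hU⟩ := exists_test_forms hφ hq hC
  -- Centres on the diagonal at mutual distance at least `3`, with supports of radius `1/4`:
  -- disjointness makes the forms orthogonal, so `‖u_k - u_l‖² = ‖u_k‖² + ‖u_l‖² ≥ c`.
  choose U hUc hUs hUm w hker hgr hw hn using fun k : ℕ => hU fun _ => ((3 * k : ℝ) : ℂ)
  refine not_compactDbarNeumann hφ hker hgr hw (Real.sqrt_pos.2 hc) fun k l hkl => ?_
  have hzero : ∀ K z, U k K z = 0 ∨ U l K z = 0 := by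
    intro K z
    by_contra! hz
    have h1 := hUs k K (subset_tsupport _ hz.1)
    have h2 := hUs l K (subset_tsupport _ hz.2)
    have h3 := (dist_triangle_left _ _ z).trans (add_le_add h1 h2)
    -- A coordinate exists because `q < n`.
    have h4 := (dist_le_pi_dist _ _ (⟨0, by omega⟩ : Fin n)).trans h3
    simp only [Complex.dist_eq, ← Complex.ofReal_sub, Complex.norm_real, Real.norm_eq_abs] at h4
    rcases lt_or_gt_of_ne hkl with h | h
    · have h5 : (k : ℝ) + 1 ≤ l := by exact_mod_cast h
      have := (abs_le.1 h4).1
      linarith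
    · have h5 : (l : ℝ) + 1 ≤ k := by exact_mod_cast h
      have := (abs_le.1 h4).2
      linarith
  have h0 : inner ℂ (formLp (hUm k)) (formLp (hUm l)) = 0 := inner_formLp_eq_zero hφ (hUc k)
    (fun K => hasCompactSupport_of_tsupport_subset_closedBall (hUs k K)) _ _ hzero
  have h1 := norm_sub_sq (𝕜 := ℂ) (formLp (hUm k)) (formLp (hUm l))
  rw [h0, map_zero] at h1
  refine Real.sqrt_le_iff.2 ⟨norm_nonneg _, ?_⟩
  have := hn k
  have := sq_nonneg ‖formLp (hUm l)‖
  linarith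

end TestSequence

end WeightedDbar

theorem theorem3p1 {n : ℕ} (φ : (Fin n → ℂ) → ℝ) (hφ : ContDiff ℝ 2 φ)
    (hpsh : WeightedDbar.Plurisubharmonic φ)
    (hinf : ¬ FiniteDimensional ℂ (WeightedDbar.bergmanSpace φ hφ))
    (hcpt : ∃ q : ℕ, 1 ≤ q ∧ q ≤ n ∧ WeightedDbar.CompactDbarNeumann φ hφ q) :
    Filter.limsup (fun z : Fin n → ℂ => (((WeightedDbar.complexHessian φ z).trace.re : ℝ) : EReal))
      (Filter.cocompact (Fin n → ℂ)) = ⊤ := by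
  by_contra hlim
  obtain ⟨q, hq1, hqn, hN⟩ := hcpt
  obtain ⟨q, rfl⟩ := Nat.exists_eq_add_of_le' hq1
  obtain ⟨C, hC⟩ := WeightedDbar.exists_trace_le_of_limsup_ne_top hφ hlim
  -- The factor `2` is that of `Plurisubharmonic.norm_complexHessian_le`. After the shift of `q`,
  -- `hqn` reads `q + 1 ≤ n`, which is `q < n`.
  refine WeightedDbar.not_compactDbarNeumann_of_bounded hφ hqn (C := 2 * C) (fun z j k => ?_) hN
  have hφc : ContDiff ℝ 2 fun w => (φ w : ℂ) := Complex.ofRealCLM.contDiff.comp hφ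
  rw [WeightedDbar.wirtingerBar_wirtinger hφc]
  refine (hpsh.norm_complexHessian_le hφ z j k).trans ?_
  linarith [hC z]
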